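/- Let $F$ be a local field of characteristic zero, $D/F$ a quadratic field extension and $\tau$ the non-trivial automorphism of $D$ over $F$. **Conventions.** All spaces are finite-dimensional. All groups are algebraic groups over $F$; in particular, for a linear (resp. hermitian) space $W$ over a finite extension of $F$, $GL(W)$ (resp. $U(W)$) denotes the algebraic group over $F$ whose $F$-points are the linear automorphisms (resp. unitary transformations) of $W$. A hermitian space over a field with involution is a linear space with a non-degenerate hermitian form. An extension $(D',\tau')$ of $(D,\tau)$ is a finite field extension $D'/D$ with an involution $\tau'$ of $D'$ that restricts to $\tau$ on $D$. A symmetric pair $(G,H,\theta)$ consists of a reductive group $G$, an involution $\theta$ of $G$ and $H=G^\theta$. The product of symmetric pairs is $(G_1\times G_2,H_1\times H_2,\theta_1\times\theta_2)$, and an isomorphism of symmetric pairs is an isomorphism of the groups $G$ that commutes with the involutions. For $\varepsilon\in G(F)$ with $\varepsilon^2=1$ let $(G,G_\varepsilon)$ be the symmetric pair with $\theta(y)=\varepsilon y\varepsilon$. For $g\in G(F)$ put $s(g)=g\,\theta(g^{-1})$. A descendant of $(G,H,\theta)$ is a triple $(G_x,H_x,\theta|_{G_x})$ with $x=s(g)$,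 where $g\in G(F)$ is such that $HgH$ is (Zariski) closed in $G$, and $G_x,H_x$ are the centralizers of $x$ in $G$ and in $H$. **Theorem.** Let $V$ be a hermitian space over $(D,\tau)$ and let $\varepsilon\in U(V)$ be an element of order $2$. Then every descendant of $(U(V),U(V)_\varepsilon)$ is isomorphic to a finite product of symmetric pairs of the following types: (i) $(GL(W)\times GL(W),\Delta GL(W))$, with $\theta(a,b)=(b,a)$, for a linear space $W$ over a finite extension $D'$ of $D$; (ii) $(U(W)\times U(W),\Delta U(W))$, with $\theta(a,b)=(b,a)$, for a hermitian space $W$ over an extension $(D',\tau')$ of $(D,\tau)$; (iii) $(GL(W),U(W))$, with $\theta(a)=(a^{*})^{-1}$, for a hermitian space $W$ over an extension $(D',\tau')$ of $(D,\tau)$; (iv) $(GL(W_{D'}),GL(W))$, where $F'$ is a finite extension of $D$, $D'/F'$ is a quadratic extension, $W$ is a linear space over $F'$, $W_{D'}=W\otimes_{F'}D'$, and $\theta$ is conjugation by $1\otimes c$ with $c$ the non-trivial automorphism of $D'/F'$; (v) $(GL(W),GL(W)_{\varepsilon'})$, where $W$ is a linear space over $D$ and $\varepsilon'\in GL(W)$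 has order at most $2$; (vi) $(U(W_E),U(W))$, where $W$ is a hermitian space over an extension $(D',\tau')$ of $(D,\tau)$, $E/D'$ is a quadratic extension with an involution $\tau''$ of $E$ that restricts to $\tau'$, $W_E=W\otimes_{D'}E$ carries the hermitian form over $(E,\tau'')$ that extends the form of $W$, and $\theta$ is conjugation by $1\otimes c$ with $c$ the non-trivial automorphism of $E/D'$; (vii) $(U(W),U(W)_{\varepsilon'})$, where $W$ is a hermitian space over $(D,\tau)$ and $\varepsilon'\in U(W)$ has order $2$. -/

import Mathlib

open CategoryTheory
open scoped TensorProduct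

universe u

noncomputable section

/-! ## Group functors and symmetric pairs

An algebraic group `G` over a field `F` is handled through its functor of points `R ↦ G(R)` on
commutative `F`-algebras.  By Yoneda, homomorphisms of algebraic groups are the same thing as
natural transformations of these functors, and an isomorphism of algebraic groups is a natural
isomorphism. -/

/-- Functors from commutative `F`-algebras to groups. -/
abbrev GroupFunctor (F : Type u) [Field F] := CommAlgCat.{u} F ⥤ GrpCat.{u}

namespace GroupFunctor

variable {F : Type u} [Field F]

/-- The structure morphism `F → R` of a commutative `F`-algebra. -/
def structMap (R : CommAlgCat.{u} F) : CommAlgCat.of F F ⟶ R :=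
  CommAlgCat.ofHom (Algebra.ofId F R)

theorem structMap_comp {R S : CommAlgCat.{u} F} (f : R ⟶ S) :
    structMap R ≫ f = structMap S := by
  apply CommAlgCat.hom_ext
  exact Subsingleton.elim _ _

/-- The image in `G(R)` of an `F`-point of `G`. -/
def ofPoint (G : GroupFunctor F) (g : G.obj (CommAlgCat.of F F)) (R : CommAlgCat.{u} F) :
    G.obj R :=
  G.map (structMap R) g

theorem map_ofPoint (G : GroupFunctor F) (g : G.obj (CommAlgCat.of F F))
    {R S : CommAlgCat.{u} F} (f : R ⟶ S) : G.map f (G.ofPoint g R) = G.ofPoint g S := by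
  simp only [ofPoint, ← structMap_comp f, Functor.map_comp, GrpCat.comp_apply]

/-- The subgroup functor of `G` given by a compatible family of subgroups `H R ≤ G(R)`. -/
def sub (G : GroupFunctor F) (H : ∀ R : CommAlgCat.{u} F, Subgroup (G.obj R))
    (hH : ∀ {R S : CommAlgCat.{u} F} (f : R ⟶ S) (x : G.obj R), x ∈ H R → G.map f x ∈ H S) :
    GroupFunctor F where
  obj R := GrpCat.of (H R)
  map f := GrpCat.ofHom
    (((G.map f).hom.comp (H _).subtype).codRestrict (H _) fun x => hH f x.1 x.2)
  map_id R := by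
    ext x
    exact ConcreteCategory.congr_hom (G.map_id R) x.1
  map_comp f g := by
    ext x
    exact ConcreteCategory.congr_hom (G.map_comp f g) x.1

/-- The centralizer `G_x` of an `F`-point `x`, that is
`G_x(R) = {y ∈ G(R) | y x = x y}`. -/
def centralizer (G : GroupFunctor F) (x : G.obj (CommAlgCat.of F F)) : GroupFunctor F :=
  G.sub (fun R => Subgroup.centralizer {G.ofPoint x R}) (by
    intro R S f y hy
    rw [Subgroup.mem_centralizer_singleton_iff] at hy ⊢
    rw [← G.map_ofPoint x f, ← map_mul, ← map_mul, hy])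

/-- The product of finitely many group functors. -/
def pi {ι : Type} (G : ι → GroupFunctor F) : GroupFunctor F where
  obj R := GrpCat.of (∀ i, (G i).obj R)
  map f := GrpCat.ofHom (MonoidHom.mk' (fun x i => (G i).map f (x i)) (by
    intro a b; funext i; simp))
  map_id R := by
    ext x i
    exact ConcreteCategory.congr_hom ((G i).map_id R) (x i)
  map_comp f g := by
    ext x i
    exact ConcreteCategory.congr_hom ((G i).map_comp f g) (x i)

/-- The product `G × G`. -/
def square (G : GroupFunctor F) : GroupFunctor F where
  obj R := GrpCat.of (G.obj R × G.obj R)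
  map f := GrpCat.ofHom ((G.map f).hom.prodMap (G.map f).hom)
  map_id R := by
    ext x
    · exact ConcreteCategory.congr_hom (G.map_id R) x.1
    · exact ConcreteCategory.congr_hom (G.map_id R) x.2
  map_comp f g := by
    ext x
    · exact ConcreteCategory.congr_hom (G.map_comp f g) x.1
    · exact ConcreteCategory.congr_hom (G.map_comp f g) x.2

/-- A regular function on the base change `G_K` of `G` to an extension `K` of `F`: a family of
functions `G(S) → S` that is natural in the `K`-algebra `S` (a morphism from `G_K` to the affine
line over `K`). -/
structure RegularFunction (G : GroupFunctor F) (K : Type u) [Field K] [Algebra F K] where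
  toFun : ∀ (S : Type u) [CommRing S] [Algebra F S] [Algebra K S] [IsScalarTower F K S],
    G.obj (CommAlgCat.of F S) → S
  natural : ∀ (S T : Type u) [CommRing S] [Algebra F S] [Algebra K S] [IsScalarTower F K S]
    [CommRing T] [Algebra F T] [Algebra K T] [IsScalarTower F K T] (φ : S →ₐ[K] T)
    (x : G.obj (CommAlgCat.of F S)),
    toFun T (G.map (CommAlgCat.ofHom (φ.restrictScalars F)) x) = φ (toFun S x)

/-- Zariski closed subsets of `G(K)`: those that contain every common zero of the regular functions
on `G_K` that vanish on them. -/
def IsZariskiClosed (G : GroupFunctor F) (K : Type u) [Field K] [Algebra F K]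
    (Z : Set (G.obj (CommAlgCat.of F K))) : Prop :=
  ∀ x : G.obj (CommAlgCat.of F K),
    (∀ f : G.RegularFunction K, (∀ z ∈ Z, f.toFun K z = 0) → f.toFun K x = 0) → x ∈ Z

end GroupFunctor

/-- A symmetric pair `(G, H, θ)`: a group `G` with an involution `θ`; the subgroup `H` is the
group `G^θ` of fixed points of `θ`, see `SymmetricPair.fixed`. -/
structure SymmetricPair (F : Type u) [Field F] where
  /-- The group `G`. -/
  G : GroupFunctor F
  /-- The involution `θ`. -/
  θ : G ⟶ G
  involutive : θ ≫ θ = 𝟙 G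

namespace SymmetricPair

variable {F : Type u} [Field F]

theorem θ_θ (P : SymmetricPair F) (R : CommAlgCat.{u} F) (x : P.G.obj R) :
    P.θ.app R (P.θ.app R x) = x := by
  have h := congrArg (fun α => NatTrans.app α R) P.involutive
  exact ConcreteCategory.congr_hom h x

theorem map_θ (P : SymmetricPair F) {R S : CommAlgCat.{u} F} (f : R ⟶ S) (x : P.G.obj R) :
    P.G.map f (P.θ.app R x) = P.θ.app S (P.G.map f x) := by
  have h := ConcreteCategory.congr_hom (P.θ.naturality f) x
  exact h.symm

theorem θ_ofPoint (P : SymmetricPair F) (x : P.G.obj (CommAlgCat.of F F)) (R : CommAlgCat.{u} F) :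
    P.θ.app R (P.G.ofPoint x R) = P.G.ofPoint (P.θ.app _ x) R :=
  (P.map_θ _ x).symm

/-- `H(R)`, where `H = G^θ`. -/
def fixed (P : SymmetricPair F) (R : CommAlgCat.{u} F) : Subgroup (P.G.obj R) where
  carrier := {x | P.θ.app R x = x}
  mul_mem' {a b} ha hb := by
    change P.θ.app R (a * b) = a * b
    rw [map_mul, show P.θ.app R a = a from ha, show P.θ.app R b = b from hb]
  one_mem' := map_one (P.θ.app R).hom
  inv_mem' {a} ha := by
    change P.θ.app R a⁻¹ = a⁻¹
    rw [map_inv, show P.θ.app R a = a from ha]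

/-- Two symmetric pairs are isomorphic if there is an isomorphism of groups that commutes with the
involutions (and hence identifies the subgroups `H`). -/
def Isomorphic (P Q : SymmetricPair F) : Prop :=
  ∃ e : P.G ≅ Q.G, P.θ ≫ e.hom = e.hom ≫ Q.θ

/-- The product of finitely many symmetric pairs. -/
def pi {ι : Type} (P : ι → SymmetricPair F) : SymmetricPair F where
  G := GroupFunctor.pi fun i => (P i).G
  θ :=
    { app := fun R => GrpCat.ofHom (MonoidHom.mk' (fun x i => (P i).θ.app R (x i)) (by
        intro a b; funext i; exact map_mul ((P i).θ.app R).hom (a i) (b i)))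
      naturality := by
        intro R S f
        ext x
        funext i
        exact ((P i).map_θ f (x i)).symm }
  involutive := by
    ext R x
    funext i
    exact (P i).θ_θ R (x i)

/-- The symmetrization map `s(g) = g σ(g) = g θ(g)⁻¹` on `F`-points. -/
def symmetrization (P : SymmetricPair F) (g : P.G.obj (CommAlgCat.of F F)) :
    P.G.obj (CommAlgCat.of F F) :=
  g * P.θ.app _ g⁻¹

theorem θ_symmetrization (P : SymmetricPair F) (g : P.G.obj (CommAlgCat.of F F)) :
    P.θ.app _ (P.symmetrization g) = (P.symmetrization g)⁻¹ := by
  simp only [symmetrization, map_mul, map_inv, θ_θ, mul_inv_rev, inv_inv]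

/-- The set of `K`-points of the double coset `H g H`, for an algebraically closed extension `K`
of `F`. -/
def doubleCoset (P : SymmetricPair F) (g : P.G.obj (CommAlgCat.of F F)) (K : Type u) [Field K]
    [Algebra F K] : Set (P.G.obj (CommAlgCat.of F K)) :=
  {y | ∃ a ∈ P.fixed (CommAlgCat.of F K), ∃ b ∈ P.fixed (CommAlgCat.of F K),
    y = a * P.G.ofPoint g _ * b}

/-- The double coset `H g H` is (Zariski) closed in `G`. -/
def DoubleCosetClosed (P : SymmetricPair F) (g : P.G.obj (CommAlgCat.of F F)) : Prop :=
  P.G.IsZariskiClosed (AlgebraicClosure F) (P.doubleCoset g (AlgebraicClosure F))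

theorem θ_mem_centralizer (P : SymmetricPair F) (x : P.G.obj (CommAlgCat.of F F))
    (hx : P.θ.app _ x = x⁻¹) (R : CommAlgCat.{u} F) (y : P.G.obj R)
    (hy : y ∈ Subgroup.centralizer {P.G.ofPoint x R}) :
    P.θ.app R y ∈ Subgroup.centralizer {P.G.ofPoint x R} := by
  rw [Subgroup.mem_centralizer_singleton_iff] at hy ⊢
  have h : P.θ.app R (P.G.ofPoint x R) = (P.G.ofPoint x R)⁻¹ := by
    rw [θ_ofPoint, hx]; exact map_inv (P.G.map (GroupFunctor.structMap R)).hom x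
  have h2 := congrArg (P.θ.app R) hy
  rw [map_mul, map_mul, h] at h2
  have h3 : Commute (P.θ.app R y) (P.G.ofPoint x R)⁻¹ := h2
  simpa using h3.inv_right.eq

/-- The triple `(G_x, H_x, θ|_{G_x})` for an `F`-point `x` with `θ(x) = x⁻¹`. -/
def centralizerPair (P : SymmetricPair F) (x : P.G.obj (CommAlgCat.of F F))
    (hx : P.θ.app _ x = x⁻¹) : SymmetricPair F where
  G := P.G.centralizer x
  θ :=
    { app := fun R => GrpCat.ofHom
        (((P.θ.app R).hom.comp (Subgroup.centralizer {P.G.ofPoint x R}).subtype).codRestrict _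
          fun y => P.θ_mem_centralizer x hx R y.1 y.2)
      naturality := by
        intro R S f
        ext y
        exact Subtype.ext (P.map_θ f y.1).symm }
  involutive := by
    ext R y
    exact Subtype.ext (P.θ_θ R y.1)

/-- `Q` is a descendant of `P = (G, H, θ)`: it is `(G_x, H_x, θ|_{G_x})` with `x = s(g)` for some
`g ∈ G(F)` such that `H g H` is closed. -/
def IsDescendant (P Q : SymmetricPair F) : Prop :=
  ∃ g : P.G.obj (CommAlgCat.of F F), P.DoubleCosetClosed g ∧
    Q = P.centralizerPair (P.symmetrization g) (P.θ_symmetrization g)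

/-- The pair `(G × G, ΔG)`, with the involution `(a, b) ↦ (b, a)`. -/
def diagonal (G : GroupFunctor F) : SymmetricPair F where
  G := G.square
  θ :=
    { app := fun R => GrpCat.ofHom
        (MulEquiv.prodComm : G.obj R × G.obj R ≃* G.obj R × G.obj R).toMonoidHom
      naturality := by
        intro R S f
        ext x
        rfl }
  involutive := by
    ext R x
    rfl

/-- The pair `(G, G_ε)` for `ε ∈ G(F)` with `ε² = 1`, with the involution `x ↦ ε x ε`. -/
def inner (G : GroupFunctor F) (ε : G.obj (CommAlgCat.of F F)) (hε : ε ^ 2 = 1) :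
    SymmetricPair F where
  G := G
  θ :=
    { app := fun R => GrpCat.ofHom (MonoidHom.mk' (fun x => G.ofPoint ε R * x * G.ofPoint ε R) (by
        have h : G.ofPoint ε R * G.ofPoint ε R = 1 := by
          rw [GroupFunctor.ofPoint, ← map_mul, ← sq, hε, map_one]
        intro a b
        calc G.ofPoint ε R * (a * b) * G.ofPoint ε R
            = G.ofPoint ε R * a * 1 * b * G.ofPoint ε R := by group
          _ = _ := by rw [← h]; group))
      naturality := by
        intro R S f
        ext x
        change G.ofPoint ε S * G.map f x * G.ofPoint ε S
          = G.map f (G.ofPoint ε R * x * G.ofPoint ε R)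
        rw [map_mul, map_mul, G.map_ofPoint] }
  involutive := by
    ext R x
    have h : G.ofPoint ε R * G.ofPoint ε R = 1 := by
      rw [GroupFunctor.ofPoint, ← map_mul, ← sq, hε, map_one]
    change G.ofPoint ε R * (G.ofPoint ε R * x * G.ofPoint ε R) * G.ofPoint ε R = x
    calc G.ofPoint ε R * (G.ofPoint ε R * x * G.ofPoint ε R) * G.ofPoint ε R
        = (G.ofPoint ε R * G.ofPoint ε R) * x * (G.ofPoint ε R * G.ofPoint ε R) := by group
      _ = x := by rw [h]; group

end SymmetricPair

/-! ## Unit groups and unitary groups of finite-dimensional algebras -/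

/-- An anti-automorphism of order at most two of the `F`-algebra `A` (an involution of `A`,
`F`-linear). -/
structure AlgInvolution (F A : Type u) [Field F] [Ring A] [Algebra F A] where
  toLin : A →ₗ[F] A
  map_mul : ∀ a b, toLin (a * b) = toLin b * toLin a
  involutive : ∀ a, toLin (toLin a) = a

namespace AlgInvolution

variable {F A : Type u} [Field F] [Ring A] [Algebra F A]

theorem map_one (σ : AlgInvolution F A) : σ.toLin 1 = 1 := by
  have h := σ.map_mul (σ.toLin 1) 1
  rw [mul_one, σ.involutive, mul_one] at h
  exact h.symm

/-- The extension of an involution of `A` to `R ⊗ A`. -/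
def ext (σ : AlgInvolution F A) (R : Type u) [CommRing R] [Algebra F R] :
    R ⊗[F] A →ₗ[F] R ⊗[F] A :=
  σ.toLin.lTensor R

variable (σ : AlgInvolution F A) (R : Type u) [CommRing R] [Algebra F R]

theorem ext_tmul (r : R) (a : A) : σ.ext R (r ⊗ₜ a) = r ⊗ₜ σ.toLin a := rfl

theorem ext_one : σ.ext R 1 = 1 := by
  rw [Algebra.TensorProduct.one_def, ext_tmul, map_one]

theorem ext_mul (x y : R ⊗[F] A) : σ.ext R (x * y) = σ.ext R y * σ.ext R x := by
  induction x with
  | zero => simp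
  | add x x' hx hx' => simp only [add_mul, mul_add, _root_.map_add, hx, hx']
  | tmul r a =>
    induction y with
    | zero => simp
    | add y y' hy hy' => simp only [add_mul, mul_add, _root_.map_add, hy, hy']
    | tmul s b =>
      simp only [Algebra.TensorProduct.tmul_mul_tmul, ext_tmul, σ.map_mul, mul_comm r s]

theorem ext_ext (x : R ⊗[F] A) : σ.ext R (σ.ext R x) = x := by
  induction x with
  | zero => simp
  | add x x' hx hx' => simp only [_root_.map_add, hx, hx']
  | tmul r a => simp only [ext_tmul, σ.involutive]

theorem ext_map {S : Type u} [CommRing S] [Algebra F S] (f : R →ₐ[F] S) (x : R ⊗[F] A) :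
    σ.ext S (Algebra.TensorProduct.map f (AlgHom.id F A) x)
      = Algebra.TensorProduct.map f (AlgHom.id F A) (σ.ext R x) := by
  induction x with
  | zero => simp
  | add x x' hx hx' => simp only [_root_.map_add, hx, hx']
  | tmul r a => simp only [ext_tmul, Algebra.TensorProduct.map_tmul, AlgHom.id_apply]

end AlgInvolution

/-- The subgroup `{u ∈ (R ⊗ A)ˣ | σ(u) u = 1}` of `(R ⊗ A)ˣ`. -/
def AlgInvolution.unitarySubgroup {F A : Type u} [Field F] [Ring A] [Algebra F A]
    (σ : AlgInvolution F A) (R : Type u) [CommRing R] [Algebra F R] : Subgroup (R ⊗[F] A)ˣ where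
  carrier := {u | σ.ext R u.val * u.val = 1}
  one_mem' := by
    change σ.ext R 1 * 1 = 1
    rw [σ.ext_one R, mul_one]
  mul_mem' {a b} ha hb := by
    change σ.ext R (a.val * b.val) * (a.val * b.val) = 1
    rw [σ.ext_mul R, mul_assoc, ← mul_assoc _ a.val,
      show σ.ext R a.val * a.val = 1 from ha, one_mul]
    exact hb
  inv_mem' {a} ha := by
    have ha' : σ.ext R a.val * a.val = 1 := ha
    have h1 : σ.ext R a.val = (a⁻¹).val := by
      rw [← mul_one (σ.ext R a.val), ← Units.mul_inv a, ← mul_assoc, ha', one_mul]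
    change σ.ext R (a⁻¹).val * (a⁻¹).val = 1
    rw [← h1, σ.ext_ext R, h1, Units.mul_inv]

/-- The group of units of the `F`-algebra `A`, as an algebraic group over `F`:
`R ↦ (R ⊗ A)ˣ`. -/
def unitsFunctor (F A : Type u) [Field F] [Ring A] [Algebra F A] : GroupFunctor F where
  obj R := GrpCat.of (R ⊗[F] A)ˣ
  map f := GrpCat.ofHom
    (Units.map (Algebra.TensorProduct.map f.hom (AlgHom.id F A) : _ →* _))
  map_id R := by
    ext x
    change Algebra.TensorProduct.map (AlgHom.id F R) (AlgHom.id F A) x.val = x.val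
    rw [Algebra.TensorProduct.map_id, AlgHom.id_apply]
  map_comp {R S T} f g := by
    ext x
    change Algebra.TensorProduct.map (g.hom.comp f.hom) (AlgHom.id F A) x.val =
      Algebra.TensorProduct.map g.hom (AlgHom.id F A)
        (Algebra.TensorProduct.map f.hom (AlgHom.id F A) x.val)
    induction x.val with
    | zero => simp
    | add x x' hx hx' => simp only [_root_.map_add, hx, hx']
    | tmul r a => simp

/-- The unitary group of an algebra with involution, as an algebraic group over `F`:
`R ↦ {u ∈ (R ⊗ A)ˣ | σ(u) u = 1}`. -/
def unitaryFunctor {F A : Type u} [Field F] [Ring A] [Algebra F A] (σ : AlgInvolution F A) :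
    GroupFunctor F :=
  (unitsFunctor F A).sub
    (fun R => σ.unitarySubgroup R)
    (by
      intro R S f x hx
      change σ.ext S (Algebra.TensorProduct.map f.hom (AlgHom.id F A) x.val)
        * Algebra.TensorProduct.map f.hom (AlgHom.id F A) x.val = 1
      have hx' : σ.ext R x.val * x.val = 1 := hx
      rw [σ.ext_map R f.hom, ← map_mul, hx', map_one])

namespace SymmetricPair

variable {F A : Type u} [Field F] [Ring A] [Algebra F A]

/-- The pair `(Aˣ, U(A, σ))`, with the involution `a ↦ σ(a)⁻¹`. -/
def unitsUnitary (σ : AlgInvolution F A) : SymmetricPair F where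
  G := unitsFunctor F A
  θ :=
    { app := fun R => GrpCat.ofHom (MonoidHom.mk'
        (fun u : (R ⊗[F] A)ˣ => (⟨σ.ext R (u⁻¹).val, σ.ext R u.val,
          by rw [← σ.ext_mul R, Units.mul_inv, σ.ext_one R],
          by rw [← σ.ext_mul R, Units.inv_mul, σ.ext_one R]⟩ : (R ⊗[F] A)ˣ)) (by
          intro a b
          apply Units.ext
          change σ.ext R ((a * b)⁻¹).val = σ.ext R (a⁻¹).val * σ.ext R (b⁻¹).val
          rw [mul_inv_rev, Units.val_mul, σ.ext_mul R]))
      naturality := by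
        intro R S f
        ext x
        apply Units.ext
        exact σ.ext_map R f.hom _ }
  involutive := by
    ext R x
    apply Units.ext
    exact σ.ext_ext R _

/-- The extension of an algebra endomorphism `φ` of `A` to `R ⊗ A`. -/
def extHom (φ : A →ₐ[F] A) (R : CommAlgCat.{u} F) : R ⊗[F] A →ₐ[F] R ⊗[F] A :=
  Algebra.TensorProduct.map (AlgHom.id F R) φ

theorem extHom_map (φ : A →ₐ[F] A) {R S : CommAlgCat.{u} F} (f : R ⟶ S) (x : R ⊗[F] A) :
    extHom φ S (Algebra.TensorProduct.map f.hom (AlgHom.id F A) x)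
      = Algebra.TensorProduct.map f.hom (AlgHom.id F A) (extHom φ R x) := by
  induction x with
  | zero => simp
  | add x x' hx hx' => simp only [_root_.map_add, hx, hx']
  | tmul r a => simp [extHom]

theorem extHom_extHom (φ : A →ₐ[F] A) (hφ : ∀ a, φ (φ a) = a) (R : CommAlgCat.{u} F)
    (x : R ⊗[F] A) : extHom φ R (extHom φ R x) = x := by
  induction x with
  | zero => simp
  | add x x' hx hx' => simp only [_root_.map_add, hx, hx']
  | tmul r a => simp [extHom, hφ]

theorem ext_extHom (σ : AlgInvolution F A) (φ : A →ₐ[F] A)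
    (hσ : ∀ a, σ.toLin (φ a) = φ (σ.toLin a)) (R : CommAlgCat.{u} F) (x : R ⊗[F] A) :
    σ.ext R (extHom φ R x) = extHom φ R (σ.ext R x) := by
  induction x with
  | zero => simp
  | add x x' hx hx' => simp only [_root_.map_add, hx, hx']
  | tmul r a => simp [extHom, AlgInvolution.ext_tmul, hσ]

/-- The group `Aˣ` with the involution given by an automorphism `φ` of `A` with `φ² = 1`. -/
def unitsAut (φ : A →ₐ[F] A) (hφ : ∀ a, φ (φ a) = a) : SymmetricPair F where
  G := unitsFunctor F A
  θ :=
    { app := fun R => GrpCat.ofHom (Units.map (extHom φ R : _ →* _))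
      naturality := by
        intro R S f
        ext x
        apply Units.ext
        exact extHom_map φ f _ }
  involutive := by
    ext R x
    apply Units.ext
    exact extHom_extHom φ hφ R _

/-- The endomorphism of `{u ∈ (R ⊗ A)ˣ | σ(u) u = 1}` induced by an endomorphism `φ` of `A` that
commutes with `σ`. -/
def unitaryExtHom (σ : AlgInvolution F A) (φ : A →ₐ[F] A)
    (hσ : ∀ a, σ.toLin (φ a) = φ (σ.toLin a)) (R : CommAlgCat.{u} F) :
    σ.unitarySubgroup R →* σ.unitarySubgroup R :=
  ((Units.map (extHom φ R : _ →* _)).comp (σ.unitarySubgroup R).subtype).codRestrict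
    (σ.unitarySubgroup R) (by
      intro u
      change σ.ext R (extHom φ R u.1.val) * extHom φ R u.1.val = 1
      have hu : σ.ext R u.1.val * u.1.val = 1 := u.2
      rw [ext_extHom σ φ hσ, ← map_mul, hu, map_one])

/-- The group `U(A, σ)` with the involution given by an automorphism `φ` of `A` with `φ² = 1` that
commutes with `σ`. -/
def unitaryAut (σ : AlgInvolution F A) (φ : A →ₐ[F] A) (hφ : ∀ a, φ (φ a) = a)
    (hσ : ∀ a, σ.toLin (φ a) = φ (σ.toLin a)) : SymmetricPair F where
  G := unitaryFunctor σ
  θ :=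
    { app := fun R => GrpCat.ofHom (X := σ.unitarySubgroup R) (Y := σ.unitarySubgroup R)
        (unitaryExtHom σ φ hσ R)
      naturality := by
        intro R S f
        ext x
        apply Subtype.ext
        apply Units.ext
        exact extHom_map φ f _ }
  involutive := by
    ext R x
    apply Subtype.ext
    apply Units.ext
    exact extHom_extHom φ hφ R _

end SymmetricPair

/-! ## General linear groups and unitary groups of hermitian spaces -/

section Hermitian

variable {F D : Type u} [Field F] [Field D] [Algebra F D]

/-- `GL(W)` for a finite-dimensional linear space `W` over an extension `D` of `F`, as an algebraic
group over `F` (restriction of scalars from `D`): its `R`-points are the units of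
`R ⊗_F End_D(W) = End_{R ⊗_F D}(R ⊗_F W)`. -/
def GLFunctor (F D W : Type u) [Field F] [Field D] [Algebra F D] [AddCommGroup W] [Module D W]
    [Module F W] [IsScalarTower F D W] : GroupFunctor F :=
  unitsFunctor F (Module.End D W)

/-- A non-degenerate hermitian form on the linear space `V` over `(D, τ)`; it is `τ`-linear in the
first variable and linear in the second one. -/
structure HermitianForm (τ : D ≃ₐ[F] D) (V : Type u) [AddCommGroup V] [Module D V] where
  form : V →ₛₗ[(τ : D →+* D)] V →ₗ[D] D
  isSymm : form.IsSymm
  nondegenerate : form.Nondegenerate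

namespace HermitianForm

variable {τ : D ≃ₐ[F] D} {V : Type u} [AddCommGroup V] [Module D V] (B : HermitianForm τ V)

theorem symm (v w : V) : τ (B.form v w) = B.form w v := B.isSymm.eq v w

theorem ext_right {x y : V} (h : ∀ v, B.form v x = B.form v y) : x = y := by
  rw [← sub_eq_zero]
  exact B.nondegenerate.2 _ fun v => by rw [map_sub, h, sub_self]

theorem injective : Function.Injective B.form := by
  intro x y h
  rw [← sub_eq_zero]
  exact B.nondegenerate.1 _ fun v => by rw [map_sub, h, sub_self, LinearMap.zero_apply]

theorem surjective [FiniteDimensional D V] : Function.Surjective B.form := by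
  have : RingHomSurjective (τ : D →+* D) := ⟨τ.surjective⟩
  rw [← LinearMap.range_eq_top]
  by_contra hne
  obtain ⟨f, hf, hle⟩ := Submodule.exists_le_ker_of_lt_top _ (lt_top_iff_ne_top.2 hne)
  obtain ⟨v, rfl⟩ := (Module.evalEquiv D V).surjective f
  apply hf
  have hv : v = 0 := B.nondegenerate.2 v fun u => by
    have := hle (LinearMap.mem_range_self B.form u)
    simpa using this
  rw [hv, map_zero]

/-- The bijection `v ↦ B(v, ·)` between `V` and its dual space. -/
def toDual [FiniteDimensional D V] : V ≃ Module.Dual D V :=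
  Equiv.ofBijective B.form ⟨B.injective, B.surjective⟩

theorem form_toDual_symm [FiniteDimensional D V] (l : Module.Dual D V) :
    B.form (B.toDual.symm l) = l :=
  B.toDual.apply_symm_apply l

/-- The adjoint `f^*` of an endomorphism `f` of a hermitian space. -/
def adjoint [FiniteDimensional D V] (f : Module.End D V) : Module.End D V where
  toFun w := B.toDual.symm ((B.form w).comp f)
  map_add' x y := by
    apply B.injective
    simp only [map_add, form_toDual_symm, LinearMap.add_comp]
  map_smul' c x := by
    apply B.injective
    simp only [map_smulₛₗ, form_toDual_symm, LinearMap.smul_comp, RingHom.id_apply]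

variable [FiniteDimensional D V]

/-- The defining property of the adjoint. -/
theorem adjoint_left (f : Module.End D V) (v w : V) :
    B.form (B.adjoint f v) w = B.form v (f w) := by
  have h : B.form (B.adjoint f v) = (B.form v).comp f := B.form_toDual_symm _
  exact congrArg (fun l => l w) h

theorem adjoint_right (f : Module.End D V) (v w : V) :
    B.form v (B.adjoint f w) = B.form (f v) w := by
  rw [← B.symm, adjoint_left, B.symm]

/-- The elements `f` with `f^* f = 1` are exactly the unitary transformations. -/
theorem adjoint_mul_self_eq_one_iff (f : Module.End D V) :
    B.adjoint f * f = 1 ↔ ∀ v w, B.form (f v) (f w) = B.form v w := by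
  constructor
  · intro h v w
    rw [← B.adjoint_right, ← Module.End.mul_apply, h, Module.End.one_apply]
  · intro h
    refine LinearMap.ext fun w => B.ext_right fun v => ?_
    rw [Module.End.mul_apply, adjoint_right, h, Module.End.one_apply]

/-- The adjoint involution of `End_D(V)`. -/
def adjointInvolution [Module F V] [IsScalarTower F D V] :
    AlgInvolution F (Module.End D V) where
  toLin :=
    { toFun := B.adjoint
      map_add' := fun f g => LinearMap.ext fun w => B.ext_right fun v => by
        simp only [adjoint_right, LinearMap.add_apply, map_add]
      map_smul' := fun r f => LinearMap.ext fun w => B.ext_right fun v => by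
        rw [adjoint_right, LinearMap.smul_apply, RingHom.id_apply, LinearMap.smul_apply,
          ← algebraMap_smul D r (f v), ← algebraMap_smul D r (B.adjoint f w), map_smulₛₗ, map_smul,
          LinearMap.smul_apply, adjoint_right]
        simp }
  map_mul f g := LinearMap.ext fun w => B.ext_right fun v => by
    change B.form v (B.adjoint (f * g) w) = B.form v (B.adjoint g (B.adjoint f w))
    simp only [adjoint_right, Module.End.mul_apply]
  involutive f := LinearMap.ext fun w => B.ext_right fun v => by
    change B.form v (B.adjoint (B.adjoint f) w) = _
    rw [adjoint_right, adjoint_left]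

end HermitianForm

/-- The unitary group `U(V)` of a hermitian space over `(D, τ)`, as an algebraic group over `F`:
`R ↦ {u ∈ (R ⊗_F End_D(V))ˣ | u^* u = 1}`. -/
def unitaryGroupFunctor {τ : D ≃ₐ[F] D} {V : Type u} [AddCommGroup V] [Module D V]
    [Module F V] [IsScalarTower F D V] [FiniteDimensional D V] (B : HermitianForm τ V) :
    GroupFunctor F :=
  unitaryFunctor B.adjointInvolution

/-! ### Extension of scalars along a quadratic extension -/

section Quadratic

variable {E : Type u} [Field E] [Algebra F E] [Algebra D E] [IsScalarTower F D E]
variable {W : Type u} [AddCommGroup W] [Module D W]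

theorem quadratic_card_le [Algebra.IsQuadraticExtension D E] : Fintype.card (E ≃ₐ[D] E) ≤ 2 :=
  (Algebra.IsQuadraticExtension.finrank_eq_two D E) ▸ AlgEquiv.card_le

theorem quadratic_eq [Algebra.IsQuadraticExtension D E] (c c' : E ≃ₐ[D] E) (hc : c ≠ 1)
    (hc' : c' ≠ 1) : c = c' := by
  by_contra h
  have h3 : 3 ≤ Fintype.card (E ≃ₐ[D] E) := by
    classical
    have := Finset.card_le_univ ({1, c, c'} : Finset (E ≃ₐ[D] E))
    rwa [Finset.card_eq_three.2 ⟨1, c, c', hc.symm, hc'.symm, h, rfl⟩] at this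
  have := quadratic_card_le (D := D) (E := E)
  omega

theorem quadratic_involutive [Algebra.IsQuadraticExtension D E] (c : E ≃ₐ[D] E) (hc : c ≠ 1)
    (e : E) : c (c e) = e := by
  have h : c⁻¹ = c := quadratic_eq _ _ (inv_ne_one.2 hc) hc
  have h2 : c * c = 1 := by
    nth_rewrite 1 [← h]; exact inv_mul_cancel c
  exact congrArg (fun f : E ≃ₐ[D] E => f e) h2

/-- The map `c ⊗ 1` on `E ⊗_D W`, for an automorphism `c` of `E` over `D`. -/
def galoisAct (c : E ≃ₐ[D] E) (W : Type u) [AddCommGroup W] [Module D W] :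
    E ⊗[D] W →ₗ[D] E ⊗[D] W :=
  LinearMap.rTensor W c.toLinearMap

theorem galoisAct_tmul (c : E ≃ₐ[D] E) (e : E) (w : W) :
    galoisAct c W (e ⊗ₜ w) = c e ⊗ₜ w := rfl

theorem galoisAct_smul (c : E ≃ₐ[D] E) (e : E) (x : E ⊗[D] W) :
    galoisAct c W (e • x) = c e • galoisAct c W x := by
  induction x with
  | zero => simp
  | add x y hx hy => simp only [smul_add, map_add, hx, hy]
  | tmul e' w => simp only [TensorProduct.smul_tmul', smul_eq_mul, galoisAct_tmul, map_mul]

theorem galoisAct_galoisAct (c : E ≃ₐ[D] E) (hc : ∀ e, c (c e) = e) (x : E ⊗[D] W) :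
    galoisAct c W (galoisAct c W x) = x := by
  induction x with
  | zero => simp
  | add x y hx hy => simp only [map_add, hx, hy]
  | tmul e' w => simp only [galoisAct_tmul, hc]

/-- The automorphism `a ↦ (c ⊗ 1) a (c ⊗ 1)⁻¹` of `End_E(E ⊗_D W)`, where `c` is an automorphism
of `E` over `D` with `c² = 1`. -/
def galoisConj (F : Type u) [Field F] [Algebra F E] (c : E ≃ₐ[D] E)
    (hc : ∀ e, c (c e) = e) (W : Type u) [AddCommGroup W] [Module D W] [Algebra F D]
    [IsScalarTower F D E] :
    Module.End E (E ⊗[D] W) →ₐ[F] Module.End E (E ⊗[D] W) :=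
  AlgHom.ofLinearMap
    { toFun := fun a =>
        { toFun := fun x => galoisAct c W (a (galoisAct c W x))
          map_add' := fun x y => by simp only [map_add]
          map_smul' := fun e x => by
            rw [galoisAct_smul, map_smul, galoisAct_smul, hc, RingHom.id_apply] }
      map_add' := fun a b => LinearMap.ext fun x => by
        change galoisAct c W ((a + b) _) = galoisAct c W (a _) + galoisAct c W (b _)
        rw [LinearMap.add_apply, map_add]
      map_smul' := fun r a => LinearMap.ext fun x => by
        change galoisAct c W ((r • a) _) = r • galoisAct c W (a _)
        rw [LinearMap.smul_apply, ← algebraMap_smul E r, galoisAct_smul,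
          IsScalarTower.algebraMap_apply F D E, AlgEquiv.commutes,
          ← IsScalarTower.algebraMap_apply, algebraMap_smul] }
    (LinearMap.ext fun x => galoisAct_galoisAct c hc x)
    (fun a b => LinearMap.ext fun x => by
      change galoisAct c W ((a * b) _) = galoisAct c W (a (galoisAct c W (galoisAct c W (b _))))
      rw [galoisAct_galoisAct c hc, Module.End.mul_apply])

theorem galoisConj_apply (c : E ≃ₐ[D] E) (hc : ∀ e, c (c e) = e)
    (a : Module.End E (E ⊗[D] W)) (x : E ⊗[D] W) :
    galoisConj F c hc W a x = galoisAct c W (a (galoisAct c W x)) := rfl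

theorem galoisConj_galoisConj (c : E ≃ₐ[D] E) (hc : ∀ e, c (c e) = e)
    (a : Module.End E (E ⊗[D] W)) : galoisConj F c hc W (galoisConj F c hc W a) = a :=
  LinearMap.ext fun x => by
    rw [galoisConj_apply, galoisConj_apply, galoisAct_galoisAct c hc, galoisAct_galoisAct c hc]

/-- The pair `(GL(W_E), GL(W))`, where `E` is a quadratic extension of `D` and
`W_E = E ⊗_D W`; the involution is conjugation by `c ⊗ 1`, where `c` is the non-trivial automorphism
of `E` over `D`. -/
def SymmetricPair.galoisGL (F : Type u) [Field F] [Algebra F D] [Algebra F E]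
    [IsScalarTower F D E] [Algebra.IsQuadraticExtension D E] (c : E ≃ₐ[D] E) (hc : c ≠ 1)
    (W : Type u) [AddCommGroup W] [Module D W] : SymmetricPair F :=
  SymmetricPair.unitsAut (F := F) (A := Module.End E (E ⊗[D] W)) (galoisConj F c (quadratic_involutive c hc) W)
    (galoisConj_galoisConj c (quadratic_involutive c hc))

namespace HermitianForm

variable {τ : D ≃ₐ[F] D}

/-- `w' ↦ B(w, w')`, extended `E`-linearly to `E ⊗_D W`. -/
def baseChangeRight (B : HermitianForm τ W) (w : W) : E ⊗[D] W →ₗ[E] E :=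
  LinearMap.liftBaseChange E ((Algebra.linearMap D E).comp (B.form w))

theorem baseChangeRight_tmul (B : HermitianForm τ W) (w : W) (e : E) (w' : W) :
    B.baseChangeRight w (e ⊗ₜ w') = e * algebraMap D E (B.form w w') := by
  simp [baseChangeRight]

/-- The sesquilinear form on `E ⊗_D W` with
`B_E(e ⊗ w, e' ⊗ w') = τ''(e) e' B(w, w')`. -/
def baseChangeForm (B : HermitianForm τ W) (τ'' : E ≃ₐ[F] E)
    (hτ : ∀ d : D, τ'' (algebraMap D E d) = algebraMap D E (τ d)) :
    E ⊗[D] W →ₛₗ[(τ'' : E →+* E)] E ⊗[D] W →ₗ[E] E :=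
  let f : E ⊗[D] W →+ (E ⊗[D] W →ₗ[E] E) :=
    TensorProduct.liftAddHom
      (AddMonoidHom.mk' (fun e => AddMonoidHom.mk' (fun w => τ'' e • B.baseChangeRight w) (by
          intro w₁ w₂
          ext w'
          simp [baseChangeRight_tmul, mul_add])) (by
        intro e₁ e₂
        ext w w'
        simp [add_mul]))
      (by
        intro d e w
        ext w'
        simp only [AddMonoidHom.mk'_apply, Algebra.smul_def d e, map_mul, hτ]
        simp [baseChangeRight_tmul, mul_assoc, mul_left_comm])
  { toFun := f
    map_add' := f.map_add
    map_smul' := by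
      intro e x
      induction x with
      | zero => simp
      | add x y hx hy => rw [smul_add, f.map_add, hx, hy, f.map_add, smul_add]
      | tmul e' w =>
        rw [TensorProduct.smul_tmul']
        ext w'
        simp [f, mul_assoc] }

theorem baseChangeForm_tmul (B : HermitianForm τ W) (τ'' : E ≃ₐ[F] E)
    (hτ : ∀ d : D, τ'' (algebraMap D E d) = algebraMap D E (τ d)) (e e' : E) (w w' : W) :
    B.baseChangeForm τ'' hτ (e ⊗ₜ w) (e' ⊗ₜ w')
      = τ'' e * e' * algebraMap D E (B.form w w') := by
  have h : B.baseChangeForm τ'' hτ (e ⊗ₜ w) = τ'' e • B.baseChangeRight w := rfl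
  rw [h, LinearMap.smul_apply, baseChangeRight_tmul, smul_eq_mul, mul_assoc]

theorem baseChangeForm_isSymm (B : HermitianForm τ W) (τ'' : E ≃ₐ[F] E)
    (hτ : ∀ d : D, τ'' (algebraMap D E d) = algebraMap D E (τ d))
    (hτ2 : ∀ e, τ'' (τ'' e) = e) : (B.baseChangeForm τ'' hτ).IsSymm where
  eq x y := by
    change τ'' _ = _
    induction x with
    | zero => simp
    | add x x' hx hx' => simp only [map_add, LinearMap.add_apply, hx, hx']
    | tmul e w =>
      induction y with
      | zero => simp
      | add y y' hy hy' => simp only [map_add, LinearMap.add_apply, hy, hy']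
      | tmul e' w' =>
        rw [baseChangeForm_tmul, baseChangeForm_tmul, map_mul, map_mul, hτ2, hτ, B.symm,
          mul_comm e]

theorem baseChangeForm_separatingLeft (B : HermitianForm τ W) (τ'' : E ≃ₐ[F] E)
    (hτ : ∀ d : D, τ'' (algebraMap D E d) = algebraMap D E (τ d)) :
    (B.baseChangeForm τ'' hτ).SeparatingLeft := by
  intro x hx
  let b := Module.Free.chooseBasis D E
  obtain ⟨s, rfl⟩ := (TensorProduct.equivFinsuppOfBasisLeft b).symm.surjective x
  have hs : s = 0 := by
    ext i
    refine B.nondegenerate.1 _ fun w' => ?_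
    have h := hx (1 ⊗ₜ w')
    rw [TensorProduct.equivFinsuppOfBasisLeft_symm_apply, Finsupp.sum, map_sum,
      LinearMap.sum_apply] at h
    simp only [baseChangeForm_tmul, mul_one] at h
    have h2 : ∑ j ∈ s.support, (τ.symm (B.form (s j) w')) • b j = 0 := by
      apply τ''.injective
      rw [map_sum, map_zero, ← h]
      refine Finset.sum_congr rfl fun j _ => ?_
      rw [Algebra.smul_def, map_mul, hτ, AlgEquiv.apply_symm_apply, mul_comm]
    by_cases hi : i ∈ s.support
    · have := linearIndependent_iff'.1 b.linearIndependent _ _ h2 i hi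
      simpa using this
    · rw [Finsupp.notMem_support_iff.1 hi]; simp
  rw [hs, map_zero]

/-- The extension of scalars of a hermitian space `W` over `(D, τ)` to an extension `(E, τ'')` of
`(D, τ)`. -/
def baseChange (B : HermitianForm τ W) (τ'' : E ≃ₐ[F] E)
    (hτ : ∀ d : D, τ'' (algebraMap D E d) = algebraMap D E (τ d))
    (hτ2 : ∀ e, τ'' (τ'' e) = e) : HermitianForm τ'' (E ⊗[D] W) where
  form := B.baseChangeForm τ'' hτ
  isSymm := B.baseChangeForm_isSymm τ'' hτ hτ2
  nondegenerate := by
    have h := B.baseChangeForm_separatingLeft τ'' hτ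
    refine ⟨h, fun y hy => h y fun x => ?_⟩
    rw [← (B.baseChangeForm_isSymm τ'' hτ hτ2).eq, hy, map_zero]

theorem quadratic_commute [Algebra.IsQuadraticExtension D E] (τ'' : E ≃ₐ[F] E)
    (hτ : ∀ d : D, τ'' (algebraMap D E d) = algebraMap D E (τ d)) (c : E ≃ₐ[D] E) (hc : c ≠ 1)
    (e : E) : τ'' (c e) = c (τ'' e) := by
  have hτs : ∀ d : D, τ''.symm (algebraMap D E d) = algebraMap D E (τ.symm d) := by
    intro d
    rw [AlgEquiv.symm_apply_eq, hτ, AlgEquiv.apply_symm_apply]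
  let c' : E ≃ₐ[D] E := AlgEquiv.ofRingEquiv
    (f := ((τ''.symm : E ≃+* E).trans (c : E ≃+* E)).trans (τ'' : E ≃+* E)) (by
      intro d
      change τ'' (c (τ''.symm (algebraMap D E d))) = _
      rw [hτs, AlgEquiv.commutes, hτ, AlgEquiv.apply_symm_apply])
  have hc'e : ∀ y, c' y = τ'' (c (τ''.symm y)) := fun y => rfl
  have hc' : c' ≠ 1 := by
    intro h
    apply hc
    ext y
    have := congrArg (fun f : E ≃ₐ[D] E => f (τ'' y)) h
    simp only [hc'e, AlgEquiv.symm_apply_apply] at this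
    exact τ''.injective this
  have h := quadratic_eq c' c hc' hc
  have h2 := hc'e (τ'' e)
  rw [AlgEquiv.symm_apply_apply, h] at h2
  exact h2.symm

theorem baseChangeForm_galoisAct [Algebra.IsQuadraticExtension D E] (B : HermitianForm τ W)
    (τ'' : E ≃ₐ[F] E) (hτ : ∀ d : D, τ'' (algebraMap D E d) = algebraMap D E (τ d))
    (c : E ≃ₐ[D] E) (hc : c ≠ 1) (x y : E ⊗[D] W) :
    B.baseChangeForm τ'' hτ (galoisAct c W x) (galoisAct c W y)
      = c (B.baseChangeForm τ'' hτ x y) := by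
  induction x with
  | zero => simp
  | add x x' hx hx' => simp only [map_add, LinearMap.add_apply, hx, hx']
  | tmul e w =>
    induction y with
    | zero => simp
    | add y y' hy hy' => simp only [map_add, hy, hy']
    | tmul e' w' =>
      rw [galoisAct_tmul, galoisAct_tmul, baseChangeForm_tmul, baseChangeForm_tmul, map_mul,
        map_mul, AlgEquiv.commutes, quadratic_commute τ'' hτ c hc]

theorem adjoint_galoisConj [Algebra.IsQuadraticExtension D E] [FiniteDimensional D W]
    (B : HermitianForm τ W)
    (τ'' : E ≃ₐ[F] E) (hτ : ∀ d : D, τ'' (algebraMap D E d) = algebraMap D E (τ d))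
    (hτ2 : ∀ e, τ'' (τ'' e) = e) (c : E ≃ₐ[D] E) (hc : c ≠ 1)
    (a : Module.End E (E ⊗[D] W)) :
    (B.baseChange τ'' hτ hτ2).adjoint (galoisConj F c (quadratic_involutive c hc) W a)
      = galoisConj F c (quadratic_involutive c hc) W ((B.baseChange τ'' hτ hτ2).adjoint a) := by
  have key : ∀ x y, (B.baseChange τ'' hτ hτ2).form (galoisAct c W x) y
      = c ((B.baseChange τ'' hτ hτ2).form x (galoisAct c W y)) := by
    intro x y
    have h := B.baseChangeForm_galoisAct τ'' hτ c hc x (galoisAct c W y)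
    rwa [galoisAct_galoisAct c (quadratic_involutive c hc)] at h
  have key' : ∀ x y, (B.baseChange τ'' hτ hτ2).form x (galoisAct c W y)
      = c ((B.baseChange τ'' hτ hτ2).form (galoisAct c W x) y) := by
    intro x y
    rw [key, quadratic_involutive c hc]
  refine LinearMap.ext fun y => (B.baseChange τ'' hτ hτ2).ext_right fun x => ?_
  rw [adjoint_right, galoisConj_apply, galoisConj_apply, key, key' x, adjoint_right]

end HermitianForm

/-- The pair `(U(W_E), U(W))`, where `W` is a hermitian space over `(D, τ)`, `(E, τ'')` is a
quadratic extension of `(D, τ)` and `W_E = E ⊗_D W` is the extension of scalars with the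
corresponding hermitian structure; the involution is conjugation by `c ⊗ 1`, where `c` is the
non-trivial automorphism of `E` over `D`. -/
def SymmetricPair.galoisU [Algebra.IsQuadraticExtension D E] [FiniteDimensional D W]
    {τ : D ≃ₐ[F] D} (B : HermitianForm τ W) (τ'' : E ≃ₐ[F] E)
    (hτ : ∀ d : D, τ'' (algebraMap D E d) = algebraMap D E (τ d))
    (hτ2 : ∀ e, τ'' (τ'' e) = e) (c : E ≃ₐ[D] E) (hc : c ≠ 1) : SymmetricPair F :=
  SymmetricPair.unitaryAut (B.baseChange τ'' hτ hτ2).adjointInvolution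
    (galoisConj F c (quadratic_involutive c hc) W)
    (galoisConj_galoisConj c (quadratic_involutive c hc))
    (B.adjoint_galoisConj τ'' hτ hτ2 c hc)

end Quadratic

end Hermitian

/-- The seven types of symmetric pairs, for a field `D` with involution `τ` over `F`. Here an
extension `(D', τ')` of `(D, τ)` is a finite field extension `D'` of `D` with an involution `τ'` that
restricts to `τ`. -/
inductive IsListedPair (F D : Type u) [Field F] [Field D] [Algebra F D] (τ : D ≃ₐ[F] D) :
    SymmetricPair F → Prop
  /-- `(GL(W) × GL(W), Δ GL(W))`. -/
  | diagonalGL (D' : Type u) [Field D'] [Algebra F D'] [Algebra D D'] [IsScalarTower F D D']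
      [FiniteDimensional D D']
      (W : Type u) [AddCommGroup W] [Module D' W] [Module F W] [IsScalarTower F D' W]
      [FiniteDimensional D' W] :
      IsListedPair F D τ (SymmetricPair.diagonal (GLFunctor F D' W))
  /-- `(U(W) × U(W), Δ U(W))`. -/
  | diagonalU (D' : Type u) [Field D'] [Algebra F D'] [Algebra D D'] [IsScalarTower F D D']
      [FiniteDimensional D D']
      (τ' : D' ≃ₐ[F] D') (hτ'2 : ∀ d, τ' (τ' d) = d)
      (hτ' : ∀ d : D, τ' (algebraMap D D' d) = algebraMap D D' (τ d))
      (W : Type u) [AddCommGroup W] [Module D' W] [Module F W] [IsScalarTower F D' W]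
      [FiniteDimensional D' W] (B : HermitianForm τ' W) :
      IsListedPair F D τ (SymmetricPair.diagonal (unitaryGroupFunctor B))
  /-- `(GL(W), U(W))`. -/
  | unitaryInGL (D' : Type u) [Field D'] [Algebra F D'] [Algebra D D'] [IsScalarTower F D D']
      [FiniteDimensional D D']
      (τ' : D' ≃ₐ[F] D') (hτ'2 : ∀ d, τ' (τ' d) = d)
      (hτ' : ∀ d : D, τ' (algebraMap D D' d) = algebraMap D D' (τ d))
      (W : Type u) [AddCommGroup W] [Module D' W] [Module F W] [IsScalarTower F D' W]
      [FiniteDimensional D' W] (B : HermitianForm τ' W) :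
      IsListedPair F D τ (SymmetricPair.unitsUnitary B.adjointInvolution)
  /-- `(GL(W_{D'}), GL(W))` for a quadratic extension `D'/F'`. -/
  | galoisGL (F' : Type u) [Field F'] [Algebra F F'] [Algebra D F'] [IsScalarTower F D F']
      [FiniteDimensional D F']
      (D' : Type u) [Field D'] [Algebra F D'] [Algebra F' D'] [IsScalarTower F F' D']
      [Algebra.IsQuadraticExtension F' D'] (c : D' ≃ₐ[F'] D') (hc : c ≠ 1)
      (W : Type u) [AddCommGroup W] [Module F' W] [FiniteDimensional F' W] :
      IsListedPair F D τ (SymmetricPair.galoisGL F c hc W)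
  /-- `(GL(W), GL(W)_ε)`, with `ε` of order at most two. -/
  | innerGL (W : Type u) [AddCommGroup W] [Module D W] [Module F W] [IsScalarTower F D W]
      [FiniteDimensional D W] (ε : (GLFunctor F D W).obj (CommAlgCat.of F F)) (hε : ε ^ 2 = 1) :
      IsListedPair F D τ (SymmetricPair.inner (GLFunctor F D W) ε hε)
  /-- `(U(W_E), U(W))` for a quadratic extension `(E, τ'')` of `(D', τ')`. -/
  | galoisU (D' : Type u) [Field D'] [Algebra F D'] [Algebra D D'] [IsScalarTower F D D']
      [FiniteDimensional D D']
      (τ' : D' ≃ₐ[F] D') (hτ'2 : ∀ d, τ' (τ' d) = d)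
      (hτ' : ∀ d : D, τ' (algebraMap D D' d) = algebraMap D D' (τ d))
      (E : Type u) [Field E] [Algebra F E] [Algebra D' E] [IsScalarTower F D' E]
      [Algebra.IsQuadraticExtension D' E]
      (τ'' : E ≃ₐ[F] E) (hτ''2 : ∀ e, τ'' (τ'' e) = e)
      (hτ'' : ∀ d : D', τ'' (algebraMap D' E d) = algebraMap D' E (τ' d))
      (c : E ≃ₐ[D'] E) (hc : c ≠ 1)
      (W : Type u) [AddCommGroup W] [Module D' W] [FiniteDimensional D' W]
      (B : HermitianForm τ' W) :
      IsListedPair F D τ (SymmetricPair.galoisU B τ'' hτ'' hτ''2 c hc)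
  /-- `(U(W), U(W)_ε)`, with `ε` of order two. -/
  | innerU (W : Type u) [AddCommGroup W] [Module D W] [Module F W] [IsScalarTower F D W]
      [FiniteDimensional D W] (B : HermitianForm τ W)
      (ε : (unitaryGroupFunctor B).obj (CommAlgCat.of F F)) (hε : orderOf ε = 2) :
      IsListedPair F D τ
        (SymmetricPair.inner (unitaryGroupFunctor B) ε (hε ▸ pow_orderOf_eq_one ε))

end

noncomputable section

/-! ## Morphisms of group functors -/

namespace GroupFunctor

variable {F : Type u} [Field F]

/-- The inclusion of a subgroup functor. -/
def subIncl (G : GroupFunctor F) (H : ∀ R : CommAlgCat.{u} F, Subgroup (G.obj R))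
    (hH : ∀ {R S : CommAlgCat.{u} F} (f : R ⟶ S) (x : G.obj R), x ∈ H R → G.map f x ∈ H S) :
    G.sub H hH ⟶ G where
  app R := GrpCat.ofHom (H R).subtype
  naturality R S f := by
    ext x
    rfl

/-- A morphism with values in a subgroup functor. -/
def subLift {G' G : GroupFunctor F} (H : ∀ R : CommAlgCat.{u} F, Subgroup (G.obj R))
    (hH : ∀ {R S : CommAlgCat.{u} F} (f : R ⟶ S) (x : G.obj R), x ∈ H R → G.map f x ∈ H S)
    (f : G' ⟶ G) (hf : ∀ R (x : G'.obj R), f.app R x ∈ H R) : G' ⟶ G.sub H hH where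
  app R := GrpCat.ofHom ((f.app R).hom.codRestrict (H R) (hf R))
  naturality R S g := by
    ext x
    exact Subtype.ext (ConcreteCategory.congr_hom (f.naturality g) x)

/-- The morphism to `G × G` with given components. -/
def squareLift {G' G : GroupFunctor F} (f g : G' ⟶ G) : G' ⟶ G.square where
  app R := GrpCat.ofHom ((f.app R).hom.prod (g.app R).hom)
  naturality R S h := by
    ext x
    exact Prod.ext (ConcreteCategory.congr_hom (f.naturality h) x)
      (ConcreteCategory.congr_hom (g.naturality h) x)

/-- The morphism to a finite product with given components. -/
def piLift {ι : Type} {G' : GroupFunctor F} {G : ι → GroupFunctor F} (f : ∀ i, G' ⟶ G i) :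
    G' ⟶ GroupFunctor.pi G where
  app R := GrpCat.ofHom (MonoidHom.mk' (fun x i => (f i).app R x) (by
    intro a b
    funext i
    exact map_mul ((f i).app R).hom a b))
  naturality R S h := by
    ext x
    funext i
    exact ConcreteCategory.congr_hom ((f i).naturality h) x

end GroupFunctor

namespace SymmetricPair

variable {F : Type u} [Field F]

theorem isomorphic_of_bijective {P Q : SymmetricPair F} (f : P.G ⟶ Q.G)
    (hθ : ∀ R (x : P.G.obj R), f.app R (P.θ.app R x) = Q.θ.app R (f.app R x))
    (hb : ∀ R, Function.Bijective (f.app R)) : P.Isomorphic Q := by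
  have : ∀ R, IsIso (f.app R) := fun R =>
    (ConcreteCategory.isIso_iff_bijective (f.app R)).2 (hb R)
  have := NatIso.isIso_of_isIso_app f
  refine ⟨asIso f, ?_⟩
  ext R x
  exact hθ R x

theorem Isomorphic.symm {P Q : SymmetricPair F} (h : P.Isomorphic Q) : Q.Isomorphic P := by
  obtain ⟨e, he⟩ := h
  refine ⟨e.symm, ?_⟩
  rw [Iso.symm_hom, ← Iso.cancel_iso_hom_left e, ← Category.assoc, ← he, Category.assoc,
    e.hom_inv_id, Category.comp_id, e.hom_inv_id_assoc]

theorem Isomorphic.trans {P Q S : SymmetricPair F} (h : P.Isomorphic Q) (h' : Q.Isomorphic S) :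
    P.Isomorphic S := by
  obtain ⟨e, he⟩ := h
  obtain ⟨e', he'⟩ := h'
  refine ⟨e ≪≫ e', ?_⟩
  rw [Iso.trans_hom, ← Category.assoc, he, Category.assoc, he', Category.assoc]

end SymmetricPair

/-- The morphism of unit groups induced by a homomorphism of algebras. -/
def unitsMap {F A A' : Type u} [Field F] [Ring A] [Algebra F A] [Ring A'] [Algebra F A']
    (f : A →ₐ[F] A') : unitsFunctor F A ⟶ unitsFunctor F A' where
  app R := GrpCat.ofHom (Units.map (Algebra.TensorProduct.map (AlgHom.id F R) f : _ →* _))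
  naturality R S g := by
    ext x
    apply Units.ext
    change Algebra.TensorProduct.map (AlgHom.id F S) f
        (Algebra.TensorProduct.map g.hom (AlgHom.id F A) x.val) =
      Algebra.TensorProduct.map g.hom (AlgHom.id F A')
        (Algebra.TensorProduct.map (AlgHom.id F R) f x.val)
    induction x.val with
    | zero => simp
    | add x x' hx hx' => simp only [_root_.map_add, hx, hx']
    | tmul r a => simp

/-- A homomorphism of algebras that commutes with involutions induces a map of unitary groups. -/
theorem ext_map_of_commute {F A A' : Type u} [Field F] [Ring A] [Algebra F A] [Ring A']
    [Algebra F A'] (f : A →ₐ[F] A') (σ : AlgInvolution F A) (σ' : AlgInvolution F A')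
    (h : ∀ a, f (σ.toLin a) = σ'.toLin (f a)) (R : Type u) [CommRing R] [Algebra F R]
    (x : R ⊗[F] A) :
    Algebra.TensorProduct.map (AlgHom.id F R) f (σ.ext R x) =
      σ'.ext R (Algebra.TensorProduct.map (AlgHom.id F R) f x) := by
  induction x with
  | zero => simp
  | add x x' hx hx' => simp only [_root_.map_add, hx, hx']
  | tmul r a => simp [AlgInvolution.ext_tmul, h]

theorem extHom_map_of_commute {F A A' : Type u} [Field F] [Ring A] [Algebra F A] [Ring A']
    [Algebra F A'] (f : A →ₐ[F] A') (φ : A →ₐ[F] A) (φ' : A' →ₐ[F] A')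
    (h : ∀ a, f (φ a) = φ' (f a)) (R : CommAlgCat.{u} F) (x : R ⊗[F] A) :
    Algebra.TensorProduct.map (AlgHom.id F R) f (SymmetricPair.extHom φ R x) =
      SymmetricPair.extHom φ' R (Algebra.TensorProduct.map (AlgHom.id F R) f x) := by
  induction x with
  | zero => simp
  | add x x' hx hx' => simp only [_root_.map_add, hx, hx']
  | tmul r a => simp [SymmetricPair.extHom, h]

theorem AlgInvolution.map_mem_unitarySubgroup {F A : Type u} [Field F] [Ring A] [Algebra F A]
    (σ : AlgInvolution F A) {R S : CommAlgCat.{u} F} (f : R ⟶ S) (x : (R ⊗[F] A)ˣ)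
    (hx : x ∈ σ.unitarySubgroup R) :
    Units.map (Algebra.TensorProduct.map f.hom (AlgHom.id F A) : R ⊗[F] A →* S ⊗[F] A) x ∈
      σ.unitarySubgroup S := by
  change σ.ext S (Algebra.TensorProduct.map f.hom (AlgHom.id F A) x.val)
    * Algebra.TensorProduct.map f.hom (AlgHom.id F A) x.val = 1
  have hx' : σ.ext R x.val * x.val = 1 := hx
  rw [σ.ext_map R f.hom, ← _root_.map_mul, hx', _root_.map_one]

/-- The inclusion `U(A, σ) → Aˣ`. -/
def unitaryIncl {F A : Type u} [Field F] [Ring A] [Algebra F A] (σ : AlgInvolution F A) :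
    unitaryFunctor σ ⟶ unitsFunctor F A :=
  GroupFunctor.subIncl (unitsFunctor F A) (fun R => σ.unitarySubgroup R)
    σ.map_mem_unitarySubgroup

/-- The morphism of unitary groups induced by a homomorphism of algebras that commutes with the
involutions. -/
def unitaryMap {F A A' : Type u} [Field F] [Ring A] [Algebra F A] [Ring A'] [Algebra F A']
    (f : A →ₐ[F] A') (σ : AlgInvolution F A) (σ' : AlgInvolution F A')
    (h : ∀ a, f (σ.toLin a) = σ'.toLin (f a)) : unitaryFunctor σ ⟶ unitaryFunctor σ' :=
  GroupFunctor.subLift (G := unitsFunctor F A') (fun R => σ'.unitarySubgroup R)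
    σ'.map_mem_unitarySubgroup (unitaryIncl σ ≫ unitsMap f) (by
    intro R x
    let y : (R ⊗[F] A)ˣ := x.1
    have hx : σ.ext R y.val * y.val = 1 := x.2
    change σ'.ext R (Algebra.TensorProduct.map (AlgHom.id F R) f y.val) *
      Algebra.TensorProduct.map (AlgHom.id F R) f y.val = 1
    rw [← ext_map_of_commute f σ σ' h, ← map_mul, hx, _root_.map_one])

end

noncomputable section

/-! ## Corners of algebras with involution -/

section Corner

variable {F C A : Type u} [Field F] [Ring C] [Algebra F C] [Ring A] [Algebra F A]

/-- The algebra `A` is identified with the corner `e C` for a central idempotent `e` of `C`, by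
the projection `π` and the section `ι`. -/
structure IsCornerMap (e : C) (π : C →ₐ[F] A) (ι : A →ₗ[F] C) : Prop where
  map_mul : ∀ a b, ι (a * b) = ι a * ι b
  right_inv : ∀ a, π (ι a) = a
  left_inv : ∀ c, ι (π c) = e * c
  comm : ∀ c, e * c = c * e

/-- The base change of an algebra with involution. -/
def AlgInvolution.baseChange (σ : AlgInvolution F C) (R : Type u) [CommRing R] [Algebra F R] :
    AlgInvolution F (R ⊗[F] C) where
  toLin := σ.ext R
  map_mul := σ.ext_mul R
  involutive := σ.ext_ext R

namespace IsCornerMap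

variable {e : C} {π : C →ₐ[F] A} {ι : A →ₗ[F] C} (h : IsCornerMap e π ι)
include h

theorem baseChange (R : Type u) [CommRing R] [Algebra F R] :
    IsCornerMap ((1 : R) ⊗ₜ[F] e) (Algebra.TensorProduct.map (AlgHom.id F R) π)
      (ι.lTensor R) where
  map_mul a b := by
    induction a with
    | zero => simp
    | add x x' hx hx' => simp only [add_mul, map_add, hx, hx']
    | tmul r a =>
      induction b with
      | zero => simp
      | add y y' hy hy' => simp only [mul_add, map_add, hy, hy']
      | tmul s b => simp [h.map_mul]
  right_inv a := by
    induction a with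
    | zero => simp
    | add x x' hx hx' => simp only [map_add, hx, hx']
    | tmul r a => simp [h.right_inv]
  left_inv a := by
    induction a with
    | zero => simp
    | add x x' hx hx' => simp only [map_add, hx, hx', mul_add]
    | tmul r a => simp [h.left_inv]
  comm a := by
    induction a with
    | zero => simp
    | add x x' hx hx' => simp only [hx, hx', mul_add, add_mul]
    | tmul r a => simp [h.comm]

theorem ι_one : ι 1 = e := by
  have := h.left_inv 1
  rwa [_root_.map_one, mul_one] at this

theorem idem : e * e = e := by
  rw [← h.ι_one, ← h.map_mul, mul_one]

theorem e_mul_ι (a : A) : e * ι a = ι a := by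
  rw [← h.ι_one, ← h.map_mul, one_mul]

theorem ι_mul_e (a : A) : ι a * e = ι a := by
  rw [← h.comm, h.e_mul_ι]

theorem π_e : π e = 1 := by
  rw [← h.ι_one, h.right_inv]

theorem π_eq_iff (c c' : C) : π c = π c' ↔ e * c = e * c' := by
  constructor
  · intro hc
    rw [← h.left_inv, hc, h.left_inv]
  · intro hc
    have := congrArg π hc
    rwa [_root_.map_mul, _root_.map_mul, h.π_e, one_mul, one_mul] at this

theorem π_eq_zero {c : C} (hc : e * c = 0) : π c = 0 := by
  rw [← map_zero π, h.π_eq_iff, hc, mul_zero]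

theorem ι_add_mul (a b : A) : (ι a + (1 - e)) * (ι b + (1 - e)) = ι (a * b) + (1 - e) := by
  simp only [add_mul, mul_add, mul_sub, sub_mul, one_mul, mul_one, h.idem, h.e_mul_ι, h.ι_mul_e,
    h.map_mul]
  abel

/-- The unit `ι a + (1 - e)`. -/
def liftUnit (a : Aˣ) : Cˣ where
  val := ι a + (1 - e)
  inv := ι ↑a⁻¹ + (1 - e)
  val_inv := by rw [h.ι_add_mul, Units.mul_inv, h.ι_one]; abel
  inv_val := by rw [h.ι_add_mul, Units.inv_mul, h.ι_one]; abel

theorem liftUnit_val (a : Aˣ) : (h.liftUnit a).val = 1 + e * (ι a - 1) := by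
  change ι a + (1 - e) = _
  rw [mul_sub, h.e_mul_ι, mul_one]
  abel

theorem liftUnit_inv_val (a : Aˣ) : (h.liftUnit a)⁻¹.val = 1 + e * (ι ↑a⁻¹ - 1) := by
  change ι ↑a⁻¹ + (1 - e) = _
  rw [mul_sub, h.e_mul_ι, mul_one]
  abel

theorem π_liftUnit (a : Aˣ) : π (h.liftUnit a).val = a := by
  change π (ι a + (1 - e)) = a
  rw [map_add, h.right_inv, map_sub, h.π_e, _root_.map_one, sub_self, add_zero]

theorem liftUnit_comm {e' : C} (he : e * e' = 0) (hc : ∀ c, e' * c = c * e') (a : Aˣ) (c : C) :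
    (h.liftUnit a).val * (1 + e' * c) = (1 + e' * c) * (h.liftUnit a).val := by
  have he' : e' * e = 0 := by rw [hc, he]
  have h1 : ∀ p q : C, e * p * (e' * q) = 0 := fun p q => by
    rw [h.comm p, mul_assoc, ← mul_assoc e, he, zero_mul, mul_zero]
  have h2 : ∀ p q : C, e' * q * (e * p) = 0 := fun p q => by
    rw [hc q, mul_assoc, ← mul_assoc e', he', zero_mul, mul_zero]
  rw [h.liftUnit_val, add_mul, add_mul, mul_add, mul_add, mul_add, mul_add, h1, h2]
  simp only [one_mul, mul_one]
  abel

theorem π_one_add {e' : C} (he : e * e' = 0) (c : C) : π (1 + e' * c) = 1 := by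
  rw [map_add, _root_.map_one, h.π_eq_zero (by rw [← mul_assoc, he, zero_mul]), add_zero]

end IsCornerMap

namespace AlgInvolution

variable (σ : AlgInvolution F C)

/-- The image of a unit under an involution. -/
def unit (u : Cˣ) : Cˣ where
  val := σ.toLin u
  inv := σ.toLin ↑u⁻¹
  val_inv := by rw [← σ.map_mul, Units.inv_mul, σ.map_one]
  inv_val := by rw [← σ.map_mul, Units.mul_inv, σ.map_one]

/-- `σ(u) u = 1`. -/
def IsUnitary (u : Cˣ) : Prop := σ.toLin u.val * u.val = 1

variable {σ}

theorem IsUnitary.eq {u : Cˣ} (hu : σ.IsUnitary u) : σ.toLin u.val = u⁻¹.val :=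
  Units.eq_inv_of_mul_eq_one_right hu

theorem IsUnitary.mul {u v : Cˣ} (hu : σ.IsUnitary u) (hv : σ.IsUnitary v) :
    σ.IsUnitary (u * v) := by
  change _ * (u.val * v.val) = _
  rw [Units.val_mul, σ.map_mul, mul_assoc, ← mul_assoc _ u.val, hu, one_mul, hv]

theorem IsUnitary.map {φ : C →ₐ[F] C} (hσ : ∀ a, σ.toLin (φ a) = φ (σ.toLin a)) {u : Cˣ}
    (hu : σ.IsUnitary u) : σ.IsUnitary (Units.map (φ : C →* C) u) := by
  change σ.toLin (φ u.val) * φ u.val = 1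
  rw [hσ, ← _root_.map_mul, hu, _root_.map_one]

theorem isUnitary_mul_unit {u : Cˣ} (hu : Commute u.val (σ.toLin u.val)) :
    σ.IsUnitary (u * σ.unit u⁻¹) := by
  have h1 : σ.toLin ↑u⁻¹ = (σ.unit u)⁻¹.val := rfl
  change σ.toLin (u.val * σ.toLin ↑u⁻¹) * (u.val * σ.toLin ↑u⁻¹) = 1
  rw [σ.map_mul, σ.involutive, mul_assoc, ← mul_assoc (σ.toLin u.val), ← hu.eq, mul_assoc u.val,
    ← σ.map_mul, Units.inv_mul, σ.map_one, mul_one, Units.inv_mul]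

/-- If two unitary elements agree on `e`, then they agree on `σ e`. -/
theorem IsUnitary.eq_on {e : C} (hc : ∀ c, e * c = c * e) {u v : Cˣ}
    (hu : σ.IsUnitary u) (hv : σ.IsUnitary v) (h : e * u.val = e * v.val) :
    σ.toLin e * u.val = σ.toLin e * v.val := by
  have hc' : ∀ c, σ.toLin e * c = c * σ.toLin e := fun c => by
    rw [← σ.involutive c, ← σ.map_mul, ← hc, σ.map_mul]
  have h1 := congrArg σ.toLin h
  rw [σ.map_mul, σ.map_mul, hu.eq, hv.eq] at h1
  rw [hc', hc']
  calc u.val * σ.toLin e = u.val * (σ.toLin e * (v⁻¹.val * v.val)) := by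
        rw [Units.inv_mul, mul_one]
    _ = u.val * (v⁻¹.val * σ.toLin e) * v.val := by rw [← hc' (v⁻¹.val)]; simp only [mul_assoc]
    _ = v.val * σ.toLin e := by
        rw [← h1, ← mul_assoc, Units.mul_inv, one_mul, hc']

end AlgInvolution

namespace IsCornerMap

variable {e : C} {π : C →ₐ[F] A} {ι : A →ₗ[F] C} (h : IsCornerMap e π ι)
variable {σ : AlgInvolution F C}
include h

theorem central_map (c : C) : σ.toLin e * c = c * σ.toLin e := by
  rw [← σ.involutive c, ← σ.map_mul, ← h.comm, σ.map_mul]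

theorem isUnitary_liftUnit {σ' : AlgInvolution F A} (hσ' : ∀ c, π (σ.toLin c) = σ'.toLin (π c))
    (he : σ.toLin e = e) {a : Aˣ} (ha : σ'.IsUnitary a) : σ.IsUnitary (h.liftUnit a) := by
  have h1 : σ.toLin (ι a.val) = ι (σ'.toLin a.val) := by
    have h2 : ι (σ'.toLin a.val) = e * σ.toLin (ι a.val) := by
      rw [← h.left_inv, hσ', h.right_inv]
    rw [h2]
    conv_lhs => rw [← h.ι_mul_e, σ.map_mul, he]
  change σ.toLin (ι a + (1 - e)) * (ι a + (1 - e)) = 1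
  rw [map_add, h1, map_sub, he, σ.map_one, h.ι_add_mul, ha, h.ι_one]
  abel

theorem σ_one_add (c : C) : σ.toLin (1 + e * c) = 1 + σ.toLin e * σ.toLin c := by
  rw [map_add, σ.map_one, σ.map_mul, ← h.central_map]

/-- The unitary element `u σ(u)⁻¹` with `u = ι a + (1 - e)`. -/
def liftUnitary (σ : AlgInvolution F C) (a : Aˣ) : Cˣ :=
  h.liftUnit a * σ.unit (h.liftUnit a)⁻¹

theorem isUnitary_liftUnitary (he : e * σ.toLin e = 0) (a : Aˣ) :
    σ.IsUnitary (h.liftUnitary σ a) := by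
  apply AlgInvolution.isUnitary_mul_unit
  have h1 : σ.toLin (h.liftUnit a).val = 1 + σ.toLin e * σ.toLin (ι a - 1) := by
    rw [h.liftUnit_val, h.σ_one_add]
  change _ * _ = _ * _
  rw [h1]
  exact h.liftUnit_comm he h.central_map a _

theorem liftUnitary_val (a : Aˣ) : (h.liftUnitary σ a).val =
    (h.liftUnit a).val * (1 + σ.toLin e * σ.toLin (ι ↑a⁻¹ - 1)) := by
  change _ * σ.toLin (h.liftUnit a)⁻¹.val = _
  rw [h.liftUnit_inv_val, h.σ_one_add]

theorem π_liftUnitary (he : e * σ.toLin e = 0) (a : Aˣ) : π (h.liftUnitary σ a).val = a := by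
  rw [liftUnitary_val, _root_.map_mul, h.π_liftUnit, h.π_one_add he, mul_one]

end IsCornerMap

end Corner

end

noncomputable section

/-! ## Factors of the symmetric pair of an algebra with involution -/

section Corner

variable {F C A : Type u} [Field F] [Ring C] [Algebra F C] [Ring A] [Algebra F A]
variable {e : C} {π : C →ₐ[F] A} {ι : A →ₗ[F] C} (h : IsCornerMap e π ι)
variable {σ : AlgInvolution F C} {φ : C →ₐ[F] C}

theorem add_mul_eq_add_mul_iff {e e' : C} (he : e * e = e) (he' : e' * e' = e') (h : e * e' = 0)
    (h' : e' * e = 0) (u v : C) :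
    (e + e') * u = (e + e') * v ↔ e * u = e * v ∧ e' * u = e' * v := by
  constructor
  · intro H
    have h1 := congrArg (fun z => e * z) H
    have h2 := congrArg (fun z => e' * z) H
    simp only [← mul_assoc, mul_add, he, he', h, h', add_zero, zero_add] at h1 h2
    exact ⟨h1, h2⟩
  · rintro ⟨h1, h2⟩
    rw [add_mul, add_mul, h1, h2]

namespace AlgInvolution

theorem mul_self_eq {e : C} (he : e * e = e) : σ.toLin e * σ.toLin e = σ.toLin e := by
  rw [← σ.map_mul, he]

theorem IsUnitary.add_mul_eq_iff {e : C} (hc : ∀ c, e * c = c * e) (he : e * e = e)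
    (he' : e * σ.toLin e = 0) {u v : Cˣ} (hu : σ.IsUnitary u) (hv : σ.IsUnitary v) :
    (e + σ.toLin e) * u.val = (e + σ.toLin e) * v.val ↔ e * u.val = e * v.val := by
  rw [add_mul_eq_add_mul_iff he (σ.mul_self_eq he) he' (by rw [← hc, he'])]
  exact ⟨fun H => H.1, fun H => ⟨H, hu.eq_on hc hv H⟩⟩

end AlgInvolution

namespace IsCornerMap

include h

/-- Two elements with prescribed components in the corners `e C` and `φ(e) C`. -/
theorem π_mul_map (hφ : ∀ a, φ (φ a) = a) {f f' : C}
    (hf : e * φ (f - 1) = 0) (hf' : e * φ (f' - 1) = 0) :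
    π (f * φ f') = π f ∧ π (φ (f * φ f')) = π f' := by
  have key : ∀ g : C, e * φ (g - 1) = 0 → π (φ g) = 1 := fun g hg => by
    rw [← sub_add_cancel g 1, map_add, map_add, h.π_eq_zero hg, _root_.map_one, _root_.map_one, zero_add]
  rw [_root_.map_mul, _root_.map_mul, _root_.map_mul, key f' hf', key f hf, hφ, mul_one, one_mul]
  exact ⟨rfl, rfl⟩

theorem exists_unitary_pair {σ' : AlgInvolution F A} (hφ : ∀ a, φ (φ a) = a)
    (hσ : ∀ a, σ.toLin (φ a) = φ (σ.toLin a))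
    (h1 : ∀ c, π (σ.toLin c) = σ'.toLin (π c)) (he : σ.toLin e = e) (he' : e * φ e = 0)
    {a b : Aˣ} (ha : σ'.IsUnitary a) (hb : σ'.IsUnitary b) :
    ∃ u : Cˣ, σ.IsUnitary u ∧ π u.val = a ∧ π (φ u.val) = b := by
  have key : ∀ a : Aˣ, e * φ ((h.liftUnit a).val - 1) = 0 := fun a => by
    rw [h.liftUnit_val, add_sub_cancel_left, _root_.map_mul, ← mul_assoc, he', zero_mul]
  have := h.π_mul_map hφ (key a) (key b)
  refine ⟨h.liftUnit a * Units.map (φ : C →* C) (h.liftUnit b),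
    (h.isUnitary_liftUnit h1 he ha).mul ((h.isUnitary_liftUnit h1 he hb).map hσ),
    this.1.trans (h.π_liftUnit a), this.2.trans (h.π_liftUnit b)⟩

theorem exists_pair (hφ : ∀ a, φ (φ a) = a)
    (hσ : ∀ a, σ.toLin (φ a) = φ (σ.toLin a))
    (he : e * σ.toLin e = 0) (he' : e * φ e = 0) (he'' : e * φ (σ.toLin e) = 0) (a b : Aˣ) :
    ∃ u : Cˣ, σ.IsUnitary u ∧ π u.val = a ∧ π (φ u.val) = b := by
  have key : ∀ a : Aˣ, e * φ ((h.liftUnitary σ a).val - 1) = 0 := fun a => by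
    have : (h.liftUnitary σ a).val - 1 = e * (ι a - 1) + (h.liftUnit a).val *
        (σ.toLin e * σ.toLin (ι ↑a⁻¹ - 1)) := by
      rw [h.liftUnitary_val, mul_add, mul_one]
      nth_rewrite 1 [h.liftUnit_val]
      abel
    rw [this, map_add, _root_.map_mul, mul_add, ← mul_assoc, he', zero_mul, zero_add, ← mul_assoc,
      ← h.central_map, mul_assoc, _root_.map_mul, ← mul_assoc, he'', zero_mul]
  have := h.π_mul_map hφ (key a) (key b)
  refine ⟨h.liftUnitary σ a * Units.map (φ : C →* C) (h.liftUnitary σ b),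
    (h.isUnitary_liftUnitary he a).mul ((h.isUnitary_liftUnitary he b).map hσ),
    this.1.trans (h.π_liftUnitary he a), this.2.trans (h.π_liftUnitary he b)⟩

end IsCornerMap

end Corner

section Factor

variable {F C A : Type u} [Field F] [Ring C] [Algebra F C] [Ring A] [Algebra F A]
variable (σ : AlgInvolution F C) (φ : C →ₐ[F] C) (hφ : ∀ a, φ (φ a) = a)
  (hσ : ∀ a, σ.toLin (φ a) = φ (σ.toLin a))

/-- The symmetric pair `P` is the factor of `(U(C, σ), φ)` that belongs to the central idempotent
`f` of `C`. -/
def IsFactor (f : C) (P : SymmetricPair F) : Prop :=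
  ∃ l : (SymmetricPair.unitaryAut σ φ hφ hσ).G ⟶ P.G,
    (∀ R x, l.app R ((SymmetricPair.unitaryAut σ φ hφ hσ).θ.app R x) = P.θ.app R (l.app R x)) ∧
    ∀ R : CommAlgCat.{u} F, Function.Surjective (l.app R) ∧
      ∀ u v : σ.unitarySubgroup R, l.app R u = l.app R v ↔
        ((1 : R) ⊗ₜ[F] f) * u.1.val = ((1 : R) ⊗ₜ[F] f) * v.1.val

variable {σ φ hφ hσ}

theorem extHom_involutive (hφ : ∀ a, φ (φ a) = a) (R : CommAlgCat.{u} F) (x : R ⊗[F] C) :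
    SymmetricPair.extHom φ R (SymmetricPair.extHom φ R x) = x :=
  SymmetricPair.extHom_extHom φ hφ R x

theorem extHom_one_tmul (R : CommAlgCat.{u} F) (c : C) :
    SymmetricPair.extHom φ R ((1 : R) ⊗ₜ[F] c) = (1 : R) ⊗ₜ[F] φ c := by
  simp [SymmetricPair.extHom]

/-- The factor of an idempotent that is stable under `σ` and `φ`. -/
theorem isFactor_unitaryAut {e : C} {π : C →ₐ[F] A} {ι : A →ₗ[F] C} (h : IsCornerMap e π ι)
    (σ' : AlgInvolution F A) (φ' : A →ₐ[F] A) (hφ' : ∀ a, φ' (φ' a) = a)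
    (hσ' : ∀ a, σ'.toLin (φ' a) = φ' (σ'.toLin a)) (he : σ.toLin e = e)
    (h1 : ∀ c, π (σ.toLin c) = σ'.toLin (π c)) (h2 : ∀ c, π (φ c) = φ' (π c)) :
    IsFactor σ φ hφ hσ e (SymmetricPair.unitaryAut σ' φ' hφ' hσ') := by
  refine ⟨unitaryMap π σ σ' h1, fun R x => ?_, fun R => ⟨fun a => ?_, fun u v => ?_⟩⟩
  · exact Subtype.ext (Units.ext (extHom_map_of_commute π φ φ' h2 R _))
  · let a' : σ'.unitarySubgroup R := a
    refine ⟨(⟨(h.baseChange R).liftUnit a'.1, (h.baseChange R).isUnitary_liftUnit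
      (σ := σ.baseChange R) (σ' := σ'.baseChange R) (ext_map_of_commute π σ σ' h1 R) ?_ a'.2⟩ :
      σ.unitarySubgroup R), Subtype.ext (Units.ext ((h.baseChange R).π_liftUnit a'.1))⟩
    exact congrArg (fun z => (1 : R) ⊗ₜ[F] z) he
  · rw [← (h.baseChange R).π_eq_iff]
    exact ⟨fun h => congrArg (fun z : σ'.unitarySubgroup R => z.1.val) h,
      fun h => Subtype.ext (Units.ext h)⟩

theorem one_tmul_mul_eq_zero {a b : C} (h : a * b = 0) (R : Type u) [CommRing R] [Algebra F R] :
    ((1 : R) ⊗ₜ[F] a) * ((1 : R) ⊗ₜ[F] b) = 0 := by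
  rw [Algebra.TensorProduct.tmul_mul_tmul, h, TensorProduct.tmul_zero]

theorem AlgInvolution.IsUnitary.one_tmul_add_mul_eq_iff {e : C} {π : C →ₐ[F] A} {ι : A →ₗ[F] C}
    (h : IsCornerMap e π ι) (he : e * σ.toLin e = 0) (R : CommAlgCat.{u} F)
    (u v : σ.unitarySubgroup R) :
    ((1 : R) ⊗ₜ[F] (e + σ.toLin e)) * u.1.val = ((1 : R) ⊗ₜ[F] (e + σ.toLin e)) * v.1.val ↔
      Algebra.TensorProduct.map (AlgHom.id F R) π u.1.val =
        Algebra.TensorProduct.map (AlgHom.id F R) π v.1.val := by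
  rw [(h.baseChange R).π_eq_iff, TensorProduct.tmul_add]
  exact AlgInvolution.IsUnitary.add_mul_eq_iff (σ := σ.baseChange R) (h.baseChange R).comm
    (h.baseChange R).idem (one_tmul_mul_eq_zero he R) u.2 v.2

theorem one_tmul_add_map_mul_eq_iff {e : C} (hφ : ∀ a, φ (φ a) = a) (he : e * e = e)
    (he' : e * φ e = 0) (R : CommAlgCat.{u} F) (u v : R ⊗[F] C) :
    ((1 : R) ⊗ₜ[F] (e + φ e)) * u = ((1 : R) ⊗ₜ[F] (e + φ e)) * v ↔
      ((1 : R) ⊗ₜ[F] e) * u = ((1 : R) ⊗ₜ[F] e) * v ∧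
      ((1 : R) ⊗ₜ[F] e) * SymmetricPair.extHom φ R u =
        ((1 : R) ⊗ₜ[F] e) * SymmetricPair.extHom φ R v := by
  have hinj : Function.Injective (SymmetricPair.extHom φ R) :=
    Function.LeftInverse.injective (extHom_involutive hφ R)
  have he'' : φ e * e = 0 := by rw [← hφ e, ← map_mul, hφ e, he', map_zero]
  have hidem : φ e * φ e = φ e := by rw [← map_mul, he]
  rw [TensorProduct.tmul_add, add_mul_eq_add_mul_iff _ _ (one_tmul_mul_eq_zero he' R)
    (one_tmul_mul_eq_zero he'' R)]
  · refine and_congr Iff.rfl ?_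
    rw [← hinj.eq_iff, map_mul, map_mul, extHom_one_tmul, hφ]
  · rw [Algebra.TensorProduct.tmul_mul_tmul, he, one_mul]
  · rw [Algebra.TensorProduct.tmul_mul_tmul, hidem, one_mul]

/-- The factor of `e + σ e`, where `e` is stable under `φ`. -/
theorem isFactor_unitsAut {e : C} {π : C →ₐ[F] A} {ι : A →ₗ[F] C} (h : IsCornerMap e π ι)
    (φ' : A →ₐ[F] A) (hφ' : ∀ a, φ' (φ' a) = a) (he : e * σ.toLin e = 0)
    (h2 : ∀ c, π (φ c) = φ' (π c)) :
    IsFactor σ φ hφ hσ (e + σ.toLin e) (SymmetricPair.unitsAut φ' hφ') := by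
  refine ⟨unitaryIncl σ ≫ unitsMap π, fun R x => ?_, fun R => ⟨fun a => ?_, fun u v => ?_⟩⟩
  · exact Units.ext (extHom_map_of_commute π φ φ' h2 R _)
  · let a' : (R ⊗[F] A)ˣ := a
    have he' : ((1 : R) ⊗ₜ[F] e) * (σ.baseChange R).toLin ((1 : R) ⊗ₜ[F] e) = 0 :=
      one_tmul_mul_eq_zero he R
    exact ⟨(⟨(h.baseChange R).liftUnitary (σ.baseChange R) a',
      (h.baseChange R).isUnitary_liftUnitary he' a'⟩ : σ.unitarySubgroup R),
      Units.ext ((h.baseChange R).π_liftUnitary he' a')⟩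
  · rw [AlgInvolution.IsUnitary.one_tmul_add_mul_eq_iff h he R]
    exact ⟨fun h => congrArg (fun z : (R ⊗[F] A)ˣ => z.val) h, fun h => Units.ext h⟩

/-- The factor of `e + σ e`, where `e` is stable under `σ φ`. -/
theorem isFactor_unitsUnitary {e : C} {π : C →ₐ[F] A} {ι : A →ₗ[F] C} (h : IsCornerMap e π ι)
    (σ' : AlgInvolution F A) (he : e * σ.toLin e = 0)
    (h2 : ∀ c, π (φ (σ.toLin c)) = σ'.toLin (π c)) :
    IsFactor σ φ hφ hσ (e + σ.toLin e) (SymmetricPair.unitsUnitary σ') := by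
  refine ⟨unitaryIncl σ ≫ unitsMap π, fun R x => ?_, fun R => ⟨fun a => ?_, fun u v => ?_⟩⟩
  · let y : σ.unitarySubgroup R := x
    have hy : (σ.baseChange R).IsUnitary y.1 := y.2
    refine Units.ext ?_
    change Algebra.TensorProduct.map (AlgHom.id F R) π (SymmetricPair.extHom φ R y.1.val) =
      σ'.ext R (Algebra.TensorProduct.map (AlgHom.id F R) π (y.1⁻¹).val)
    have key : ∀ z : R ⊗[F] C, Algebra.TensorProduct.map (AlgHom.id F R) π
        (SymmetricPair.extHom φ R (σ.ext R z)) =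
        σ'.ext R (Algebra.TensorProduct.map (AlgHom.id F R) π z) := by
      intro z
      induction z with
      | zero => simp
      | add x x' hx hx' => simp only [map_add, hx, hx']
      | tmul r a => simp [SymmetricPair.extHom, AlgInvolution.ext_tmul, h2]
    rw [← key]
    have h3 : σ.ext R (y.1⁻¹).val = y.1.val := by
      rw [← hy.eq]
      exact σ.ext_ext R _
    rw [h3]
  · let a' : (R ⊗[F] A)ˣ := a
    have he' : ((1 : R) ⊗ₜ[F] e) * (σ.baseChange R).toLin ((1 : R) ⊗ₜ[F] e) = 0 :=
      one_tmul_mul_eq_zero he R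
    exact ⟨(⟨(h.baseChange R).liftUnitary (σ.baseChange R) a',
      (h.baseChange R).isUnitary_liftUnitary he' a'⟩ : σ.unitarySubgroup R),
      Units.ext ((h.baseChange R).π_liftUnitary he' a')⟩
  · rw [AlgInvolution.IsUnitary.one_tmul_add_mul_eq_iff h he R]
    exact ⟨fun h => congrArg (fun z : (R ⊗[F] A)ˣ => z.val) h, fun h => Units.ext h⟩

variable (σ φ hφ hσ) in
/-- The involution of `U(C, σ)` given by `φ`. -/
def unitaryθ : unitaryFunctor σ ⟶ unitaryFunctor σ := (SymmetricPair.unitaryAut σ φ hφ hσ).θ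

/-- The factor of `e + φ e`, where `e` is stable under `σ`. -/
theorem isFactor_diagonal_unitaryFunctor {e : C} {π : C →ₐ[F] A} {ι : A →ₗ[F] C}
    (h : IsCornerMap e π ι) (σ' : AlgInvolution F A) (he : σ.toLin e = e) (he' : e * φ e = 0)
    (h1 : ∀ c, π (σ.toLin c) = σ'.toLin (π c)) :
    IsFactor σ φ hφ hσ (e + φ e) (SymmetricPair.diagonal (unitaryFunctor σ')) := by
  refine ⟨GroupFunctor.squareLift (unitaryMap π σ σ' h1)
    (unitaryθ σ φ hφ hσ ≫ unitaryMap π σ σ' h1), fun R x => ?_, fun R => ⟨fun a => ?_,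
    fun u v => ?_⟩⟩
  · refine Prod.ext rfl (Subtype.ext (Units.ext ?_))
    exact congrArg (Algebra.TensorProduct.map (AlgHom.id F R) π) (extHom_involutive hφ R _)
  · let a' : σ'.unitarySubgroup R := a.1
    let b' : σ'.unitarySubgroup R := a.2
    obtain ⟨u, hu, hu1, hu2⟩ := (h.baseChange R).exists_unitary_pair (σ := σ.baseChange R)
      (σ' := σ'.baseChange R) (φ := SymmetricPair.extHom φ R) (extHom_involutive hφ R)
      (SymmetricPair.ext_extHom σ φ hσ R) (ext_map_of_commute π σ σ' h1 R)
      (congrArg (fun z => (1 : R) ⊗ₜ[F] z) he)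
      (by rw [extHom_one_tmul]; exact one_tmul_mul_eq_zero he' R) a'.2 b'.2
    exact ⟨(⟨u, hu⟩ : σ.unitarySubgroup R), Prod.ext (Subtype.ext (Units.ext hu1))
      (Subtype.ext (Units.ext hu2))⟩
  · rw [one_tmul_add_map_mul_eq_iff hφ h.idem he', ← (h.baseChange R).π_eq_iff,
      ← (h.baseChange R).π_eq_iff]
    exact ⟨fun h => ⟨congrArg (fun z : σ'.unitarySubgroup R × σ'.unitarySubgroup R => z.1.1.val) h,
      congrArg (fun z : σ'.unitarySubgroup R × σ'.unitarySubgroup R => z.2.1.val) h⟩,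
      fun h => Prod.ext (Subtype.ext (Units.ext h.1)) (Subtype.ext (Units.ext h.2))⟩

/-- The factor of `e + σ e + φ e + φ (σ e)`. -/
theorem isFactor_diagonal_unitsFunctor {e : C} {π : C →ₐ[F] A} {ι : A →ₗ[F] C}
    (h : IsCornerMap e π ι) (he : e * σ.toLin e = 0) (he' : e * φ e = 0)
    (he'' : e * φ (σ.toLin e) = 0) :
    IsFactor σ φ hφ hσ (e + σ.toLin e + φ (e + σ.toLin e))
      (SymmetricPair.diagonal (unitsFunctor F A)) := by
  refine ⟨GroupFunctor.squareLift (unitaryIncl σ ≫ unitsMap π)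
    (unitaryθ σ φ hφ hσ ≫ unitaryIncl σ ≫ unitsMap π), fun R x => ?_, fun R => ⟨fun a => ?_,
    fun u v => ?_⟩⟩
  · refine Prod.ext rfl (Units.ext ?_)
    exact congrArg (Algebra.TensorProduct.map (AlgHom.id F R) π) (extHom_involutive hφ R _)
  · obtain ⟨u, hu, hu1, hu2⟩ := (h.baseChange R).exists_pair (σ := σ.baseChange R)
      (φ := SymmetricPair.extHom φ R) (extHom_involutive hφ R)
      (SymmetricPair.ext_extHom σ φ hσ R) (one_tmul_mul_eq_zero he R)
      (by rw [extHom_one_tmul]; exact one_tmul_mul_eq_zero he' R)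
      (by
        change _ * SymmetricPair.extHom φ R ((1 : R) ⊗ₜ[F] σ.toLin e) = 0
        rw [extHom_one_tmul]; exact one_tmul_mul_eq_zero he'' R) a.1 a.2
    exact ⟨(⟨u, hu⟩ : σ.unitarySubgroup R), Prod.ext (Units.ext hu1) (Units.ext hu2)⟩
  · have hc := h.central_map (σ := σ)
    have h3 : σ.toLin e * φ e = 0 := by
      rw [hc, ← hφ (σ.toLin e), ← map_mul, he'', map_zero]
    have h4 : σ.toLin e * φ (σ.toLin e) = 0 := by
      rw [← hσ, ← σ.map_mul, ← h.comm, he', map_zero]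
    rw [one_tmul_add_map_mul_eq_iff hφ, AlgInvolution.IsUnitary.one_tmul_add_mul_eq_iff h he R]
    · have := AlgInvolution.IsUnitary.one_tmul_add_mul_eq_iff h he R
        ((unitaryθ σ φ hφ hσ).app R u) ((unitaryθ σ φ hφ hσ).app R v)
      refine (Iff.trans ?_ (and_congr Iff.rfl this.symm))
      exact ⟨fun h => ⟨congrArg (fun z : (R ⊗[F] A)ˣ × (R ⊗[F] A)ˣ => z.1.val) h,
        congrArg (fun z : (R ⊗[F] A)ˣ × (R ⊗[F] A)ˣ => z.2.val) h⟩,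
        fun h => Prod.ext (Units.ext h.1) (Units.ext h.2)⟩
    · rw [add_mul, mul_add, mul_add, h.idem, he, hc e, he, σ.mul_self_eq h.idem, add_zero,
        zero_add]
    · rw [map_add, add_mul, mul_add, mul_add, he', he'', h3, h4, add_zero, add_zero]

end Factor

/-! ## The decomposition into factors -/

section Glue

variable {F C : Type u} [Field F] [Ring C] [Algebra F C]
variable {σ : AlgInvolution F C} {φ : C →ₐ[F] C} {hφ : ∀ a, φ (φ a) = a}
  {hσ : ∀ a, σ.toLin (φ a) = φ (σ.toLin a)}

theorem AlgInvolution.exists_glue {n : ℕ} (f : Fin n → C) (hc : ∀ i c, f i * c = c * f i)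
    (h1 : ∑ i, f i = 1) (h2 : ∀ i, f i * f i = f i) (h3 : ∀ i j, i ≠ j → f i * f j = 0)
    (hf : ∀ i, σ.toLin (f i) = f i) (u : Fin n → Cˣ) (hu : ∀ i, σ.IsUnitary (u i)) :
    ∃ v : Cˣ, σ.IsUnitary v ∧ ∀ i, f i * v.val = f i * (u i).val := by
  have key : ∀ a b : Fin n → C, (∑ i, f i * a i) * (∑ j, f j * b j) = ∑ i, f i * (a i * b i) := by
    intro a b
    rw [Finset.sum_mul_sum]
    refine Finset.sum_congr rfl fun i _ => ?_
    rw [Finset.sum_eq_single i]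
    · rw [mul_assoc, ← mul_assoc (a i), ← hc, mul_assoc, ← mul_assoc, h2]
    · intro j _ hj
      rw [hc i, mul_assoc, ← mul_assoc (f i), h3 i j hj.symm, zero_mul, mul_zero]
    · simp
  refine ⟨⟨∑ i, f i * (u i).val, ∑ i, f i * (u i)⁻¹.val, ?_, ?_⟩, ?_, fun i => ?_⟩
  · simp [key, h1]
  · simp [key, h1]
  · change σ.toLin (∑ i, f i * (u i).val) * ∑ i, f i * (u i).val = 1
    have : σ.toLin (∑ i, f i * (u i).val) = ∑ i, f i * (u i)⁻¹.val := by
      rw [map_sum]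
      refine Finset.sum_congr rfl fun i _ => ?_
      rw [σ.map_mul, hf, ← hc, (hu i).eq]
    rw [this, key]
    simp [h1]
  · change f i * ∑ i, f i * (u i).val = _
    rw [Finset.mul_sum, Finset.sum_eq_single i]
    · rw [← mul_assoc, h2]
    · intro j _ hj
      rw [← mul_assoc, h3 i j hj.symm, zero_mul]
    · simp

theorem isomorphic_pi_of_isFactor {n : ℕ} (f : Fin n → C) (hc : ∀ i c, f i * c = c * f i)
    (h1 : ∑ i, f i = 1) (h2 : ∀ i, f i * f i = f i) (h3 : ∀ i j, i ≠ j → f i * f j = 0)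
    (hf : ∀ i, σ.toLin (f i) = f i) (P : Fin n → SymmetricPair F)
    (hP : ∀ i, IsFactor σ φ hφ hσ (f i) (P i)) :
    (SymmetricPair.unitaryAut σ φ hφ hσ).Isomorphic (SymmetricPair.pi P) := by
  choose l hl hl' using hP
  refine SymmetricPair.isomorphic_of_bijective (GroupFunctor.piLift l) (fun R x => ?_)
    fun R => ⟨fun u v huv => ?_, fun a => ?_⟩
  · funext i
    exact hl i R x
  · have huv' : ∀ i, (l i).app R u = (l i).app R v := fun i => congrFun huv i
    have : ∀ i, ((1 : R) ⊗ₜ[F] f i) * (u : σ.unitarySubgroup R).1.val =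
        ((1 : R) ⊗ₜ[F] f i) * (v : σ.unitarySubgroup R).1.val :=
      fun i => ((hl' i R).2 u v).1 (huv' i)
    have h4 : ∑ i, ((1 : R) ⊗ₜ[F] f i) = 1 := by
      rw [← TensorProduct.tmul_sum, h1, Algebra.TensorProduct.one_def]
    refine Subtype.ext (Units.ext ?_)
    change (u : σ.unitarySubgroup R).1.val = (v : σ.unitarySubgroup R).1.val
    rw [← one_mul (u : σ.unitarySubgroup R).1.val, ← one_mul (v : σ.unitarySubgroup R).1.val,
      ← h4, Finset.sum_mul, Finset.sum_mul]
    exact Finset.sum_congr rfl fun i _ => this i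
  · choose u hu using fun i => (hl' i R).1 (a i)
    have hc' : ∀ i (c : R ⊗[F] C), ((1 : R) ⊗ₜ[F] f i) * c = c * ((1 : R) ⊗ₜ[F] f i) := by
      intro i c
      induction c with
      | zero => simp
      | add x x' hx hx' => simp only [mul_add, add_mul, hx, hx']
      | tmul r a => simp [hc]
    have h1' : ∑ i, ((1 : R) ⊗ₜ[F] f i) = 1 := by
      rw [← TensorProduct.tmul_sum, h1, Algebra.TensorProduct.one_def]
    have h2' : ∀ i, ((1 : R) ⊗ₜ[F] f i) * ((1 : R) ⊗ₜ[F] f i) = (1 : R) ⊗ₜ[F] f i := fun i => by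
      rw [Algebra.TensorProduct.tmul_mul_tmul, h2, one_mul]
    obtain ⟨v, hv, hv'⟩ := AlgInvolution.exists_glue (σ := σ.baseChange R)
      (fun i => (1 : R) ⊗ₜ[F] f i) hc' h1' h2'
      (fun i j hij => one_tmul_mul_eq_zero (h3 i j hij) R)
      (fun i => congrArg (fun z => (1 : R) ⊗ₜ[F] z) (hf i))
      (fun i => (u i : σ.unitarySubgroup R).1) (fun i => (u i : σ.unitarySubgroup R).2)
    refine ⟨(⟨v, hv⟩ : σ.unitarySubgroup R), ?_⟩
    funext i
    rw [← hu i]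
    exact ((hl' i R).2 _ _).2 (hv' i)

end Glue

end

noncomputable section

/-! ## Orbits of primitive idempotents -/

section Orbit

variable {L : Type*} [CommRing L]

/-- An idempotent `e` of a commutative ring such that `e L` is a field. -/
structure IsFieldIdempotent (e : L) : Prop where
  idem : e * e = e
  isMaximal : (Ideal.span {1 - e}).IsMaximal

/-- The sum `f` of the orbit of an idempotent `e` under two commuting involutions. -/
inductive IsOrbitSum (σ φ : L →+* L) (e : L) : L → Prop
  | fixed (h1 : σ e = e) (h2 : φ e = e) : IsOrbitSum σ φ e e
  | left (h1 : σ e = e) (h2 : e * φ e = 0) : IsOrbitSum σ φ e (e + φ e)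
  | right (h1 : φ e = e) (h2 : e * σ e = 0) : IsOrbitSum σ φ e (e + σ e)
  | mixed (h1 : φ (σ e) = e) (h2 : e * σ e = 0) : IsOrbitSum σ φ e (e + σ e)
  | free (h1 : e * σ e = 0) (h2 : e * φ e = 0) (h3 : e * φ (σ e) = 0) :
      IsOrbitSum σ φ e (e + σ e + φ (e + σ e))

theorem IsFieldIdempotent.mul_eq_zero_or {e : L} (he : IsFieldIdempotent e) {e' : L}
    (he' : e' * e' = e') : e * e' = 0 ∨ e * e' = e := by
  have hmem : ∀ y ∈ Ideal.span {1 - e}, e * y = 0 := by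
    intro y hy
    obtain ⟨c, rfl⟩ := Ideal.mem_span_singleton'.1 hy
    linear_combination c * (-he.idem)
  have : e' * (1 - e') ∈ Ideal.span {1 - e} := by
    rw [mul_sub, mul_one, he', sub_self]
    exact zero_mem _
  rcases he.isMaximal.isPrime.mem_or_mem this with h | h
  · exact Or.inl (hmem _ h)
  · refine Or.inr ?_
    have := hmem _ h
    linear_combination -this

theorem IsFieldIdempotent.mul_map_eq_zero_or {e : L} (he : IsFieldIdempotent e) (ψ : L →+* L)
    (hψ : ∀ a, ψ (ψ a) = a) : e * ψ e = 0 ∨ ψ e = e := by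
  rcases he.mul_eq_zero_or (e' := ψ e) (by rw [← map_mul, he.idem]) with h | h
  · exact Or.inl h
  · refine Or.inr ?_
    have h2 := congrArg ψ h
    rw [map_mul, hψ, mul_comm, h] at h2
    exact h2.symm

theorem IsFieldIdempotent.ne_zero {e : L} (he : IsFieldIdempotent e) : e ≠ 0 := by
  rintro rfl
  apply he.isMaximal.ne_top
  rw [sub_zero, Ideal.span_singleton_one]

theorem IsFieldIdempotent.exists_isOrbitSum {e : L} (he : IsFieldIdempotent e) (σ φ : L →+* L)
    (hσ : ∀ a, σ (σ a) = a) (hφ : ∀ a, φ (φ a) = a) (hσφ : ∀ a, σ (φ a) = φ (σ a)) :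
    ∃ f, IsOrbitSum σ φ e f := by
  rcases he.mul_map_eq_zero_or σ hσ with h1 | h1
  · rcases he.mul_map_eq_zero_or φ hφ with h2 | h2
    · rcases he.mul_map_eq_zero_or (φ.comp σ) (fun a => by simp [hσφ, hσ, hφ]) with h3 | h3
      · exact ⟨_, .free h1 h2 h3⟩
      · exact ⟨_, .mixed h3 h1⟩
    · exact ⟨_, .right h2 h1⟩
  · rcases he.mul_map_eq_zero_or φ hφ with h2 | h2
    · exact ⟨_, .left h1 h2⟩
    · exact ⟨_, .fixed h1 h2⟩

theorem IsOrbitSum.spec {σ φ : L →+* L} {e f : L} (h : IsOrbitSum σ φ e f) (he : e * e = e)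
    (hσ : ∀ a, σ (σ a) = a) (hφ : ∀ a, φ (φ a) = a) (hσφ : ∀ a, σ (φ a) = φ (σ a)) :
    f * f = f ∧ σ f = f ∧ φ f = f ∧ f * e = e ∧
      ∀ g, σ g = g → φ g = g → e * g = e → f * g = f := by
  have hs : σ e * σ e = σ e := by rw [← map_mul, he]
  have hp : φ e * φ e = φ e := by rw [← map_mul, he]
  have hps : φ (σ e) * φ (σ e) = φ (σ e) := by rw [← map_mul, hs]
  have hgs : ∀ g, σ g = g → e * g = e → σ e * g = σ e := fun g h1 h2 => by
    nth_rewrite 1 [← h1]; rw [← map_mul, h2]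
  have hgp : ∀ g, φ g = g → e * g = e → φ e * g = φ e := fun g h1 h2 => by
    nth_rewrite 1 [← h1]; rw [← map_mul, h2]
  have hgps : ∀ g, σ g = g → φ g = g → e * g = e → φ (σ e) * g = φ (σ e) := fun g h0 h1 h2 => by
    nth_rewrite 1 [← h1]; rw [← map_mul, hgs g h0 h2]
  cases h with
  | fixed h1 h2 => exact ⟨he, h1, h2, he, fun g _ _ h => h⟩
  | left h1 h2 =>
    refine ⟨by linear_combination he + hp + 2 * h2, ?_, ?_, by linear_combination he + h2,
      fun g g1 g2 g3 => by linear_combination g3 + hgp g g2 g3⟩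
    · rw [map_add, hσφ, h1]
    · rw [map_add, hφ, add_comm]
  | right h1 h2 =>
    refine ⟨by linear_combination he + hs + 2 * h2, ?_, ?_, by linear_combination he + h2,
      fun g g1 g2 g3 => by linear_combination g3 + hgs g g1 g3⟩
    · rw [map_add, hσ, add_comm]
    · rw [map_add, ← hσφ, h1]
  | mixed h1 h2 =>
    refine ⟨by linear_combination he + hs + 2 * h2, ?_, ?_, by linear_combination he + h2,
      fun g g1 g2 g3 => by linear_combination g3 + hgs g g1 g3⟩
    · rw [map_add, hσ, add_comm]
    · have : φ e = σ e := by rw [← hφ (σ e), h1]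
      rw [map_add, h1, this, add_comm]
  | free h1 h2 h3 =>
    have h4 : σ e * φ e = 0 := by
      rw [← hφ (σ e), ← map_mul, mul_comm, h3, map_zero]
    have h5 : σ e * φ (σ e) = 0 := by rw [← hσφ, ← map_mul, h2, map_zero]
    have h6 : φ e * φ (σ e) = 0 := by rw [← map_mul, h1, map_zero]
    simp only [map_add]
    refine ⟨by linear_combination he + hs + hp + hps + 2 * (h1 + h2 + h3 + h4 + h5 + h6), ?_, ?_,
      by linear_combination he + h1 + h2 + h3,
      fun g g1 g2 g3 => by
        linear_combination g3 + hgs g g1 g3 + hgp g g2 g3 + hgps g g1 g2 g3⟩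
    · simp only [hσφ, hσ]; ring
    · simp only [hφ]; ring

theorem exists_isFieldIdempotent [IsArtinianRing L] [IsReduced L] {g : L} (hg : g * g = g)
    (h0 : g ≠ 0) : ∃ e, IsFieldIdempotent e ∧ e * g = e := by
  have hne : Ideal.span {1 - g} ≠ ⊤ := by
    intro h
    apply h0
    obtain ⟨c, hc⟩ := Ideal.mem_span_singleton'.1 ((Ideal.eq_top_iff_one _).1 h)
    linear_combination (-g) * hc - c * hg
  obtain ⟨I, hI, hle⟩ := Ideal.exists_le_maximal _ hne
  have := IsArtinianRing.isSemisimpleRing_of_isReduced L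
  obtain ⟨e, he, rfl⟩ := IsSemisimpleRing.ideal_eq_span_idempotent I
  have he' : e * e = e := he
  obtain ⟨c, hc⟩ := Ideal.mem_span_singleton'.1 (hle (Ideal.mem_span_singleton_self _))
  refine ⟨1 - e, ⟨by linear_combination he', by rwa [sub_sub_cancel]⟩, ?_⟩
  linear_combination c * he' + (1 - e) * hc

/-- A stable idempotent is the sum of an orthogonal family of orbit sums. -/
theorem exists_isOrbitSum_family [IsArtinianRing L] [IsReduced L] (σ φ : L →+* L)
    (hσ : ∀ a, σ (σ a) = a) (hφ : ∀ a, φ (φ a) = a) (hσφ : ∀ a, σ (φ a) = φ (σ a))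
    (g : L) (hg : g * g = g) (hg1 : σ g = g) (hg2 : φ g = g) :
    ∃ (n : ℕ) (f : Fin n → L), ∑ i, f i = g ∧ (∀ i, f i * f i = f i) ∧
      (∀ i j, i ≠ j → f i * f j = 0) ∧
      ∀ i, ∃ e, IsFieldIdempotent e ∧ IsOrbitSum σ φ e (f i) := by
  induction h : Ideal.span {g} using WellFoundedLT.induction generalizing g with
  | ind I ih =>
    by_cases h0 : g = 0
    · exact ⟨0, Fin.elim0, by simp [h0], fun i => i.elim0, fun i => i.elim0, fun i => i.elim0⟩
    obtain ⟨e, he, heg⟩ := exists_isFieldIdempotent hg h0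
    obtain ⟨f, hf⟩ := he.exists_isOrbitSum σ φ hσ hφ hσφ
    obtain ⟨f1, f2, f3, f4, f5⟩ := hf.spec he.idem hσ hφ hσφ
    have hfg := f5 g hg1 hg2 heg
    have hlt : Ideal.span {g - f} < I := by
      rw [← h]
      refine lt_of_le_of_ne ?_ fun heq => ?_
      · rw [Ideal.span_singleton_le_span_singleton]
        exact ⟨1 - f, by linear_combination hfg⟩
      · have : g ∈ Ideal.span {g - f} := heq ▸ Ideal.mem_span_singleton_self g
        obtain ⟨c, hc⟩ := Ideal.mem_span_singleton'.1 this
        apply he.ne_zero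
        have hf0 : f = 0 := by linear_combination (-f) * hc + c * hfg - c * f1 - hfg
        rw [← f4, hf0, zero_mul]
    obtain ⟨n, f', s1, s2, s3, s4⟩ := ih (Ideal.span {g - f}) hlt (g - f)
      (by linear_combination hg + f1 - 2 * hfg) (by rw [map_sub, hg1, f2])
      (by rw [map_sub, hg2, f3]) rfl
    have hf' : ∀ i, f' i * (g - f) = f' i := by
      intro i
      rw [← s1, Finset.mul_sum, Finset.sum_eq_single i]
      · exact s2 i
      · exact fun j _ hj => s3 i j hj.symm
      · simp
    have hff : ∀ i, f * f' i = 0 := fun i => by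
      linear_combination (-f) * hf' i + f' i * hfg - f' i * f1
    refine ⟨n + 1, Fin.cons f f', ?_, ?_, ?_, ?_⟩
    · rw [Fin.sum_cons, s1]; ring
    · exact Fin.cases (by simpa using f1) (by simpa using s2)
    · refine Fin.cases (Fin.cases (by simp) fun j _ => by simpa using hff j)
        fun i => Fin.cases (fun _ => ?_) fun j hij => ?_
      · simpa [mul_comm] using hff i
      · simpa using s3 i j (fun h => hij (by rw [h]))
    · exact Fin.cases ⟨e, he, by simpa using hf⟩ fun i => by simpa using s4 i
end Orbit

end

noncomputable section

/-! ## Hermitian forms and the trace -/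

section Trace

variable {F D E : Type u} [Field F] [Field D] [Field E] [Algebra F D] [Algebra F E] [Algebra D E]
  [FiniteDimensional D E] [CharZero D]

variable (D) in
theorem trace_mul_injective {x y : E}
    (h : ∀ z, Algebra.trace D E (z * x) = Algebra.trace D E (z * y)) : x = y := by
  rw [← sub_eq_zero]
  refine (traceForm_nondegenerate D E).2 _ fun z => ?_
  rw [Algebra.traceForm_apply, mul_sub, map_sub, h, sub_self]

variable (D) in
theorem exists_trace_mul_eq (l : E →ₗ[D] D) : ∃ x, ∀ z, Algebra.trace D E (z * x) = l z := by
  refine ⟨((Algebra.traceForm D E).toDual (traceForm_nondegenerate D E)).symm l, fun z => ?_⟩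
  have := (Algebra.traceForm D E).apply_toDual_symm_apply (hB := traceForm_nondegenerate D E) l z
  rw [← this, Algebra.traceForm_apply, mul_comm]

theorem trace_map_eq (τ : D ≃ₐ[F] D) (s : E ≃ₐ[F] E)
    (hs : ∀ d : D, s (algebraMap D E d) = algebraMap D E (τ d)) (z : E) :
    Algebra.trace D E (s z) = τ (Algebra.trace D E z) := by
  have := Algebra.trace_eq_of_equiv_equiv (τ : D ≃+* D) (s : E ≃+* E)
    (RingHom.ext fun d => (hs d).symm) z
  rw [this]
  exact (τ.apply_symm_apply _).symm

/-- A hermitian form over `D` for which the adjoint of the multiplication with `z ∈ E` is the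
multiplication with `s z` is the trace of a hermitian form over `E`. -/
theorem HermitianForm.exists_trace_eq {τ : D ≃ₐ[F] D} {s : E ≃ₐ[F] E}
    (hs : ∀ d : D, s (algebraMap D E d) = algebraMap D E (τ d)) (hs2 : ∀ z, s (s z) = z)
    {W : Type u} [AddCommGroup W] [Module D W] [Module E W] [IsScalarTower D E W]
    (b : HermitianForm τ W) (hb : ∀ (z : E) w w', b.form (z • w) w' = b.form w (s z • w')) :
    ∃ B : HermitianForm s W, ∀ z w w', Algebra.trace D E (z * B.form w w') = b.form w (z • w') := by
  choose β hβ using fun w w' => exists_trace_mul_eq D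
    ((b.form w).comp ((LinearMap.toSpanSingleton E W w').restrictScalars D))
  have hβ' : ∀ w w' z, Algebra.trace D E (z * β w w') = b.form w (z • w') := hβ
  have hsymm : ∀ w w', s (β w w') = β w' w := by
    intro w w'
    refine trace_mul_injective D fun z => ?_
    have h1 : z * s (β w w') = s (s z * β w w') := by rw [map_mul, hs2]
    rw [h1, trace_map_eq τ s hs, hβ', hβ', b.symm, hb, hs2]
  refine ⟨⟨LinearMap.mk₂'ₛₗ (s : E →+* E) (RingHom.id E) β ?_ ?_ ?_ ?_, ⟨hsymm⟩, ?_, ?_⟩,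
    fun z w w' => hβ' w w' z⟩
  · intro w w₁ w'
    refine trace_mul_injective D fun z => ?_
    simp only [mul_add, map_add, hβ', LinearMap.add_apply]
  · intro y w w'
    refine trace_mul_injective D fun z => ?_
    change _ = Algebra.trace D E (z * (s y * β w w'))
    rw [← mul_assoc, hβ', hβ', hb, smul_smul, mul_comm]
  · intro w w' w₁
    refine trace_mul_injective D fun z => ?_
    simp only [mul_add, map_add, hβ', smul_add]
  · intro y w w'
    refine trace_mul_injective D fun z => ?_
    rw [RingHom.id_apply, smul_eq_mul, ← mul_assoc, hβ', hβ', smul_smul]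
  · intro w hw
    refine b.nondegenerate.1 w fun w' => ?_
    have h1 : β w w' = 0 := hw w'
    have := hβ' w w' 1
    rw [h1, mul_zero, map_zero, one_smul] at this
    exact this.symm
  · intro w hw
    refine b.nondegenerate.2 w fun w' => ?_
    have h1 : β w' w = 0 := hw w'
    have := hβ' w' w 1
    rw [h1, mul_zero, map_zero, one_smul] at this
    exact this.symm

/-- The adjoint for the form over `E` is the adjoint for its trace. -/
theorem HermitianForm.adjoint_eq_of_trace_eq {τ : D ≃ₐ[F] D} {s : E ≃ₐ[F] E}
    {W : Type u} [AddCommGroup W] [Module D W] [Module E W] [FiniteDimensional E W]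
    {b : HermitianForm τ W} {B : HermitianForm s W}
    (hB : ∀ z w w', Algebra.trace D E (z * B.form w w') = b.form w (z • w'))
    {f g : Module.End E W} (h : ∀ w w', b.form (g w) w' = b.form w (f w')) :
    B.adjoint f = g := by
  refine LinearMap.ext fun w => B.injective (LinearMap.ext fun w' => ?_)
  refine trace_mul_injective D fun z => ?_
  rw [B.adjoint_left, hB, hB, h, f.map_smul]

end Trace

/-! ## Descent along a quadratic extension -/

section Descent

variable {K E W : Type u} [Field K] [Field E] [Algebra K E] [AddCommGroup W] [Module E W]
  [Module K W] [IsScalarTower K E W]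

/-- The fixed vectors of a semilinear involution. -/
def fixedVectors (η : W →ₗ[K] W) : Submodule K W := LinearMap.ker (η - LinearMap.id)

theorem mem_fixedVectors {η : W →ₗ[K] W} {w : W} : w ∈ fixedVectors η ↔ η w = w := by
  rw [fixedVectors, LinearMap.mem_ker, LinearMap.sub_apply, LinearMap.id_apply, sub_eq_zero]

theorem exists_galoisDescent [CharZero K] (c : E ≃ₐ[K] E) (hc : c ≠ 1) (hc2 : ∀ z, c (c z) = z)
    (hfix : ∀ z, c z = z → ∃ k, algebraMap K E k = z) (η : W →ₗ[K] W)
    (hη : ∀ (z : E) w, η (z • w) = c z • η w) (hη2 : ∀ w, η (η w) = w) :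
    ∃ T : E ⊗[K] fixedVectors η ≃ₗ[E] W, (∀ z w, T (z ⊗ₜ w) = z • (w : W)) ∧
      ∀ x, T (galoisAct c (fixedVectors η) x) = η (T x) := by
  let T : E ⊗[K] fixedVectors η →ₗ[E] W :=
    LinearMap.liftBaseChange E (fixedVectors η).subtype
  have hT : ∀ z w, T (z ⊗ₜ w) = z • (w : W) := fun z w => by simp [T]
  have hchar : (2 : E) ≠ 0 := by
    rw [← map_ofNat (algebraMap K E) 2]
    exact (map_ne_zero _).2 two_ne_zero
  have hchar' : (2 : K) ≠ 0 := two_ne_zero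
  obtain ⟨y, hy⟩ : ∃ y, c y ≠ y := by
    by_contra! h
    exact hc (AlgEquiv.ext h)
  obtain ⟨δ, hδ, hδ0⟩ : ∃ δ, c δ = -δ ∧ δ ≠ 0 :=
    ⟨y - c y, by rw [map_sub, hc2, neg_sub], sub_ne_zero.2 hy.symm⟩
  let p : W →ₗ[K] fixedVectors η :=
    ((2 : K)⁻¹ • (LinearMap.id + η)).codRestrict _ fun w => by
      rw [mem_fixedVectors]
      simp [hη2, add_comm]
  have hp : ∀ w, (p w : W) = (2 : K)⁻¹ • (w + η w) := fun w => rfl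
  let S : W → E ⊗[K] fixedVectors η := fun w => 1 ⊗ₜ p w + δ ⊗ₜ p (δ⁻¹ • w)
  have hTS : ∀ w, T (S w) = w := by
    intro w
    simp only [S, map_add, hT, hp, hη, map_inv₀, hδ, one_smul]
    have h1 : δ • (δ⁻¹ • w + (-δ)⁻¹ • η w) = w - η w := by
      rw [smul_add, smul_smul, smul_smul, mul_inv_cancel₀ hδ0, inv_neg, mul_neg,
        mul_inv_cancel₀ hδ0, one_smul, neg_smul, one_smul, sub_eq_add_neg]
    rw [smul_comm δ, h1, ← smul_add, show w + η w + (w - η w) = (2 : K) • w by rw [two_smul]; abel,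
      smul_smul, inv_mul_cancel₀ hchar', one_smul]
  have hpz : ∀ (z : E) (w : fixedVectors η), ∃ k : K, algebraMap K E k = (z + c z) / 2 ∧
      p (z • (w : W)) = k • w := by
    intro z w
    obtain ⟨k, hk⟩ := hfix ((z + c z) / 2) (by
      rw [map_div₀, map_add, hc2, map_ofNat, add_comm])
    refine ⟨k, hk, Subtype.ext ?_⟩
    rw [hp, hη, mem_fixedVectors.1 w.2, ← add_smul, Submodule.coe_smul, ← algebraMap_smul E k, hk,
      ← algebraMap_smul E (2 : K)⁻¹, smul_smul, map_inv₀, map_ofNat, mul_comm, div_eq_mul_inv]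
  have hST : ∀ x, S (T x) = x := by
    intro x
    induction x with
    | zero => simp [S]
    | add x x' hx hx' =>
      rw [map_add]
      calc S (T x + T x') = S (T x) + S (T x') := by
            simp only [S, map_add, smul_add, TensorProduct.tmul_add]
            abel
        _ = x + x' := by rw [hx, hx']
    | tmul z w =>
      obtain ⟨k, hk, hk'⟩ := hpz z w
      obtain ⟨k', hk1, hk1'⟩ := hpz (δ⁻¹ * z) w
      simp only [S, hT]
      rw [hk', smul_smul, hk1', ← TensorProduct.smul_tmul, ← TensorProduct.smul_tmul,
        Algebra.smul_def, Algebra.smul_def, hk, hk1, ← TensorProduct.add_tmul, map_mul, map_inv₀,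
        hδ]
      congr 1
      field_simp
      ring
  refine ⟨LinearEquiv.ofBijective T ⟨fun x x' h => ?_, fun w => ⟨S w, hTS w⟩⟩, hT, fun x => ?_⟩
  · rw [← hST x, ← hST x', h]
  · change T _ = η (T x)
    induction x with
    | zero => simp
    | add x x' hx hx' => simp only [map_add, hx, hx']
    | tmul z w => rw [galoisAct_tmul, hT, hT, hη, mem_fixedVectors.1 w.2]

end Descent

end

noncomputable section

/-! ## Centralizers -/

section Centralizer

variable {F A : Type u} [Field F] [Ring A] [Algebra F A]

/-- The element of `A` that corresponds to an `F`-point of `U(A, σ)`. -/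
def pointVal (σ : AlgInvolution F A) (g : (unitaryFunctor σ).obj (CommAlgCat.of F F)) : A :=
  Algebra.TensorProduct.lid F A (g : σ.unitarySubgroup F).1.val

/-- The element of `R ⊗ A` that underlies an `R`-point of `U(A, σ)`. -/
def unitaryVal (σ : AlgInvolution F A) (R : CommAlgCat.{u} F) (g : (unitaryFunctor σ).obj R) :
    R ⊗[F] A :=
  (g : σ.unitarySubgroup R).1.val

variable {σ : AlgInvolution F A}

theorem unitaryVal_injective (R : CommAlgCat.{u} F) : Function.Injective (unitaryVal σ R) :=
  fun _ _ h => Subtype.ext (Units.ext h)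

theorem unitaryVal_mul (R : CommAlgCat.{u} F) (g h : (unitaryFunctor σ).obj R) :
    unitaryVal σ R (g * h) = unitaryVal σ R g * unitaryVal σ R h := rfl

theorem unitaryVal_one (R : CommAlgCat.{u} F) : unitaryVal σ R 1 = 1 := rfl

theorem ext_unitaryVal (R : CommAlgCat.{u} F) (g : (unitaryFunctor σ).obj R) :
    σ.ext R (unitaryVal σ R g) = unitaryVal σ R g⁻¹ :=
  AlgInvolution.IsUnitary.eq (σ := σ.baseChange R) (u := (g : σ.unitarySubgroup R).1)
    (g : σ.unitarySubgroup R).2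

theorem unitaryVal_eq (g : (unitaryFunctor σ).obj (CommAlgCat.of F F)) :
    unitaryVal σ _ g = (1 : F) ⊗ₜ[F] pointVal σ g :=
  ((Algebra.TensorProduct.lid F A).symm_apply_apply _).symm

theorem unitaryVal_ofPoint (g : (unitaryFunctor σ).obj (CommAlgCat.of F F))
    (R : CommAlgCat.{u} F) :
    unitaryVal σ R ((unitaryFunctor σ).ofPoint g R) = (1 : R) ⊗ₜ[F] pointVal σ g := by
  change Algebra.TensorProduct.map (Algebra.ofId F R) (AlgHom.id F A) (unitaryVal σ _ g) = _
  rw [unitaryVal_eq]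
  simp

theorem pointVal_mul (g h : (unitaryFunctor σ).obj (CommAlgCat.of F F)) :
    pointVal σ (g * h) = pointVal σ g * pointVal σ h :=
  map_mul (Algebra.TensorProduct.lid F A) _ _

theorem pointVal_one : pointVal σ 1 = 1 := map_one (Algebra.TensorProduct.lid F A)

theorem pointVal_injective : Function.Injective (pointVal σ) := fun _ _ h =>
  unitaryVal_injective _ ((Algebra.TensorProduct.lid F A).injective h)

theorem toLin_pointVal (g : (unitaryFunctor σ).obj (CommAlgCat.of F F)) :
    σ.toLin (pointVal σ g) = pointVal σ g⁻¹ := by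
  have h := ext_unitaryVal _ g
  rw [unitaryVal_eq, unitaryVal_eq] at h
  have := congrArg (Algebra.TensorProduct.lid F A) h
  change Algebra.TensorProduct.lid F A ((1 : F) ⊗ₜ[F] σ.toLin (pointVal σ g)) = _ at this
  simpa using this

/-- The `F`-point of `U(A, σ)` that corresponds to an element of `A`. -/
theorem exists_pointVal_eq {a b : A} (hab : a * b = 1) (hba : b * a = 1) (h : σ.toLin a = b) :
    ∃ g : (unitaryFunctor σ).obj (CommAlgCat.of F F), pointVal σ g = a := by
  let u : (F ⊗[F] A)ˣ := ⟨1 ⊗ₜ a, 1 ⊗ₜ b, by simp [hab, Algebra.TensorProduct.one_def],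
    by simp [hba, Algebra.TensorProduct.one_def]⟩
  refine ⟨(⟨u, ?_⟩ : σ.unitarySubgroup F), ?_⟩
  · change σ.ext F (1 ⊗ₜ a) * (1 ⊗ₜ a) = 1
    rw [AlgInvolution.ext_tmul, h]
    simp [hba, Algebra.TensorProduct.one_def]
  · change Algebra.TensorProduct.lid F A (1 ⊗ₜ a) = a
    simp

variable (x : A)

variable (F) in
/-- The centralizer of an element. -/
abbrev centr : Subalgebra F A := Subalgebra.centralizer F {x}

theorem mem_centr {x a : A} : a ∈ centr F x ↔ x * a = a * x := by
  simp [Subalgebra.mem_centralizer_iff]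

/-- The restriction of an involution `σ` with `σ(x) = x⁻¹` to the centralizer of `x`. -/
def AlgInvolution.restrictCentr (σ : AlgInvolution F A) {x y : A} (hxy : x * y = 1)
    (hyx : y * x = 1) (hσ : σ.toLin x = y) : AlgInvolution F (centr F x) where
  toLin := σ.toLin.restrict (p := Subalgebra.toSubmodule (centr F x))
    (q := Subalgebra.toSubmodule (centr F x)) (fun a ha => by
      have h1 : x * a = a * x := (mem_centr (F := F)).1 ha
      have h2 := congrArg σ.toLin h1
      rw [σ.map_mul, σ.map_mul, hσ] at h2
      refine (mem_centr (F := F)).2 ?_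
      calc x * σ.toLin a = x * (σ.toLin a * y) * x := by
            rw [mul_assoc, mul_assoc, hyx, mul_one]
        _ = σ.toLin a * x := by rw [h2, ← mul_assoc x, hxy, one_mul])
  map_mul a b := Subtype.ext (σ.map_mul a.1 b.1)
  involutive a := Subtype.ext (σ.involutive a.1)

/-- The restriction of conjugation by an involution `ε` with `ε x ε = x⁻¹` to the centralizer. -/
def conjCentr {x y ε : A} (hxy : x * y = 1) (hyx : y * x = 1) (hε : ε * ε = 1)
    (hεx : ε * x * ε = y) : centr F x →ₐ[F] centr F x :=
  AlgHom.ofLinearMap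
    ((LinearMap.mulLeft F ε ∘ₗ LinearMap.mulRight F ε).restrict
      (p := Subalgebra.toSubmodule (centr F x)) (q := Subalgebra.toSubmodule (centr F x))
      (fun a ha => by
        have h1 : x * a = a * x := (mem_centr (F := F)).1 ha
        have h3 : ε * x = y * ε := by rw [← hεx, mul_assoc, hε, mul_one]
        have h2 : y * (ε * a * ε) = ε * a * ε * y := by
          rw [← hεx]
          calc ε * x * ε * (ε * a * ε) = ε * (x * (ε * ε) * a) * ε := by simp only [mul_assoc]
            _ = ε * a * (ε * ε) * x * ε := by rw [hε, mul_one, h1, mul_one]; simp only [mul_assoc]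
            _ = _ := by simp only [mul_assoc]
        refine (mem_centr (F := F)).2 ?_
        change x * (ε * (a * ε)) = ε * (a * ε) * x
        rw [← mul_assoc ε]
        calc x * (ε * a * ε) = x * (ε * a * ε * y) * x := by
              rw [mul_assoc x, mul_assoc _ y, hyx, mul_one]
          _ = ε * a * ε * x := by rw [← h2, ← mul_assoc x, hxy, one_mul]))
    (Subtype.ext (by change ε * (1 * ε) = 1; rw [one_mul, hε]))
    (fun a b => Subtype.ext (by
      change ε * (a.1 * b.1 * ε) = ε * (a.1 * ε) * (ε * (b.1 * ε))
      calc ε * (a.1 * b.1 * ε) = ε * (a.1 * 1 * b.1 * ε) := by rw [mul_one]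
        _ = _ := by rw [← hε]; simp only [mul_assoc]))

theorem conjCentr_apply {x y ε : A} (hxy : x * y = 1) (hyx : y * x = 1) (hε : ε * ε = 1)
    (hεx : ε * x * ε = y) (a : centr F x) :
    (conjCentr hxy hyx hε hεx a : A) = ε * (a.1 * ε) := rfl

theorem conjCentr_conjCentr {x y ε : A} (hxy : x * y = 1) (hyx : y * x = 1) (hε : ε * ε = 1)
    (hεx : ε * x * ε = y) (a : centr F x) :
    conjCentr hxy hyx hε hεx (conjCentr hxy hyx hε hεx a) = a := by
  refine Subtype.ext ?_
  rw [conjCentr_apply, conjCentr_apply]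
  calc ε * (ε * (a.1 * ε) * ε) = (ε * ε) * a.1 * (ε * ε) := by simp only [mul_assoc]
    _ = a.1 := by rw [hε, one_mul, mul_one]

theorem restrictCentr_conjCentr {x y ε : A} (hxy : x * y = 1) (hyx : y * x = 1) (hε : ε * ε = 1)
    (hεx : ε * x * ε = y) (hσ : σ.toLin x = y) (hσε : σ.toLin ε = ε) (a : centr F x) :
    (σ.restrictCentr hxy hyx hσ).toLin (conjCentr hxy hyx hε hεx a) =
      conjCentr hxy hyx hε hεx ((σ.restrictCentr hxy hyx hσ).toLin a) := by
  refine Subtype.ext ?_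
  rw [conjCentr_apply]
  change σ.toLin (ε * (a.1 * ε)) = ε * (σ.toLin a.1 * ε)
  rw [σ.map_mul, σ.map_mul, hσε, mul_assoc]

/-- An element of `R ⊗ A` that commutes with `x` comes from `R ⊗ C`, where `C` is the centralizer
of `x`. -/
theorem exists_of_commute_one_tmul (R : Type u) [CommRing R] [Algebra F R] {x : A} {z : R ⊗[F] A}
    (hz : ((1 : R) ⊗ₜ[F] x) * z = z * ((1 : R) ⊗ₜ[F] x)) :
    ∃ w : R ⊗[F] centr F x, Algebra.TensorProduct.map (AlgHom.id F R) (centr F x).val w = z := by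
  let ad : A →ₗ[F] A := LinearMap.mulLeft F x - LinearMap.mulRight F x
  have hexact : Function.Exact (centr F x).val.toLinearMap ad := by
    intro a
    constructor
    · intro ha
      exact ⟨⟨a, mem_centr.2 (sub_eq_zero.1 ha)⟩, rfl⟩
    · rintro ⟨a, rfl⟩
      exact sub_eq_zero.2 (mem_centr.1 a.2)
  have h2 := Module.Flat.lTensor_exact R hexact
  have had : ∀ z : R ⊗[F] A, ad.lTensor R z = ((1 : R) ⊗ₜ[F] x) * z - z * ((1 : R) ⊗ₜ[F] x) := by
    intro z
    induction z with
    | zero => simp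
    | add a b ha hb => rw [map_add, ha, hb, mul_add, add_mul]; abel
    | tmul r a => simp [ad]
  obtain ⟨w, hw⟩ := (h2 z).1 (by rw [had, hz, sub_self])
  exact ⟨w, hw⟩

theorem map_val_injective (R : Type u) [CommRing R] [Algebra F R] (S : Subalgebra F A) :
    Function.Injective (Algebra.TensorProduct.map (AlgHom.id F R) S.val) :=
  Module.Flat.lTensor_preserves_injective_linearMap (M := R) S.val.toLinearMap
    Subtype.val_injective

theorem inner_θ_val (ε : (unitaryFunctor σ).obj (CommAlgCat.of F F)) (hε : ε ^ 2 = 1)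
    (R : CommAlgCat.{u} F) (g : (unitaryFunctor σ).obj R) :
    unitaryVal σ R ((SymmetricPair.inner (unitaryFunctor σ) ε hε).θ.app R g) =
      ((1 : R) ⊗ₜ[F] pointVal σ ε) * unitaryVal σ R g * ((1 : R) ⊗ₜ[F] pointVal σ ε) := by
  rw [← unitaryVal_ofPoint ε R, ← unitaryVal_mul, ← unitaryVal_mul]
  rfl

theorem pointVal_inner_θ (ε : (unitaryFunctor σ).obj (CommAlgCat.of F F)) (hε : ε ^ 2 = 1)
    (g : (unitaryFunctor σ).obj (CommAlgCat.of F F)) :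
    pointVal σ ((SymmetricPair.inner (unitaryFunctor σ) ε hε).θ.app _ g) =
      pointVal σ ε * pointVal σ g * pointVal σ ε := by
  have h : ∀ z : (unitaryFunctor σ).obj (CommAlgCat.of F F),
      unitaryVal σ _ z = ((1 : F) ⊗ₜ[F] pointVal σ ε) * unitaryVal σ _ g *
        ((1 : F) ⊗ₜ[F] pointVal σ ε) →
      pointVal σ z = pointVal σ ε * pointVal σ g * pointVal σ ε := by
    intro z hz
    rw [unitaryVal_eq, unitaryVal_eq] at hz
    have := congrArg (Algebra.TensorProduct.lid F A) hz
    simpa using this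
  exact h _ (inner_θ_val ε hε _ g)

/-- The descendant pair is the pair of the centralizer of `x` with the restricted involutions. -/
theorem centralizerPair_isomorphic (ε : (unitaryFunctor σ).obj (CommAlgCat.of F F))
    (hε : ε ^ 2 = 1) (g : (unitaryFunctor σ).obj (CommAlgCat.of F F))
    (hg : (SymmetricPair.inner (unitaryFunctor σ) ε hε).θ.app _ g = g⁻¹)
    {x y e : A} (hx : pointVal σ g = x) (he : pointVal σ ε = e) (hxy : x * y = 1)
    (hyx : y * x = 1) (hee : e * e = 1) (hex : e * x * e = y) (hσ : σ.toLin x = y)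
    (hσe : σ.toLin e = e) :
    ((SymmetricPair.inner (unitaryFunctor σ) ε hε).centralizerPair g hg).Isomorphic
      (SymmetricPair.unitaryAut (σ.restrictCentr hxy hyx hσ) (conjCentr hxy hyx hee hex)
        (conjCentr_conjCentr hxy hyx hee hex)
        (restrictCentr_conjCentr hxy hyx hee hex hσ hσe)) := by
  subst hx he
  have h1 : ∀ a : centr F (pointVal σ g), (centr F (pointVal σ g)).val
      ((σ.restrictCentr hxy hyx hσ).toLin a) = σ.toLin a.1 := fun a => rfl
  have hinj := fun R : CommAlgCat.{u} F => map_val_injective R (centr F (pointVal σ g))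
  have hcomm : ∀ (R : CommAlgCat.{u} F) (w : R ⊗[F] centr F (pointVal σ g)),
      ((1 : R) ⊗ₜ[F] pointVal σ g) *
        Algebra.TensorProduct.map (AlgHom.id F R) (centr F (pointVal σ g)).val w =
      Algebra.TensorProduct.map (AlgHom.id F R) (centr F (pointVal σ g)).val w *
        ((1 : R) ⊗ₜ[F] pointVal σ g) := by
    intro R w
    induction w with
    | zero => simp
    | add a b ha hb => rw [map_add, mul_add, add_mul, ha, hb]
    | tmul r a => simp [(mem_centr (F := F)).1 a.2]
  let l := unitaryMap (centr F (pointVal σ g)).val (σ.restrictCentr hxy hyx hσ) σ h1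
  have hl : ∀ (R : CommAlgCat.{u} F) u, unitaryVal σ R (l.app R u) =
      Algebra.TensorProduct.map (AlgHom.id F R) (centr F (pointVal σ g)).val
        (unitaryVal _ R u) := fun R u => rfl
  refine SymmetricPair.Isomorphic.symm (SymmetricPair.isomorphic_of_bijective
    (GroupFunctor.subLift (G := unitaryFunctor σ)
      (fun R => Subgroup.centralizer {(unitaryFunctor σ).ofPoint g R}) (fun {R S} f z hz => ?_) l
      (fun R u => ?_)) (fun R u => ?_) fun R => ⟨fun u v huv => ?_, fun a => ?_⟩)
  · rw [Subgroup.mem_centralizer_singleton_iff] at hz ⊢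
    rw [← (unitaryFunctor σ).map_ofPoint g f, ← map_mul, ← map_mul, hz]
  · rw [Subgroup.mem_centralizer_singleton_iff]
    apply unitaryVal_injective
    have h2 := hcomm R (unitaryVal _ R u)
    rw [← unitaryVal_ofPoint, ← hl R u, ← unitaryVal_mul, ← unitaryVal_mul] at h2
    exact h2.symm
  · refine Subtype.ext (unitaryVal_injective R ?_)
    refine Eq.trans ?_ (inner_θ_val ε hε R (l.app R u)).symm
    refine Eq.trans ?_ (congrArg (fun w => ((1 : R) ⊗ₜ[F] pointVal σ ε) * w *
      ((1 : R) ⊗ₜ[F] pointVal σ ε)) (hl R u).symm)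
    change Algebra.TensorProduct.map (AlgHom.id F R) (centr F (pointVal σ g)).val
      (SymmetricPair.extHom (conjCentr hxy hyx hee hex) R (unitaryVal _ R u)) = _
    generalize unitaryVal _ R u = w
    induction w with
    | zero => simp
    | add a b ha hb => simp only [map_add, ha, hb, mul_add, add_mul]
    | tmul r a => simp [SymmetricPair.extHom, conjCentr_apply, mul_assoc]
  · apply unitaryVal_injective
    apply hinj R
    have : l.app R u = l.app R v := congrArg Subtype.val huv
    exact (hl R u).symm.trans ((congrArg (unitaryVal σ R) this).trans (hl R v))
  · obtain ⟨a, ha⟩ : {a : (unitaryFunctor σ).obj R //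
      a ∈ Subgroup.centralizer {(unitaryFunctor σ).ofPoint g R}} := a
    have ha' : ∀ b : (unitaryFunctor σ).obj R, b ∈ Subgroup.centralizer
        {(unitaryFunctor σ).ofPoint g R} → ∃ w, Algebra.TensorProduct.map (AlgHom.id F R)
        (centr F (pointVal σ g)).val w = unitaryVal σ R b := by
      intro b hb
      rw [Subgroup.mem_centralizer_singleton_iff] at hb
      apply exists_of_commute_one_tmul
      rw [← unitaryVal_ofPoint, ← unitaryVal_mul, ← unitaryVal_mul, hb]
    obtain ⟨w, hw⟩ := ha' a ha
    obtain ⟨w', hw'⟩ := ha' a⁻¹ (inv_mem ha)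
    have h2 : w * w' = 1 := hinj R (by
      rw [map_mul, hw, hw', ← unitaryVal_mul, mul_inv_cancel, map_one, unitaryVal_one])
    have h3 : w' * w = 1 := hinj R (by
      rw [map_mul, hw, hw', ← unitaryVal_mul, inv_mul_cancel, map_one, unitaryVal_one])
    refine ⟨(⟨⟨w, w', h2, h3⟩, ?_⟩ : (σ.restrictCentr hxy hyx hσ).unitarySubgroup R),
      Subtype.ext (unitaryVal_injective R hw)⟩
    change (σ.restrictCentr hxy hyx hσ).ext R w * w = 1
    apply hinj R
    rw [map_mul, ext_map_of_commute _ _ σ h1, hw, ext_unitaryVal, ← unitaryVal_mul,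
      inv_mul_cancel, map_one, unitaryVal_one]

end Centralizer

end

noncomputable section

/-! ## Semisimple elements of algebras -/

section SemisimpleElement

open Polynomial

variable {F A : Type*} [Field F] [Ring A] [Algebra F A]

variable (F) in
/-- An element of an algebra that is a root of a squarefree polynomial. -/
def IsSemisimpleElement (a : A) : Prop := ∃ p : F[X], Squarefree p ∧ aeval a p = 0

theorem aeval_lmul (a : A) (p : F[X]) :
    aeval (Algebra.lmul F A a) p = Algebra.lmul F A (aeval a p) :=
  aeval_algHom_apply (Algebra.lmul F A) a p

theorem lmul_injective : Function.Injective (Algebra.lmul F A) := fun a b h => by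
  have := congrArg (fun f : Module.End F A => f 1) h
  simpa using this

variable [FiniteDimensional F A]

theorem isSemisimpleElement_iff {a : A} :
    IsSemisimpleElement F a ↔ (Algebra.lmul F A a).IsSemisimple := by
  constructor
  · rintro ⟨p, hp, hpa⟩
    refine Module.End.isSemisimple_of_squarefree_aeval_eq_zero hp ?_
    rw [aeval_lmul, hpa, map_zero]
  · intro h
    refine ⟨_, h.minpoly_squarefree, lmul_injective (F := F) ?_⟩
    rw [← aeval_lmul, minpoly.aeval, map_zero]

theorem IsSemisimpleElement.mul_sub_one_eq_zero [CharZero F] {a b : A}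
    (ha : IsSemisimpleElement F a)
    (hb : IsSemisimpleElement F b) (hab : Commute a b) (h : IsNilpotent (a * b - 1)) :
    a * b = 1 := by
  rw [isSemisimpleElement_iff] at ha hb
  have h1 : (Algebra.lmul F A (a * b - 1)).IsSemisimple := by
    rw [map_sub, map_mul, map_one]
    refine Module.End.IsSemisimple.sub_of_commute (Commute.one_right _) ?_
      Module.End.isSemisimple_id
    exact Module.End.IsSemisimple.mul_of_commute (hab.map (Algebra.lmul F A)) ha hb
  have h2 := Module.End.eq_zero_of_isNilpotent_isSemisimple (h.map (Algebra.lmul F A)) h1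
  rw [← sub_eq_zero]
  exact lmul_injective (F := F) (by rw [h2, map_zero])

theorem exists_isNilpotent_isSemisimpleElement [CharZero F] (x : A) :
    ∃ n s : A, s ∈ Algebra.adjoin F {x} ∧ IsNilpotent n ∧ IsSemisimpleElement F s ∧ x = n + s := by
  obtain ⟨n, hn, s, hs, hn', hs', h⟩ :=
    Module.End.exists_isNilpotent_isSemisimple (K := F) (f := Algebra.lmul F A x)
  have : Algebra.adjoin F {Algebra.lmul F A x} = (Algebra.adjoin F {x}).map (Algebra.lmul F A) := by
    rw [AlgHom.map_adjoin, Set.image_singleton]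
  rw [this] at hn hs
  obtain ⟨n, hn, rfl⟩ := hn
  obtain ⟨s, hs, rfl⟩ := hs
  refine ⟨n, s, hs, ?_, isSemisimpleElement_iff.2 hs', lmul_injective (F := F) ?_⟩
  · exact (IsNilpotent.map_iff (lmul_injective (F := F))).1 hn'
  · rw [map_add]; exact h

/-- Lifting of approximate square roots. -/
theorem exists_sqrt_of_isNilpotent [CharZero F] {b : A} (hb : IsUnit b) (q : F[X])
    (hq : IsNilpotent (aeval b (q ^ 2 - X))) :
    ∃ p : F[X], aeval b p * aeval b p = b ∧ IsNilpotent (aeval b p - aeval b q) := by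
  let φ : F[X] →ₐ[F] A := aeval b
  let S := F[X] ⧸ RingHom.ker φ
  let ψ : S →ₐ[F] A := Ideal.kerLiftAlg φ
  have hψ : Function.Injective ψ := Ideal.kerLiftAlg_injective φ
  have hmk : ∀ p : F[X], ψ (Ideal.Quotient.mk _ p) = aeval b p := fun p =>
    Ideal.kerLiftAlg_mk φ p
  have : FiniteDimensional F S := FiniteDimensional.of_injective ψ.toLinearMap hψ
  have : IsArtinianRing S := IsArtinianRing.of_finite F S
  let r : S := Ideal.Quotient.mk _ X
  let y : S := Ideal.Quotient.mk _ q
  have hr : IsUnit r := by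
    refine IsArtinianRing.isUnit_of_mem_nonZeroDivisors ?_
    rw [mem_nonZeroDivisors_iff_right]
    intro z hz
    apply hψ
    have := congrArg ψ hz
    rw [map_mul, hmk, aeval_X, map_zero] at this
    rw [map_zero]
    exact (hb.mul_left_eq_zero).1 this
  have hnil : IsNilpotent (y ^ 2 - r) := by
    rw [← IsNilpotent.map_iff hψ, map_sub, map_pow, hmk, hmk, ← map_pow, ← map_sub]
    exact hq
  have hy : IsUnit y := by
    have : IsUnit (y ^ 2) := by
      rw [← sub_add_cancel (y ^ 2) r]
      exact IsNilpotent.isUnit_add_right_of_commute hnil hr (Commute.all _ _)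
    exact (isUnit_pow_iff two_ne_zero).1 this
  have h2 : IsUnit (2 : S) := by
    rw [← map_ofNat (algebraMap F S) 2]
    exact (IsUnit.mk0 _ two_ne_zero).map _
  obtain ⟨z, ⟨hz1, hz2⟩, -⟩ := existsUnique_nilpotent_sub_and_aeval_eq_zero
    (P := (X ^ 2 - C r : S[X])) (x := y) (by simpa using hnil)
    (by simpa [one_add_one_eq_two] using h2.mul hy)
  obtain ⟨p, rfl⟩ := Ideal.Quotient.mk_surjective z
  refine ⟨p, ?_, ?_⟩
  · have := congrArg ψ hz2
    simp only [map_sub, map_pow, aeval_X, aeval_C, Algebra.algebraMap_self, RingHom.id_apply,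
      map_zero] at this
    rw [hmk, hmk, aeval_X, sub_eq_zero, sq] at this
    exact this
  · have := (hz1.map ψ).neg
    rwa [map_sub, hmk, hmk, neg_sub] at this

theorem exists_sqrt_of_isAlgClosed [CharZero F] [IsAlgClosed F] {b : A} (hb : IsUnit b) :
    ∃ p : F[X], aeval b p * aeval b p = b := by
  classical
  have hsq : ∀ α : F, ∃ β, β ^ 2 = α := fun α => IsAlgClosed.exists_pow_nat_eq α two_pos
  choose r hr using hsq
  let f := minpoly F b
  have hf : f.Monic := minpoly.monic (Algebra.IsIntegral.isIntegral b)
  let q : F[X] := Lagrange.interpolate f.roots.toFinset id r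
  have hq : ∀ α ∈ f.roots, (X - C α) ∣ q ^ 2 - X := by
    intro α hα
    rw [dvd_iff_isRoot, IsRoot.def, eval_sub, eval_pow, eval_X]
    have := Lagrange.eval_interpolate_at_node (s := f.roots.toFinset) (v := id) r
      Function.injective_id.injOn (Multiset.mem_toFinset.2 hα)
    rw [id] at this
    rw [this, hr, sub_self]
  have key : ∀ M : Multiset F, (∀ α ∈ M, (X - C α) ∣ q ^ 2 - X) →
      (M.map fun α => X - C α).prod ∣ (q ^ 2 - X) ^ Multiset.card M := by
    intro M
    induction M using Multiset.induction with
    | empty => simp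
    | cons α M ih =>
      intro h
      rw [Multiset.map_cons, Multiset.prod_cons, Multiset.card_cons, pow_succ']
      exact mul_dvd_mul (h α (Multiset.mem_cons_self _ _))
        (ih fun β hβ => h β (Multiset.mem_cons_of_mem hβ))
  have hdvd := key f.roots hq
  rw [← (IsAlgClosed.splits f).eq_prod_roots_of_monic hf] at hdvd
  obtain ⟨p, hp, -⟩ := exists_sqrt_of_isNilpotent hb q ⟨Multiset.card f.roots, by
    obtain ⟨c, hc⟩ := hdvd
    rw [← map_pow, hc, map_mul, minpoly.aeval, zero_mul]⟩
  exact ⟨p, hp⟩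

omit [FiniteDimensional F A] in
theorem commute_aeval {a b : A} (h : Commute a b) (p : F[X]) : Commute a (aeval b p) :=
  Algebra.commute_of_mem_adjoin_singleton_of_commute (aeval_mem_adjoin_singleton F b) h

omit [FiniteDimensional F A] in
/-- Square roots of a unipotent element that are unipotent are unique. -/
theorem sqrt_unique [CharZero F] {v w : A} (hvw : Commute v w) (hv : IsNilpotent (v - 1))
    (hw : IsNilpotent (w - 1)) (h : v * v = w * w) : v = w := by
  have h1 : IsUnit (v + w) := by
    have h2 : IsUnit (2 : A) := by
      rw [← map_ofNat (algebraMap F A) 2]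
      exact (IsUnit.mk0 _ two_ne_zero).map _
    have h3 : IsNilpotent ((v - 1) + (w - 1)) := by
      refine Commute.isNilpotent_add ?_ hv hw
      exact ((hvw.sub_left (Commute.one_left _)).sub_right (Commute.one_right _))
    have : v + w = (v - 1) + (w - 1) + 2 := by
      rw [← one_add_one_eq_two]; abel
    rw [this]
    exact IsNilpotent.isUnit_add_right_of_commute h3 h2 (Commute.ofNat_right _ 2)
  have h4 : (v - w) * (v + w) = 0 := by
    rw [sub_mul, mul_add, mul_add, h, hvw.eq]; abel
  exact sub_eq_zero.1 ((h1.mul_left_eq_zero).1 h4)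

end SemisimpleElement

/-! ## The unipotent part of an element of a symmetric space -/

section Unipotent

variable {F A : Type*} [Field F] [Ring A] [Algebra F A]

/-- A linear map that is multiplicative on commuting elements; automorphisms and
anti-automorphisms have this property. -/
structure IsCommHom (T : A →ₗ[F] A) : Prop where
  map_one : T 1 = 1
  map_mul : ∀ a b, Commute a b → T (a * b) = T a * T b

namespace IsCommHom

variable {T : A →ₗ[F] A} (hT : IsCommHom T)
include hT

theorem commute {a b : A} (h : Commute a b) : Commute (T a) (T b) := by
  change _ * _ = _ * _
  rw [← hT.map_mul a b h, ← hT.map_mul b a h.symm, h.eq]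

theorem map_pow (a : A) (n : ℕ) : T (a ^ n) = T a ^ n := by
  induction n with
  | zero => rw [pow_zero, pow_zero, hT.map_one]
  | succ n ih => rw [pow_succ, pow_succ, hT.map_mul _ _ (Commute.pow_self a n), ih]

theorem map_aeval (a : A) (p : Polynomial F) :
    T (Polynomial.aeval a p) = Polynomial.aeval (T a) p := by
  induction p using Polynomial.induction_on' with
  | add p q hp hq => simp only [map_add, hp, hq]
  | monomial n r =>
    rw [Polynomial.aeval_monomial, Polynomial.aeval_monomial, ← Algebra.smul_def,
      ← Algebra.smul_def, map_smul, hT.map_pow]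

theorem isNilpotent {a : A} (ha : IsNilpotent a) : IsNilpotent (T a) := by
  obtain ⟨n, hn⟩ := ha
  exact ⟨n, by rw [← hT.map_pow, hn, map_zero]⟩

theorem map_eq_of_mul_eq_one {x y : A} (hxy : x * y = 1) (hyx : y * x = 1) (h : T x = y) :
    T y = x := by
  have h1 : y * T y = 1 := by
    rw [← h, ← hT.map_mul x (T x) (by rw [h]; exact hxy.trans hyx.symm), h, hxy, hT.map_one]
  calc T y = x * y * T y := by rw [hxy, one_mul]
    _ = x := by rw [mul_assoc, h1, mul_one]

end IsCommHom

theorem commute_of_mul_eq_one {a b c : A} (hbc : b * c = 1) (hcb : c * b = 1) (h : Commute a b) :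
    Commute a c :=
  Commute.units_inv_right (u := ⟨b, c, hbc, hcb⟩) (a := a) h

theorem isNilpotent_mul_of_commute {a b : A} (h : Commute a b) (ha : IsNilpotent a) :
    IsNilpotent (a * b) := h.isNilpotent_mul_right ha

variable [CharZero F] [FiniteDimensional F A]

/-- If `T₀ x = x⁻¹`, then the unipotent part of `x` is the square of a unipotent element `v` such
that `T v = v⁻¹` whenever `T x = x⁻¹`; it has a Cayley parameter `m`. -/
theorem exists_unipotent_sqrt {x y : A} (hxy : x * y = 1) (hyx : y * x = 1) {T₀ : A →ₗ[F] A}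
    (hT₀ : IsCommHom T₀) (hx : T₀ x = y) :
    ∃ v w m : A, v * w = 1 ∧ w * v = 1 ∧ IsNilpotent m ∧ v * (1 - m) = 1 + m ∧
      (∀ a, Commute a x → Commute a v) ∧ (∀ a, Commute a x → Commute a m) ∧
      IsSemisimpleElement F (w * x * w) ∧
      ∀ T : A →ₗ[F] A, IsCommHom T → T x = y → T v = w ∧ T m = -m := by
  obtain ⟨n, s, hs, hn, hss, hxns⟩ := exists_isNilpotent_isSemisimpleElement (F := F) x
  rw [Algebra.adjoin_singleton_eq_range_aeval] at hs
  obtain ⟨p, rfl⟩ := hs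
  obtain ⟨s, hs⟩ : ∃ s, s = Polynomial.aeval x p := ⟨_, rfl⟩
  obtain ⟨s', hs'⟩ : ∃ s', s' = Polynomial.aeval y p := ⟨_, rfl⟩
  change IsSemisimpleElement F (Polynomial.aeval x p) at hss
  change x = n + Polynomial.aeval x p at hxns
  rw [← hs] at hss hxns
  have cy : ∀ a, Commute a x → Commute a y := fun a ha => commute_of_mul_eq_one hxy hyx ha
  have cs : ∀ a, Commute a x → Commute a s := fun a ha => hs ▸ commute_aeval ha p
  have cs' : ∀ a, Commute a x → Commute a s' := fun a ha => hs' ▸ commute_aeval (cy a ha) p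
  have hTs : ∀ T : A →ₗ[F] A, IsCommHom T → T x = y → T s = s' ∧ T s' = s := fun T hT h => by
    rw [hs, hs', hT.map_aeval, hT.map_aeval, h, hT.map_eq_of_mul_eq_one hxy hyx h]
    exact ⟨rfl, rfl⟩
  have hn_eq : n = x - s := by rw [hxns]; abel
  have cn : ∀ a, Commute a x → Commute a n := fun a ha => by
    rw [hn_eq]; exact ha.sub_right (cs a ha)
  have xs : Commute s x := (cs x rfl).symm
  have xs' : Commute s' x := (cs' x rfl).symm
  have xn : Commute n x := (cn x rfl).symm
  have hss' : s' * s = 1 := by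
    have hs'ss : IsSemisimpleElement F s' := by
      obtain ⟨q, hq, hq'⟩ := hss
      refine ⟨q, hq, ?_⟩
      rw [← (hTs T₀ hT₀ hx).1, ← hT₀.map_aeval, hq', map_zero]
    refine hs'ss.mul_sub_one_eq_zero hss (cs _ xs') ?_
    have hn' : IsNilpotent (T₀ n) := hT₀.isNilpotent hn
    have e1 : T₀ n = y - s' := by rw [hn_eq, map_sub, hx, (hTs T₀ hT₀ hx).1]
    have cn' : ∀ a, Commute a x → Commute a (T₀ n) := fun a ha => by
      rw [e1]; exact (cy a ha).sub_right (cs' a ha)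
    have xn' : Commute (T₀ n) x := (cn' x rfl).symm
    have e2 : s' * s - 1 = (-n) * y + (-(T₀ n)) * s := by
      rw [e1, hn_eq, ← hyx]
      have : x * y = y * x := hxy.trans hyx.symm
      have h3 : s * y = y * s := ((cy s xs)).eq
      rw [neg_mul, neg_mul, sub_mul, sub_mul, this, h3]
      abel
    rw [e2]
    refine Commute.isNilpotent_add ?_ ?_ ?_
    · have c1 : Commute (n * y) (T₀ n * s) :=
        Commute.mul_left ((cn' n xn).mul_right (cs n xn))
          ((cn' y (cy x rfl).symm).mul_right (cs y (cy x rfl).symm))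
      rw [neg_mul, neg_mul]
      exact c1.neg_left.neg_right
    · exact isNilpotent_mul_of_commute (cy n xn).neg_left hn.neg
    · exact isNilpotent_mul_of_commute (cs _ xn').neg_left hn'.neg
  have hss'' : s * s' = 1 := by rw [(cs' s xs).eq, hss']
  obtain ⟨u, hu⟩ : ∃ u, u = x * s' := ⟨_, rfl⟩
  obtain ⟨u', hu'⟩ : ∃ u', u' = y * s := ⟨_, rfl⟩
  have cu : ∀ a, Commute a x → Commute a u := fun a ha => hu ▸ ha.mul_right (cs' a ha)
  have huu' : u * u' = 1 := by
    rw [hu, hu', mul_assoc, ← mul_assoc s', ← (cy s' xs').symm.eq, mul_assoc y, hss', mul_one, hxy]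
  have xu : Commute u x := (cu x rfl).symm
  have cu' : ∀ a, Commute a x → Commute a u' := fun a ha =>
    hu' ▸ (cy a ha).mul_right (cs a ha)
  have huu'' : u' * u = 1 := by rw [← (cu' u xu).eq, huu']
  have hun : IsNilpotent (u - 1) := by
    have : u - 1 = n * s' := by rw [hu, hn_eq, sub_mul, hss'']
    rw [this]
    exact isNilpotent_mul_of_commute (cs' n xn) hn
  obtain ⟨q, hq, hq'⟩ := exists_sqrt_of_isNilpotent (F := F) (b := u) ⟨⟨u, u', huu', huu''⟩, rfl⟩ 1 (by
    rw [map_sub, one_pow, Polynomial.aeval_X, map_one, ← neg_sub]; exact hun.neg)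
  rw [map_one] at hq'
  obtain ⟨v, hv⟩ : ∃ v, v = Polynomial.aeval u q := ⟨_, rfl⟩
  obtain ⟨w, hw⟩ : ∃ w, w = Polynomial.aeval u' q := ⟨_, rfl⟩
  rw [← hv] at hq hq'
  have cv : ∀ a, Commute a x → Commute a v := fun a ha => hv ▸ commute_aeval (cu a ha) q
  have cw : ∀ a, Commute a x → Commute a w := fun a ha => hw ▸ commute_aeval (cu' a ha) q
  have xv : Commute v x := (cv x rfl).symm
  have xw : Commute w x := (cw x rfl).symm
  have hTu : ∀ T : A →ₗ[F] A, IsCommHom T → T x = y → T u = u' := fun T hT h => by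
    rw [hu, hu', hT.map_mul x s' xs'.symm, h, (hTs T hT h).2]
  have hTv : ∀ T : A →ₗ[F] A, IsCommHom T → T x = y → T v = w := fun T hT h => by
    rw [hv, hw, hT.map_aeval, hTu T hT h]
  have hww : w * w = u' := by
    rw [← hTv T₀ hT₀ hx, ← hT₀.map_mul v v rfl, hq, hTu T₀ hT₀ hx]
  have hwn : IsNilpotent (w - 1) := by
    have := hT₀.isNilpotent hq'
    rwa [map_sub, hTv T₀ hT₀ hx, hT₀.map_one] at this
  have hvu : Commute v u' := cu' v xv
  have hvw' : v * u' = w := by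
    refine sqrt_unique (F := F) ((cw v xv).mul_left (cw u' (cu' x rfl).symm)) ?_ hwn ?_
    · have : v * u' - 1 = (-(v - 1)) * (v * u') := by
        rw [neg_mul, sub_mul, ← mul_assoc v v, hq, huu', one_mul]
        abel
      rw [this]
      refine isNilpotent_mul_of_commute ?_ hq'.neg
      exact (((Commute.refl v).mul_right hvu).sub_left (Commute.one_left _)).neg_left
    · rw [mul_assoc, ← mul_assoc u', ← hvu.eq, mul_assoc v, ← mul_assoc v, hq, hww, ← mul_assoc,
        huu', one_mul]
  have hvw : v * w = 1 := by rw [← hvw', ← mul_assoc, hq, huu']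
  have hwv : w * v = 1 := by rw [← (cw v xv).eq, hvw]
  have h2 : IsUnit (v + 1) := by
    have h2 : IsUnit (2 : A) := by
      rw [← map_ofNat (algebraMap F A) 2]
      exact (IsUnit.mk0 _ two_ne_zero).map _
    have : v + 1 = (v - 1) + 2 := by rw [← one_add_one_eq_two]; abel
    rw [this]
    exact IsNilpotent.isUnit_add_right_of_commute hq' h2 (Commute.ofNat_right _ 2)
  obtain ⟨i, hi⟩ := h2
  have ci : ∀ a, Commute a x → Commute a (i⁻¹).val := fun a ha =>
    Commute.units_inv_right (hi ▸ (cv a ha).add_right (Commute.one_right _))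
  have xi : Commute (i⁻¹).val x := (ci x rfl).symm
  obtain ⟨m, hm⟩ : ∃ m, m = (v - 1) * (i⁻¹).val := ⟨_, rfl⟩
  have hmi : m * (v + 1) = v - 1 := by rw [hm, ← hi, Units.inv_mul_cancel_right]
  have cm : ∀ a, Commute a x → Commute a m := fun a ha =>
    hm ▸ ((cv a ha).sub_right (Commute.one_right _)).mul_right (ci a ha)
  have xm : Commute m x := (cm x rfl).symm
  have hcancel : ∀ a b : A, a * (v + 1) = b * (v + 1) → a = b := fun a b h => by
    rw [← hi] at h; exact i.mul_left_inj.1 h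
  have hvm : Commute v m := cm v xv
  refine ⟨v, w, m, hvw, hwv, ?_, ?_, cv, cm, ?_, fun T hT h => ⟨hTv T hT h, ?_⟩⟩
  · rw [hm]
    exact isNilpotent_mul_of_commute ((ci v xv).sub_left (Commute.one_left _)) hq'
  · apply hcancel
    have h3 : v * m * (v + 1) = v * (v - 1) := by rw [mul_assoc, hmi]
    rw [mul_sub, mul_one, sub_mul, h3, add_mul, hmi, one_mul]
    noncomm_ring
  · have : w * x * w = s := by
      rw [mul_assoc, ← (cw x rfl).symm.eq, ← mul_assoc, hww, hu', mul_assoc, xs.eq, ← mul_assoc,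
        hyx, one_mul]
    rw [this]
    exact hss
  · apply hcancel
    have h3 := congrArg T hmi
    rw [hT.map_mul m (v + 1) (hvm.symm.add_right (Commute.one_right _)), map_add, map_sub,
      hTv T hT h, hT.map_one] at h3
    have h4 := congrArg (fun z => z * v) h3
    simp only [sub_mul, one_mul, mul_assoc, add_mul, hwv] at h4
    rw [add_comm v 1, h4, neg_mul, add_comm 1 v, hmi, neg_sub]

end Unipotent

end

noncomputable section

/-! ## Gradings for nilpotent endomorphisms -/

section Grading

open Module.End

variable {K V : Type*} [Field K] [AddCommGroup V] [Module K V]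

theorem mem_ker_pow_of_commute {s m : Module.End K V} (h : Commute s m) (k : ℕ) {v : V}
    (hv : v ∈ LinearMap.ker (m ^ k)) : s v ∈ LinearMap.ker (m ^ k) := by
  rw [LinearMap.mem_ker] at hv ⊢
  rw [← Module.End.mul_apply, ← (h.pow_right k).eq, Module.End.mul_apply, hv, map_zero]

theorem IsSemisimple.exists_isCompl_of_disjoint {s : Module.End K V} (hs : s.IsSemisimple)
    {U N : Submodule K V} (hU : U ∈ invtSubmodule s) (hN : N ∈ invtSubmodule s)
    (hd : Disjoint U N) : ∃ C ∈ invtSubmodule s, U ≤ C ∧ IsCompl N C := by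
  obtain ⟨Y, hY, hYc⟩ := isSemisimple_iff.1 hs (U ⊔ N) (invtSubmodule.sup_mem hU hN)
  refine ⟨U ⊔ Y, invtSubmodule.sup_mem hU hY, le_sup_left, ?_, ?_⟩
  · rw [disjoint_comm, sup_comm]
    refine Disjoint.disjoint_sup_left_of_disjoint_sup_right hd hYc.disjoint.symm
  · rw [codisjoint_iff, ← hYc.sup_eq_top, ← sup_assoc, sup_comm N]

theorem projection_commute {s : Module.End K V} {N C : Submodule K V}
    (hN : N ∈ invtSubmodule s) (hC : C ∈ invtSubmodule s) (h : IsCompl N C) (v : V) :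
    N.projection C h (s v) = s (N.projection C h v) := by
  have h1 : s v = s (N.projection C h v) + s (v - N.projection C h v) := by
    rw [← map_add, add_sub_cancel]
  have h2 : s (v - N.projection C h v) ∈ C := hC (Submodule.sub_projection_mem h v)
  have h3 : s (N.projection C h v) ∈ N := hN (Submodule.projection_apply_mem h v)
  rw [h1, map_add, Submodule.projection_apply_of_mem_left h h3,
    (Submodule.projection_apply_eq_zero_iff h).2 h2, add_zero]

/-- For a nilpotent endomorphism `m` that commutes with a semisimple endomorphism `s`, there is an
endomorphism that commutes with `s`, acts on the `i`-th graded piece of the kernel filtration of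
`m` as `t ^ i`, and intertwines `m` and `t m`. -/
theorem exists_grading {s m : Module.End K V} (hs : s.IsSemisimple) (hsm : Commute s m) (t : ℕ) :
    ∀ (k : ℕ) (U : Submodule K V), U ∈ invtSubmodule s → U ≤ LinearMap.ker (m ^ (k + 1)) →
      Disjoint U (LinearMap.ker (m ^ k)) →
      ∃ a : Module.End K V, (∀ v, a (s v) = s (a v)) ∧
        (∀ v ∈ LinearMap.ker (m ^ (k + 1)), t • a (m v) = m (a v)) ∧
        (∀ i ≤ k, ∀ v ∈ LinearMap.ker (m ^ (i + 1)), a v - t ^ i • v ∈ LinearMap.ker (m ^ i)) ∧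
        ∀ v ∈ U, a v = t ^ k • v := by
  intro k
  induction k with
  | zero =>
    intro U _ _ _
    refine ⟨1, fun v => rfl, fun v hv => ?_, fun i hi v _ => ?_, fun v _ => by simp⟩
    · have : m v = 0 := by simpa using hv
      simp [this]
    · rw [Nat.le_zero.1 hi]
      simp
  | succ k ih =>
    intro U hU hUk hd
    have hN : LinearMap.ker (m ^ (k + 1)) ∈ invtSubmodule s := fun v hv =>
      mem_ker_pow_of_commute hsm _ hv
    obtain ⟨C, hC, hUC, hNC⟩ := IsSemisimple.exists_isCompl_of_disjoint hs hU hN hd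
    have hC0 : ∀ v ∈ C, v ∈ LinearMap.ker (m ^ (k + 1)) → v = 0 := fun v h1 h2 =>
      Submodule.disjoint_def.1 hNC.disjoint v h2 h1
    obtain ⟨a, ha1, ha2, ha3, ha4⟩ := ih
      ((C ⊓ LinearMap.ker (m ^ (k + 2))).map m) (by
        rintro _ ⟨v, ⟨hv1, hv2⟩, rfl⟩
        refine ⟨s v, ⟨hC hv1, mem_ker_pow_of_commute hsm _ hv2⟩, ?_⟩
        exact (LinearMap.congr_fun hsm.eq v).symm) (by
        rintro _ ⟨v, ⟨hv1, hv2⟩, rfl⟩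
        rw [LinearMap.mem_ker, ← Module.End.mul_apply, ← pow_succ]
        exact hv2) (by
        rw [Submodule.disjoint_def]
        rintro _ ⟨v, ⟨hv1, hv2⟩, rfl⟩ hv3
        rw [hC0 v hv1, map_zero]
        rw [LinearMap.mem_ker, ← Module.End.mul_apply, ← pow_succ] at hv3
        exact hv3)
    let π := (LinearMap.ker (m ^ (k + 1))).projection C hNC
    have hπ1 : ∀ v, π v ∈ LinearMap.ker (m ^ (k + 1)) := Submodule.projection_apply_mem hNC
    have hπ2 : ∀ v, v - π v ∈ C := Submodule.sub_projection_mem hNC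
    have hπ3 : ∀ v ∈ LinearMap.ker (m ^ (k + 1)), π v = v := fun v hv =>
      Submodule.projection_apply_of_mem_left hNC hv
    have hπ4 : ∀ v ∈ C, π v = 0 := fun v hv => (Submodule.projection_apply_eq_zero_iff hNC).2 hv
    have hmono : ∀ {i j : ℕ}, i ≤ j → LinearMap.ker (m ^ i) ≤ LinearMap.ker (m ^ j) := by
      intro i j hij v hv
      obtain ⟨l, rfl⟩ := Nat.exists_eq_add_of_le hij
      rw [LinearMap.mem_ker] at hv ⊢
      rw [add_comm, pow_add, Module.End.mul_apply, hv, map_zero]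
    refine ⟨a * π + t ^ (k + 1) • (1 - π), fun v => ?_, fun v hv => ?_, fun i hi v hv => ?_,
      fun v hv => ?_⟩
    · have h1 : π (s v) = s (π v) := projection_commute hN hC hNC v
      simp only [LinearMap.add_apply, LinearMap.smul_apply, LinearMap.sub_apply,
        Module.End.mul_apply, Module.End.one_apply, h1, ha1, map_add, map_sub, map_nsmul]
    · have hcv : v - π v ∈ LinearMap.ker (m ^ (k + 2)) :=
        sub_mem hv (hmono (Nat.le_succ _) (hπ1 v))
      have hmv : m v ∈ LinearMap.ker (m ^ (k + 1)) := by
        rw [LinearMap.mem_ker, ← Module.End.mul_apply, ← pow_succ]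
        exact hv
      have h1 : a (m (v - π v)) = t ^ k • m (v - π v) := ha4 _ ⟨_, ⟨hπ2 v, hcv⟩, rfl⟩
      have h2 : t • a (m (π v)) = m (a (π v)) := ha2 _ (hπ1 v)
      have h3 : m v = m (π v) + m (v - π v) := by rw [← map_add, add_sub_cancel]
      simp only [LinearMap.add_apply, LinearMap.smul_apply, LinearMap.sub_apply,
        Module.End.mul_apply, Module.End.one_apply, hπ3 _ hmv, sub_self, smul_zero, add_zero]
      rw [h3, map_add, smul_add, h2, h1, map_add, map_nsmul, smul_smul, pow_succ']
    · simp only [LinearMap.add_apply, LinearMap.smul_apply, LinearMap.sub_apply,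
        Module.End.mul_apply, Module.End.one_apply]
      rcases Nat.lt_or_eq_of_le hi with hi' | rfl
      · have hv' : v ∈ LinearMap.ker (m ^ (k + 1)) := hmono (by omega) hv
        rw [hπ3 v hv', sub_self, smul_zero, add_zero]
        exact ha3 i (by omega) v hv
      · have h1 := ha3 k le_rfl _ (hπ1 v)
        have h2 : a (π v) ∈ LinearMap.ker (m ^ (k + 1)) := by
          rw [← sub_add_cancel (a (π v)) (t ^ k • π v)]
          exact add_mem (hmono (Nat.le_succ _) h1) (Submodule.smul_of_tower_mem _ _ (hπ1 v))
        have h3 : a (π v) + t ^ (k + 1) • (v - π v) - t ^ (k + 1) • v =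
            a (π v) - t ^ (k + 1) • π v := by rw [smul_sub]; abel
        rw [h3]
        exact sub_mem h2 (Submodule.smul_of_tower_mem _ _ (hπ1 v))
    · simp only [LinearMap.add_apply, LinearMap.smul_apply, LinearMap.sub_apply,
        Module.End.mul_apply, Module.End.one_apply, hπ4 v (hUC hv), map_zero, zero_add, sub_zero]

theorem exists_unit_mul_eq [CharZero K] [FiniteDimensional K V] {s m ε s' : Module.End K V}
    (hs : s.IsSemisimple) (hsm : Commute s m) (hm : IsNilpotent m) (hε : ε * ε = 1)
    (hεm : ε * m * ε = -m) (hεs : ε * s * ε = s') (hss' : s * s' = 1) (hs's : s' * s = 1)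
    {t : ℕ} (ht : t ≠ 0) :
    ∃ a : Module.End K V, IsUnit a ∧ Commute a s ∧ Commute a ε ∧ m * a = t • (a * m) := by
  obtain ⟨k, hk⟩ := hm
  have hk1 : m ^ (k + 1) = 0 := by rw [pow_succ, hk, zero_mul]
  obtain ⟨a, ha1, ha2, ha3, -⟩ := exists_grading hs hsm t k ⊥ (invtSubmodule.bot_mem s) bot_le
    disjoint_bot_left
  have hac : Commute a s := LinearMap.ext ha1
  have ham : m * a = t • (a * m) := by
    refine LinearMap.ext fun v => (ha2 v ?_).symm
    rw [hk1]; rfl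
  have hεm' : m * ε = -(ε * m) := by
    have := congrArg (fun z => ε * z) hεm
    simp only [← mul_assoc, hε, one_mul] at this
    rw [this, mul_neg]
  have hεv : ∀ v, ε (ε v) = v := fun v => LinearMap.congr_fun hε v
  have hεk : ∀ i : ℕ, ∀ v ∈ LinearMap.ker (m ^ i), ε v ∈ LinearMap.ker (m ^ i) := by
    intro i v hv
    have h1 : ∀ i : ℕ, m ^ i * ε = (-1) ^ i * (ε * m ^ i) := by
      intro i
      induction i with
      | zero => simp
      | succ i ih => rw [pow_succ, mul_assoc, hεm', mul_neg, ← mul_assoc, ih, pow_succ]; simp [mul_assoc]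
    rw [LinearMap.mem_ker] at hv ⊢
    rw [← Module.End.mul_apply, h1, Module.End.mul_apply, Module.End.mul_apply, hv, map_zero,
      map_zero]
  have hconj : ∀ p q : Module.End K V, ε * (p * q) * ε = (ε * p * ε) * (ε * q * ε) := by
    intro p q
    calc ε * (p * q) * ε = ε * p * 1 * q * ε := by rw [mul_one]; simp only [mul_assoc]
      _ = _ := by rw [← hε]; simp only [mul_assoc]
  refine ⟨a + ε * a * ε, ?_, ?_, ?_, ?_⟩
  · rw [LinearMap.isUnit_iff_ker_eq_bot, LinearMap.ker_eq_bot']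
    intro v hv
    have key : ∀ i ≤ k, v ∈ LinearMap.ker (m ^ (k - i)) := by
      intro i
      induction i with
      | zero => intro _; rw [Nat.sub_zero, hk]; rfl
      | succ i ih =>
        intro hi
        obtain ⟨j, hj⟩ : ∃ j, k - i = j + 1 := ⟨k - i - 1, by omega⟩
        have hv' := ih (by omega)
        rw [hj] at hv'
        rw [show k - (i + 1) = j by omega]
        have h1 := ha3 j (by omega) v hv'
        have h2 := hεk _ _ (ha3 j (by omega) (ε v) (hεk _ _ hv'))
        have h3 := add_mem h1 h2
        have h4 : a v - t ^ j • v + ε (a (ε v) - t ^ j • ε v) =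
            (a + ε * a * ε) v - (2 * t ^ j) • v := by
          rw [map_sub, map_nsmul, hεv, two_mul, add_smul]
          simp only [LinearMap.add_apply, Module.End.mul_apply]
          abel
        rw [h4, hv, zero_sub, neg_mem_iff] at h3
        rw [← Nat.cast_smul_eq_nsmul K] at h3
        refine (Submodule.smul_mem_iff _ ?_).1 h3
        exact Nat.cast_ne_zero.2 (mul_ne_zero two_ne_zero (pow_ne_zero _ ht))
    have := key k le_rfl
    rw [Nat.sub_self, pow_zero] at this
    exact this
  · refine hac.add_left ?_
    have h1 : Commute a s' :=
      Commute.units_inv_right (u := ⟨s, s', hss', hs's⟩) (a := a) hac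
    have h2 : ε * s' * ε = s := by
      rw [← hεs]
      calc ε * (ε * s * ε) * ε = (ε * ε) * s * (ε * ε) := by simp only [mul_assoc]
        _ = s := by rw [hε, one_mul, mul_one]
    change _ * _ = _ * _
    rw [← h2, ← hconj, ← hconj, h1.eq]
  · change _ * _ = _ * _
    rw [add_mul, mul_add, mul_assoc, hε, mul_one, ← mul_assoc, ← mul_assoc, hε, one_mul, add_comm]
  · have h1 : m = ε * (-m) * ε := by
      rw [mul_neg, neg_mul, hεm, neg_neg]
    have h2 : m * (ε * a * ε) = t • (ε * a * ε * m) := by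
      nth_rewrite 1 [h1]
      nth_rewrite 2 [h1]
      rw [← hconj, ← hconj, neg_mul, mul_neg, ham]
      simp only [mul_neg, neg_mul, mul_smul_comm, smul_mul_assoc, smul_neg]
    rw [mul_add, add_mul, smul_add, ham, h2]

theorem IsSemisimpleElement.isSemisimple {F : Type*} [Field F] [CharZero F] [Algebra F K]
    [Module F V] [IsScalarTower F K V] {s : Module.End K V} (hs : IsSemisimpleElement F s) :
    s.IsSemisimple := by
  obtain ⟨p, hp, hps⟩ := hs
  refine isSemisimple_of_squarefree_aeval_eq_zero (p := p.map (algebraMap F K)) ?_ ?_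
  · exact (Polynomial.Separable.map (PerfectField.separable_iff_squarefree.2 hp)).squarefree
  · rw [Polynomial.aeval_map_algebraMap, hps]

end Grading

end

noncomputable section

/-! ## Closed double cosets -/

section Closed

variable {F : Type u} [Field F]

/-- A curve in `G` that lies in a closed double coset outside of the origin lies in it. -/
theorem SymmetricPair.DoubleCosetClosed.mem_of_curve [CharZero F] {P : SymmetricPair F}
    {g : P.G.obj (CommAlgCat.of F F)} (hg : P.DoubleCosetClosed g)
    (z : P.G.obj (CommAlgCat.of F (AlgebraicClosure F)))
    (c : P.G.obj (CommAlgCat.of F (Polynomial (AlgebraicClosure F))))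
    (h0 : P.G.map (CommAlgCat.ofHom
      ((Polynomial.aeval (0 : AlgebraicClosure F)).restrictScalars F)) c = z)
    (ht : ∀ t : ℕ, t ≠ 0 → P.G.map (CommAlgCat.ofHom
      ((Polynomial.aeval (t : AlgebraicClosure F)).restrictScalars F)) c ∈
        P.doubleCoset g (AlgebraicClosure F)) :
    z ∈ P.doubleCoset g (AlgebraicClosure F) := by
  refine hg z fun f hf => ?_
  let q : Polynomial (AlgebraicClosure F) := f.toFun (Polynomial (AlgebraicClosure F)) c
  have hq : ∀ a : AlgebraicClosure F, f.toFun (AlgebraicClosure F) (P.G.map (CommAlgCat.ofHom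
      ((Polynomial.aeval a).restrictScalars F)) c) = Polynomial.aeval a q := fun a =>
    f.natural _ _ (Polynomial.aeval a) c
  have hinf : q = 0 := by
    refine Polynomial.eq_zero_of_infinite_isRoot q ?_
    refine Set.Infinite.mono (s := Set.range fun n : ℕ => ((n + 1 : ℕ) : AlgebraicClosure F)) ?_
      (Set.infinite_range_of_injective fun a b h => by simpa using h)
    rintro _ ⟨n, rfl⟩
    have := hf _ (ht (n + 1) n.succ_ne_zero)
    rw [hq] at this
    simpa using this
  rw [← h0, hq, hinf, map_zero]

variable {A : Type u} [Ring A] [Algebra F A]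

theorem AlgInvolution.exists_cayley {C : Type u} [Ring C] [Algebra F C] {σ : AlgInvolution F C}
    {m : C} (hm : IsNilpotent m) (h : σ.toLin m = -m) :
    ∃ u : Cˣ, σ.IsUnitary u ∧ u.val * (1 - m) = 1 + m := by
  obtain ⟨i, hi⟩ := hm.isUnit_one_sub
  obtain ⟨j, hj⟩ := hm.isUnit_one_add
  have hij : i * j = j * i := Units.ext (by
    rw [Units.val_mul, Units.val_mul, hi, hj]; noncomm_ring)
  have hu : (j * i⁻¹).val * (1 - m) = 1 + m := by
    rw [← hi, ← hj, ← Units.val_mul, inv_mul_cancel_right]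
  refine ⟨j * i⁻¹, ?_, hu⟩
  have h1 := congrArg σ.toLin hu
  rw [σ.map_mul, map_sub, map_add, σ.map_one, h, sub_neg_eq_add, ← hj, ← sub_eq_add_neg,
    ← hi] at h1
  have h2 : σ.toLin (j * i⁻¹).val = (j⁻¹ * i).val := by
    rw [Units.val_mul j⁻¹ i, ← h1, Units.inv_mul_cancel_left]
  change σ.toLin (j * i⁻¹).val * (j * i⁻¹).val = 1
  rw [h2, ← Units.val_mul, mul_assoc, ← mul_assoc i, hij, mul_assoc, mul_inv_cancel, mul_one,
    inv_mul_cancel, Units.val_one]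

theorem AlgInvolution.isCommHom (σ : AlgInvolution F A) : IsCommHom σ.toLin where
  map_one := σ.map_one
  map_mul a b h := by rw [h.eq, σ.map_mul]

theorem AlgInvolution.isCommHom_baseChange (σ : AlgInvolution F A) (K : Type u) [Field K]
    [Algebra F K] : IsCommHom (σ.toLin.baseChange K) where
  map_one := σ.ext_one K
  map_mul a b h := by
    rw [h.eq]
    exact σ.ext_mul K b a

theorem Commute.one_tmul {a b : A} (h : Commute a b) (K : Type u) [CommRing K] [Algebra F K] :
    Commute ((1 : K) ⊗ₜ[F] a) ((1 : K) ⊗ₜ[F] b) := by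
  change _ * _ = _ * _
  rw [Algebra.TensorProduct.tmul_mul_tmul, Algebra.TensorProduct.tmul_mul_tmul, h.eq]

theorem exists_unitary_of_unit [CharZero F] [FiniteDimensional F A] (σ : AlgInvolution F A)
    (K : Type u) [Field K] [Algebra F K] [IsAlgClosed K] {a s s' ε m : A} {t : ℕ} (ht : t ≠ 0)
    (ha : IsUnit a)
    (has : Commute a s) (haε : Commute a ε) (ham : m * a = t • (a * m)) (hss' : s * s' = 1)
    (hs's : s' * s = 1) (hσs : σ.toLin s = s') (hσε : σ.toLin ε = ε) (hσm : σ.toLin m = -m) :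
    ∃ l : (K ⊗[F] A)ˣ, σ.ext K l.val * l.val = 1 ∧ Commute l.val ((1 : K) ⊗ₜ[F] s) ∧
      Commute l.val ((1 : K) ⊗ₜ[F] ε) ∧
      ((1 : K) ⊗ₜ[F] m) * l.val = l.val * ((t : K) ⊗ₜ[F] m) := by
  have : CharZero K := charZero_of_injective_algebraMap (algebraMap F K).injective
  have hσa : Commute (σ.toLin a) s := by
    have h1 := σ.isCommHom.commute has
    rw [hσs] at h1
    exact commute_of_mul_eq_one hs's hss' h1
  have hσaε : Commute (σ.toLin a) ε := by
    have h1 := σ.isCommHom.commute haε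
    rwa [hσε] at h1
  have hσam : σ.toLin a * m = t • (m * σ.toLin a) := by
    have h1 := congrArg σ.toLin ham
    rw [map_nsmul, σ.map_mul, σ.map_mul, hσm, mul_neg, neg_mul, smul_neg, neg_inj] at h1
    exact h1
  obtain ⟨b, hb⟩ : ∃ b, b = σ.toLin a * a := ⟨_, rfl⟩
  have hbs : Commute s b := hb ▸ (hσa.mul_left has).symm
  have hbε : Commute ε b := hb ▸ (hσaε.mul_left haε).symm
  have hbm : Commute m b := by
    have h1 : t • (b * m) = t • (m * b) := by
      rw [hb, mul_assoc, ← mul_smul_comm, ← ham, ← mul_assoc, hσam, smul_mul_assoc, mul_assoc]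
    rw [← Nat.cast_smul_eq_nsmul F, ← Nat.cast_smul_eq_nsmul F] at h1
    exact (smul_right_injective A (Nat.cast_ne_zero.2 ht) h1).symm
  have hσb : σ.toLin b = b := by rw [hb, σ.map_mul, σ.involutive]
  have hbu : IsUnit b := by
    obtain ⟨u, rfl⟩ := ha
    rw [hb]
    exact (σ.unit u).isUnit.mul u.isUnit
  have hbK : IsUnit ((1 : K) ⊗ₜ[F] b) :=
    hbu.map (Algebra.TensorProduct.includeRight : A →ₐ[F] K ⊗[F] A)
  obtain ⟨p, hp⟩ := exists_sqrt_of_isAlgClosed (F := K) hbK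
  obtain ⟨c, hc⟩ : ∃ c, c = Polynomial.aeval ((1 : K) ⊗ₜ[F] b) p := ⟨_, rfl⟩
  rw [← hc] at hp
  have hcc : ∀ z, Commute z b → Commute ((1 : K) ⊗ₜ[F] z) c := fun z hz =>
    hc ▸ commute_aeval (hz.one_tmul K) p
  have hσc : σ.ext K c = c := by
    have h1 := (σ.isCommHom_baseChange K).map_aeval ((1 : K) ⊗ₜ[F] b) p
    rw [LinearMap.baseChange_tmul, hσb, ← hc] at h1
    exact h1
  have hcu : IsUnit c := by
    rw [← hp] at hbK
    exact ((Commute.refl c).isUnit_mul_iff.1 hbK).1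
  obtain ⟨c, rfl⟩ := hcu
  obtain ⟨a', ha'⟩ := ha.map (Algebra.TensorProduct.includeRight : A →ₐ[F] K ⊗[F] A)
  have ha'' : a'.val = (1 : K) ⊗ₜ[F] a := ha'
  have hcinv : σ.ext K (c⁻¹).val = (c⁻¹).val := by
    have h1 := congrArg (σ.ext K) (Units.inv_mul c)
    rw [σ.ext_mul, hσc, σ.ext_one] at h1
    exact (Units.inv_eq_of_mul_eq_one_right h1).symm
  refine ⟨a' * c⁻¹, ?_, ?_, ?_, ?_⟩
  · rw [Units.val_mul, σ.ext_mul, hcinv, ha'', σ.ext_tmul, mul_assoc, ← mul_assoc (1 ⊗ₜ _),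
      Algebra.TensorProduct.tmul_mul_tmul, one_mul, ← hb, ← hp, Units.mul_inv_cancel_right,
      Units.inv_mul]
  · rw [Units.val_mul, ha'']
    exact (has.one_tmul K).mul_left (Commute.units_inv_right (hcc s hbs)).symm
  · rw [Units.val_mul, ha'']
    exact (haε.one_tmul K).mul_left (Commute.units_inv_right (hcc ε hbε)).symm
  · have h1 : (t : K) ⊗ₜ[F] m = (t : K) • ((1 : K) ⊗ₜ[F] m) := by
      rw [TensorProduct.smul_tmul', smul_eq_mul, mul_one]
    have h2 : ((1 : K) ⊗ₜ[F] m) * ((1 : K) ⊗ₜ[F] a) =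
        (t : K) • (((1 : K) ⊗ₜ[F] a) * ((1 : K) ⊗ₜ[F] m)) := by
      rw [Algebra.TensorProduct.tmul_mul_tmul, Algebra.TensorProduct.tmul_mul_tmul, ham,
        TensorProduct.smul_tmul', smul_eq_mul, one_mul, mul_one, TensorProduct.tmul_smul,
        TensorProduct.smul_tmul', nsmul_eq_mul, mul_one]
    rw [Units.val_mul, ha'', ← mul_assoc, h2, h1, mul_smul_comm, smul_mul_assoc, mul_assoc,
      mul_assoc, (Commute.units_inv_right (hcc m hbm)).eq]

end Closed

end

noncomputable section

section Closed

theorem commute_inv_mul_mul {G : Type*} [Group G] {e g l : G} (he : e * e = 1)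
    (h1 : Commute l e) (h2 : Commute l (g * e * g⁻¹ * e)) : Commute (g⁻¹ * l * g) e := by
  have h3 : Commute l (g * e * g⁻¹) := by
    have := h2.mul_right h1
    rwa [mul_assoc _ e e, he, mul_one] at this
  have h4 := congrArg (fun z => g⁻¹ * z * g) h3.eq
  change g⁻¹ * l * g * e = e * (g⁻¹ * l * g)
  calc g⁻¹ * l * g * e = g⁻¹ * (l * (g * e * g⁻¹)) * g := by group
    _ = g⁻¹ * (g * e * g⁻¹ * l) * g := by rw [h3.eq]
    _ = _ := by group

theorem mul_aeval_eq {F A : Type*} [CommRing F] [Ring A] [Algebra F A] {h x s : A}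
    (H : h * x = s * h) (p : Polynomial F) :
    h * Polynomial.aeval x p = Polynomial.aeval s p * h := by
  induction p using Polynomial.induction_on' with
  | add p q hp hq => rw [map_add, map_add, mul_add, add_mul, hp, hq]
  | monomial n a =>
    have H' : SemiconjBy h x s := H
    rw [Polynomial.aeval_monomial, Polynomial.aeval_monomial, ← mul_assoc,
      ← Algebra.commutes a h, mul_assoc, (H'.pow_right n).eq, mul_assoc]

variable {F : Type u} [Field F] {A : Type u} [Ring A] [Algebra F A]

theorem isNilpotent_tmul {R : Type u} [CommRing R] [Algebra F R] (r : R) {m : A}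
    (hm : IsNilpotent m) : IsNilpotent (r ⊗ₜ[F] m) := by
  obtain ⟨n, hn⟩ := hm
  exact ⟨n, by rw [Algebra.TensorProduct.tmul_pow, hn, TensorProduct.tmul_zero]⟩

/-- If the double coset of `g` is closed, then the symmetrization of `g` is semisimple. -/
theorem isSemisimpleElement_of_doubleCosetClosed [CharZero F] [FiniteDimensional F A]
    {σ : AlgInvolution F A} (ε : (unitaryFunctor σ).obj (CommAlgCat.of F F)) (hε : ε ^ 2 = 1)
    (g : (unitaryFunctor σ).obj (CommAlgCat.of F F))
    (hg : (SymmetricPair.inner (unitaryFunctor σ) ε hε).DoubleCosetClosed g)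
    (H : ∀ {s s' m e : A}, IsSemisimpleElement F s → Commute s m → IsNilpotent m → e * e = 1 →
      e * m * e = -m → e * s * e = s' → s * s' = 1 → s' * s = 1 → ∀ {t : ℕ}, t ≠ 0 →
      ∃ a, IsUnit a ∧ Commute a s ∧ Commute a e ∧ m * a = t • (a * m))
    {x : (unitaryFunctor σ).obj (CommAlgCat.of F F)} (hx : x = g * (ε * g⁻¹ * ε)) :
    IsSemisimpleElement F (pointVal σ x) := by
  have hε1 : ε * ε = 1 := by rw [← sq, hε]
  have hε' : ε⁻¹ = ε := inv_eq_of_mul_eq_one_left hε1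
  have hεx : ε * x * ε = x⁻¹ := by
    rw [hx, mul_inv_rev, mul_inv_rev, mul_inv_rev, hε', inv_inv]
    calc ε * (g * (ε * g⁻¹ * ε)) * ε = ε * (g * (ε * g⁻¹)) * (ε * ε) := by simp only [mul_assoc]
      _ = _ := by rw [hε1, mul_one]; simp only [mul_assoc]
  obtain ⟨e, he⟩ : ∃ e, e = pointVal σ ε := ⟨_, rfl⟩
  have hee : e * e = 1 := by rw [he, ← pointVal_mul, hε1, pointVal_one]
  have hσe : σ.toLin e = e := by rw [he, toLin_pointVal, hε']
  have hxy : pointVal σ x * pointVal σ x⁻¹ = 1 := by rw [← pointVal_mul, mul_inv_cancel, pointVal_one]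
  have hyx : pointVal σ x⁻¹ * pointVal σ x = 1 := by rw [← pointVal_mul, inv_mul_cancel, pointVal_one]
  obtain ⟨v, w, m, hvw, hwv, hm, hvm, hvx, hmx, hs, hT⟩ :=
    exists_unipotent_sqrt hxy hyx σ.isCommHom (toLin_pointVal x)
  obtain ⟨hσv, hσm⟩ := hT _ σ.isCommHom (toLin_pointVal x)
  have hconj : IsCommHom (LinearMap.mulLeft F e ∘ₗ LinearMap.mulRight F e) :=
    { map_one := by simp [hee]
      map_mul := fun a b _ => by
        simp only [LinearMap.comp_apply, LinearMap.mulLeft_apply, LinearMap.mulRight_apply]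
        calc e * (a * b * e) = e * (a * 1 * (b * e)) := by rw [mul_one, mul_assoc]
          _ = _ := by rw [← hee]; simp only [mul_assoc] }
  obtain ⟨hev, hem⟩ := hT _ hconj (by
    simp only [LinearMap.comp_apply, LinearMap.mulLeft_apply, LinearMap.mulRight_apply]
    rw [he, ← pointVal_mul, ← pointVal_mul, ← hεx, mul_assoc])
  simp only [LinearMap.comp_apply, LinearMap.mulLeft_apply, LinearMap.mulRight_apply] at hev hem
  rw [← mul_assoc] at hev hem
  obtain ⟨vt, hvt⟩ := exists_pointVal_eq hvw hwv hσv
  have hvt' : pointVal σ vt⁻¹ = w := by rw [← toLin_pointVal, hvt, hσv]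
  have hεv : ε * vt * ε = vt⁻¹ := pointVal_injective (by
    rw [pointVal_mul, pointVal_mul, ← he, hvt, hev, hvt'])
  obtain ⟨g0, hg0⟩ : ∃ g0, g0 = vt⁻¹ * g := ⟨_, rfl⟩
  obtain ⟨s0, hs0⟩ : ∃ s0, s0 = g0 * ε * g0⁻¹ * ε := ⟨_, rfl⟩
  have hs0' : s0 = vt⁻¹ * x * vt⁻¹ := by
    have h1 : vt * ε = ε * vt⁻¹ := by
      rw [← hεv]
      calc vt * ε = (ε * ε) * vt * ε := by rw [hε1, one_mul]
        _ = _ := by simp only [mul_assoc]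
    rw [hs0, hg0, hx, mul_inv_rev, inv_inv, mul_assoc _ _ ε, mul_assoc g⁻¹, h1]
    simp only [mul_assoc]
  obtain ⟨s, hs_eq⟩ : ∃ s, s = w * pointVal σ x * w := ⟨_, rfl⟩
  have hsv : pointVal σ s0 = s := by
    rw [hs0', pointVal_mul, pointVal_mul, hvt', hs_eq]
  rw [← hs_eq] at hs
  have hss' : s * pointVal σ s0⁻¹ = 1 := by rw [← hsv, ← pointVal_mul, mul_inv_cancel, pointVal_one]
  have hs's : pointVal σ s0⁻¹ * s = 1 := by rw [← hsv, ← pointVal_mul, inv_mul_cancel, pointVal_one]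
  have hes : e * s * e = pointVal σ s0⁻¹ := by
    rw [he, ← hsv, ← pointVal_mul, ← pointVal_mul]
    congr 1
    rw [hs0, mul_inv_rev, mul_inv_rev, mul_inv_rev, hε', inv_inv]
    calc ε * (g0 * ε * g0⁻¹ * ε) * ε = ε * (g0 * ε * g0⁻¹) * (ε * ε) := by simp only [mul_assoc]
      _ = _ := by rw [hε1, mul_one]; simp only [mul_assoc]
  have hσs : σ.toLin s = pointVal σ s0⁻¹ := by rw [← hsv, toLin_pointVal]
  have hmw : Commute m w := commute_of_mul_eq_one hvw hwv (hvx m (hmx _ (Commute.refl _)).symm)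
  have hsm : Commute s m := by
    rw [hs_eq]
    exact (hmw.symm.mul_left (hmx _ (Commute.refl _))).mul_left hmw.symm
  have hεK : (unitaryFunctor σ).ofPoint ε (CommAlgCat.of F (AlgebraicClosure F)) *
      (unitaryFunctor σ).ofPoint ε _ = 1 := by
    rw [GroupFunctor.ofPoint, ← map_mul, hε1, map_one]
  have hfix : ∀ z : (unitaryFunctor σ).obj (CommAlgCat.of F (AlgebraicClosure F)),
      Commute z ((unitaryFunctor σ).ofPoint ε _) ↔
      z ∈ (SymmetricPair.inner (unitaryFunctor σ) ε hε).fixed _ := by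
    intro z
    change _ ↔ (unitaryFunctor σ).ofPoint ε _ * z * (unitaryFunctor σ).ofPoint ε _ = z
    generalize (unitaryFunctor σ).ofPoint ε (CommAlgCat.of F (AlgebraicClosure F)) = d at hεK
    constructor
    · intro h
      rw [← h.eq, mul_assoc, hεK, mul_one]
    · intro h
      change z * d = d * z
      calc z * d = d * z * d * d := by rw [h]
        _ = d * z := by rw [mul_assoc, hεK, mul_one]
  have hmem : (unitaryFunctor σ).ofPoint g0 (CommAlgCat.of F (AlgebraicClosure F)) ∈
      (SymmetricPair.inner (unitaryFunctor σ) ε hε).doubleCoset g (AlgebraicClosure F) := by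
    obtain ⟨u, hu, hum⟩ := AlgInvolution.exists_cayley
      (σ := σ.baseChange (Polynomial (AlgebraicClosure F)))
      (isNilpotent_tmul (Polynomial.X : Polynomial (AlgebraicClosure F)) hm) (by
        change Polynomial.X ⊗ₜ[F] σ.toLin m = _
        rw [hσm, TensorProduct.tmul_neg])
    let c : (unitaryFunctor σ).obj (CommAlgCat.of F (Polynomial (AlgebraicClosure F))) :=
      (⟨u, hu⟩ : σ.unitarySubgroup _)
    let ev := fun a : AlgebraicClosure F => CommAlgCat.ofHom (R := F)
      ((Polynomial.aeval a).restrictScalars F : Polynomial (AlgebraicClosure F) →ₐ[F] _)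
    have hev' : ∀ a, unitaryVal σ _ ((unitaryFunctor σ).map (ev a) c) * (1 - a ⊗ₜ[F] m) =
        1 + a ⊗ₜ[F] m := by
      intro a
      have h1 := congrArg (Algebra.TensorProduct.map (ev a).hom (AlgHom.id F A)) hum
      simp only [map_mul, map_sub, map_add, map_one, Algebra.TensorProduct.map_tmul] at h1
      have h2 : (ev a).hom (Polynomial.X : Polynomial (AlgebraicClosure F)) = a :=
        Polynomial.aeval_X a
      rw [h2] at h1
      exact h1
    have hcurve : ∀ a, (unitaryFunctor σ).map (ev a) (c * (unitaryFunctor σ).ofPoint g0 _) =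
        (unitaryFunctor σ).map (ev a) c * (unitaryFunctor σ).ofPoint g0 _ := by
      intro a
      rw [map_mul, (unitaryFunctor σ).map_ofPoint]
    have hg0K : (unitaryFunctor σ).ofPoint g (CommAlgCat.of F (AlgebraicClosure F)) =
        (unitaryFunctor σ).ofPoint vt _ * (unitaryFunctor σ).ofPoint g0 _ := by
      rw [hg0, GroupFunctor.ofPoint, GroupFunctor.ofPoint, GroupFunctor.ofPoint, ← map_mul,
        mul_inv_cancel_left]
    refine hg.mem_of_curve _ (c * (unitaryFunctor σ).ofPoint g0 _ :) ?_ fun t ht => ?_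
    · refine (hcurve 0).trans ?_
      have h1 := hev' 0
      rw [TensorProduct.zero_tmul, sub_zero, mul_one, add_zero] at h1
      have h2 : (unitaryFunctor σ).map (ev 0) c = 1 := unitaryVal_injective _ h1
      rw [h2, one_mul]
    · obtain ⟨a, ha, has, hae, ham⟩ := H hs hsm hm hee hem hes hss' hs's ht
      obtain ⟨l, hl, hls, hle, hlm⟩ := exists_unitary_of_unit σ (AlgebraicClosure F) ht ha has hae
        ham hss' hs's hσs hσe hσm
      let L : (unitaryFunctor σ).obj (CommAlgCat.of F (AlgebraicClosure F)) :=
        (⟨l, hl⟩ : σ.unitarySubgroup _)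
      have hL : unitaryVal σ _ L = l.val := rfl
      have hLe : Commute L ((unitaryFunctor σ).ofPoint ε _) := unitaryVal_injective _ (by
        rw [unitaryVal_mul, unitaryVal_mul, unitaryVal_ofPoint, ← he]
        exact hle)
      have hLs : Commute L ((unitaryFunctor σ).ofPoint s0 _) := unitaryVal_injective _ (by
        rw [unitaryVal_mul, unitaryVal_mul, unitaryVal_ofPoint, hsv]
        exact hls)
      have hLu : L * (unitaryFunctor σ).map (ev t) c = (unitaryFunctor σ).ofPoint vt _ * L := by
        refine unitaryVal_injective _ ?_
        rw [unitaryVal_mul, unitaryVal_mul, hL, unitaryVal_ofPoint, hvt]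
        refine (isNilpotent_tmul (t : AlgebraicClosure F) hm).isUnit_one_sub.mul_right_cancel ?_
        have h1 : ((1 : AlgebraicClosure F) ⊗ₜ[F] v) * (1 - 1 ⊗ₜ[F] m) = 1 + 1 ⊗ₜ[F] m := by
          rw [mul_sub, mul_one, Algebra.TensorProduct.tmul_mul_tmul, one_mul,
            ← TensorProduct.tmul_sub, Algebra.TensorProduct.one_def, ← TensorProduct.tmul_add,
            ← hvm, mul_sub, mul_one]
        rw [mul_assoc, hev', mul_add, mul_one, ← hlm, mul_assoc, mul_sub, mul_one, ← hlm]
        calc l.val + (1 ⊗ₜ[F] m) * l.val = (1 + 1 ⊗ₜ[F] m) * l.val := by rw [add_mul, one_mul]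
          _ = _ := by rw [← h1, mul_assoc, sub_mul, one_mul]
      refine ⟨L⁻¹, (hfix _).1 hLe.inv_left, ((unitaryFunctor σ).ofPoint g0 _)⁻¹ * L *
        (unitaryFunctor σ).ofPoint g0 _, (hfix _).1 (commute_inv_mul_mul hεK hLe ?_), ?_⟩
      · convert hLs using 1
        rw [hs0]
        simp only [GroupFunctor.ofPoint, map_mul, map_inv]
      · refine (hcurve t).trans ?_
        have h1 : ∀ a b c d : (unitaryFunctor σ).obj (CommAlgCat.of F (AlgebraicClosure F)),
            a * b = d * a → b * c = a⁻¹ * (d * c) * (c⁻¹ * a * c) := by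
          intro a b c d h
          calc b * c = a⁻¹ * (a * b) * c := by group
            _ = _ := by rw [h]; group
        refine (h1 L _ _ _ hLu).trans ?_
        rw [← hg0K]
        rfl
  obtain ⟨(a : (unitaryFunctor σ).obj (CommAlgCat.of F (AlgebraicClosure F))), ha,
    (b : (unitaryFunctor σ).obj (CommAlgCat.of F (AlgebraicClosure F))), hb, hab⟩ := hmem
  replace ha := (hfix a).2 ha
  replace hb := (hfix b).2 hb
  have key : ∀ a b g g0 d : (unitaryFunctor σ).obj (CommAlgCat.of F (AlgebraicClosure F)),
      d * d = 1 → Commute a d → Commute b d → g0 = a * g * b →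
      a * (g * d * g⁻¹ * d) = g0 * d * g0⁻¹ * d * a := by
    intro a b g g0 d hd ha hb h
    have h1 : b * d * b⁻¹ = d := by rw [hb.eq, mul_inv_cancel_right]
    calc a * (g * d * g⁻¹ * d) = a * g * d * g⁻¹ * (a⁻¹ * (a * d)) := by group
      _ = a * g * (b * d * b⁻¹) * g⁻¹ * (a⁻¹ * (d * a)) := by rw [ha.eq, h1]
      _ = _ := by rw [h]; group
  have h1 := key a b ((unitaryFunctor σ).ofPoint g _) ((unitaryFunctor σ).ofPoint g0 _) _ hεK ha hb
    hab
  have h2 : (unitaryFunctor σ).ofPoint s0 (CommAlgCat.of F (AlgebraicClosure F)) =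
      (unitaryFunctor σ).ofPoint g0 _ * (unitaryFunctor σ).ofPoint ε _ *
        ((unitaryFunctor σ).ofPoint g0 _)⁻¹ * (unitaryFunctor σ).ofPoint ε _ := by
    rw [hs0]
    simp only [GroupFunctor.ofPoint, map_mul, map_inv]
  have h3 : (unitaryFunctor σ).ofPoint x (CommAlgCat.of F (AlgebraicClosure F)) =
      (unitaryFunctor σ).ofPoint g _ * (unitaryFunctor σ).ofPoint ε _ *
        ((unitaryFunctor σ).ofPoint g _)⁻¹ * (unitaryFunctor σ).ofPoint ε _ := by
    rw [hx]
    simp only [GroupFunctor.ofPoint, map_mul, map_inv, mul_assoc]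
  have h4 := congrArg (unitaryVal σ _) h1
  rw [← h3, ← h2, unitaryVal_mul, unitaryVal_mul, unitaryVal_ofPoint, unitaryVal_ofPoint, hsv]
    at h4
  obtain ⟨p, hp, hps⟩ := hs
  refine ⟨p, hp, ?_⟩
  have h5 := mul_aeval_eq h4 (p.map (algebraMap F (AlgebraicClosure F)))
  have h6 : ∀ z : A, Polynomial.aeval ((1 : AlgebraicClosure F) ⊗ₜ[F] z)
      (p.map (algebraMap F (AlgebraicClosure F))) = 1 ⊗ₜ[F] Polynomial.aeval z p := by
    intro z
    rw [Polynomial.aeval_map_algebraMap]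
    exact (Polynomial.aeval_algHom_apply
      (Algebra.TensorProduct.includeRight : A →ₐ[F] AlgebraicClosure F ⊗[F] A) z p)
  rw [h6, h6, hps, TensorProduct.tmul_zero, zero_mul] at h5
  have h7 : (1 : AlgebraicClosure F) ⊗ₜ[F] Polynomial.aeval (pointVal σ x) p = 0 :=
    (Units.mul_right_eq_zero (a : σ.unitarySubgroup _).1).1 h5
  exact Algebra.TensorProduct.includeRight_injective (algebraMap F (AlgebraicClosure F)).injective
    (h7.trans (TensorProduct.tmul_zero _ _).symm)

end Closed

end

noncomputable section

/-! ## Corners of the centralizer of an endomorphism -/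

section Center

variable {F C : Type u} [Field F] [Ring C] [Algebra F C]

/-- The restriction of an involution to the center. -/
def AlgInvolution.centerHom (σ : AlgInvolution F C) :
    Subalgebra.center F C →+* Subalgebra.center F C where
  toFun l := ⟨σ.toLin l.1, Subalgebra.mem_center_iff.2 fun b => by
    have h := congrArg σ.toLin (Subalgebra.mem_center_iff.1 l.2 (σ.toLin b))
    rw [σ.map_mul, σ.map_mul, σ.involutive] at h
    exact h.symm⟩
  map_one' := Subtype.ext σ.map_one
  map_zero' := Subtype.ext (map_zero σ.toLin)
  map_add' a b := Subtype.ext (map_add σ.toLin a.1 b.1)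
  map_mul' a b := Subtype.ext (by
    change σ.toLin (a.1 * b.1) = σ.toLin a.1 * σ.toLin b.1
    rw [← Subalgebra.mem_center_iff.1 a.2, σ.map_mul])

/-- The restriction of an involutive automorphism to the center. -/
def centerAut (φ : C →ₐ[F] C) (hφ : ∀ a, φ (φ a) = a) :
    Subalgebra.center F C →+* Subalgebra.center F C where
  toFun l := ⟨φ l.1, Subalgebra.mem_center_iff.2 fun b => by
    have h := congrArg φ (Subalgebra.mem_center_iff.1 l.2 (φ b))
    rwa [map_mul, map_mul, hφ] at h⟩
  map_one' := Subtype.ext (map_one φ)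
  map_zero' := Subtype.ext (map_zero φ)
  map_add' a b := Subtype.ext (map_add φ a.1 b.1)
  map_mul' a b := Subtype.ext (map_mul φ a.1 b.1)

end Center

section SpaceCorner

variable {F D V : Type u} [Field F] [Field D] [Algebra F D] [AddCommGroup V] [Module D V]
  [Module F V] [IsScalarTower F D V] {x : Module.End D V}
variable {E W : Type u} [Field E] [Algebra F E] [Algebra D E] [AddCommGroup W] [Module E W]
  [Module F W] [IsScalarTower F E W]

/-- The image of the idempotent `e` is identified with the space `W` over an extension `E` of `D`,
so that the corner of `e` is the algebra of endomorphisms of `W`; the endomorphism `x` acts on `W`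
by the scalar `ξ`. -/
structure IsSpaceCorner (e : centr F x) (i : W →ₗ[F] V) (q : V →ₗ[F] W) (ξ : E) : Prop where
  i_smul : ∀ (d : D) (w : W), i (algebraMap D E d • w) = d • i w
  q_smul : ∀ (d : D) (v : V), q (d • v) = algebraMap D E d • q v
  x_i : ∀ w, x (i w) = i (ξ • w)
  q_x : ∀ v, q (x v) = ξ • q v
  linear : ∀ (c : centr F x) (z : E) (w : W), q (c.1 (i (z • w))) = z • q (c.1 (i w))
  q_i : ∀ w, q (i w) = w
  i_q : ∀ v, i (q v) = e.1 v

variable {e : centr F x} {i : W →ₗ[F] V} {q : V →ₗ[F] W} {ξ : E}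

theorem IsSpaceCorner.exists_isCornerMap (h : IsSpaceCorner e i q ξ)
    (hc : ∀ c, e * c = c * e) :
    ∃ (π : centr F x →ₐ[F] Module.End E W) (ι : Module.End E W →ₗ[F] centr F x),
      IsCornerMap e π ι ∧ ∀ c w, π c w = q (c.1 (i w)) := by
  have hei : ∀ w, e.1 (i w) = i w := fun w => by rw [← h.i_q, h.q_i]
  have hqe : ∀ v, q (e.1 v) = q v := fun v => by rw [← h.i_q, h.q_i]
  have hc' : ∀ (c : centr F x) v, e.1 (c.1 v) = c.1 (e.1 v) := fun c v =>
    LinearMap.congr_fun (congrArg Subtype.val (hc c)) v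
  let π : centr F x →ₐ[F] Module.End E W := AlgHom.ofLinearMap
    { toFun := fun c =>
        { toFun := fun w => q (c.1 (i w))
          map_add' := fun w w' => by simp only [map_add]
          map_smul' := fun z w => h.linear c z w }
      map_add' := fun c c' => LinearMap.ext fun w => by
        change q ((c.1 + c'.1) (i w)) = q (c.1 (i w)) + q (c'.1 (i w))
        rw [LinearMap.add_apply, map_add]
      map_smul' := fun r c => LinearMap.ext fun w => by
        change q ((r • c.1) (i w)) = r • q (c.1 (i w))
        rw [LinearMap.smul_apply, map_smul] }
    (LinearMap.ext fun w => h.q_i w)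
    (fun c c' => LinearMap.ext fun w => by
      change q (c.1 (c'.1 (i w))) = q (c.1 (i (q (c'.1 (i w)))))
      rw [h.i_q, hc', hei])
  let ι : Module.End E W →ₗ[F] centr F x :=
    { toFun := fun a => ⟨
        { toFun := fun v => i (a (q v))
          map_add' := fun v v' => by simp only [map_add]
          map_smul' := fun d v => by rw [h.q_smul, a.map_smul, h.i_smul, RingHom.id_apply] },
        mem_centr.2 (LinearMap.ext fun v => by
          change x (i (a (q v))) = i (a (q (x v)))
          rw [h.x_i, h.q_x, a.map_smul])⟩
      map_add' := fun a b => Subtype.ext (LinearMap.ext fun v => map_add i (a (q v)) (b (q v)))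
      map_smul' := fun r a => Subtype.ext (LinearMap.ext fun v => map_smul i r (a (q v))) }
  refine ⟨π, ι, ⟨fun a b => ?_, fun a => ?_, fun c => ?_, hc⟩, fun c w => rfl⟩
  · refine Subtype.ext (LinearMap.ext fun v => ?_)
    change i (a (b (q v))) = i (a (q (i (b (q v)))))
    rw [h.q_i]
  · refine LinearMap.ext fun w => ?_
    change q (i (a (q (i w)))) = a w
    rw [h.q_i, h.q_i]
  · refine Subtype.ext (LinearMap.ext fun v => ?_)
    change i (q (c.1 (i (q v)))) = e.1 (c.1 v)
    rw [h.i_q, h.i_q, ← hc', ← hc', ← Module.End.mul_apply]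
    have : e * (e * c) = e * c := by
      refine Subtype.ext (LinearMap.ext fun v => ?_)
      change e.1 (e.1 (c.1 v)) = e.1 (c.1 v)
      rw [← h.i_q (e.1 (c.1 v)), hqe, h.i_q]
    exact LinearMap.congr_fun (congrArg Subtype.val this) v

/-- Transport along an isomorphism of spaces. -/
theorem IsSpaceCorner.comp (h : IsSpaceCorner e i q ξ) {W' : Type u} [AddCommGroup W']
    [Module E W'] [Module F W'] [IsScalarTower F E W'] (T : W' ≃ₗ[E] W) :
    IsSpaceCorner e (i ∘ₗ T.toLinearMap.restrictScalars F)
      (T.symm.toLinearMap.restrictScalars F ∘ₗ q) ξ where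
  i_smul d w := by simp [h.i_smul]
  q_smul d w := by simp [h.q_smul]
  x_i w := by simp [h.x_i]
  q_x v := by simp [h.q_x]
  linear c z w := by simp [h.linear]
  q_i w := by simp [h.q_i]
  i_q v := by simp [h.i_q]

end SpaceCorner

section FieldCorner

variable {F D V : Type u} [Field F] [Field D] [Algebra F D] [AddCommGroup V] [Module D V]
  [Module F V] [IsScalarTower F D V] (x : Module.End D V)

/-- The scalars in the center of the centralizer of `x`. -/
def centerScalar : D →ₐ[F] Subalgebra.center F (centr F x) where
  toFun d := ⟨⟨algebraMap D (Module.End D V) d, mem_centr.2 (Algebra.commutes d x).symm⟩,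
    Subalgebra.mem_center_iff.2 fun b => Subtype.ext (Algebra.commutes d b.1).symm⟩
  map_one' := Subtype.ext (Subtype.ext (map_one (algebraMap D (Module.End D V))))
  map_zero' := Subtype.ext (Subtype.ext (map_zero (algebraMap D (Module.End D V))))
  map_add' a b := Subtype.ext (Subtype.ext (map_add (algebraMap D (Module.End D V)) a b))
  map_mul' a b := Subtype.ext (Subtype.ext (map_mul (algebraMap D (Module.End D V)) a b))
  commutes' r := Subtype.ext (Subtype.ext (LinearMap.ext fun v => by
    change algebraMap F D r • v = r • v
    rw [algebraMap_smul]))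

theorem centerScalar_apply (d : D) (v : V) : (centerScalar (F := F) x d).1.1 v = d • v := rfl

variable (F) in
/-- The element `x` of the center of its centralizer. -/
def centerSelf : Subalgebra.center F (centr F x) :=
  ⟨⟨x, mem_centr.2 rfl⟩, Subalgebra.mem_center_iff.2 fun b => Subtype.ext (mem_centr.1 b.2).symm⟩

variable {x}
variable {E W : Type u} [Field E] [Algebra F E] [Algebra D E] [AddCommGroup W] [Module E W]
  [Module D W]

/-- The field of the idempotent `e` of the center is identified with `E`, and the image of `e` with
the space `W` over `E`. -/
structure IsFieldCorner (e : Subalgebra.center F (centr F x))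
    (ψ : Subalgebra.center F (centr F x) →ₐ[F] E) (i : W →ₗ[D] V) (q : V →ₗ[D] W) : Prop where
  surjective : Function.Surjective ψ
  scalar : ∀ d, ψ (centerScalar x d) = algebraMap D E d
  eq_iff : ∀ l l', ψ l = ψ l' ↔ e * l = e * l'
  i_smul : ∀ l w, i (ψ l • w) = l.1.1 (i w)
  q_i : ∀ w, q (i w) = w
  i_q : ∀ v, i (q v) = e.1.1 v

theorem IsFieldIdempotent.exists_residueField {F D L W : Type u} [Field F] [Field D] [Algebra F D]
    [CommRing L] [Algebra F L] [FiniteDimensional F L] [AddCommGroup W] [Module D W] [Module F W]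
    [IsScalarTower F D W] {e : L} (he : IsFieldIdempotent e) (sc : D →ₐ[F] L)
    (act : L →+* Module.End D W) (hact : act e = 1) (hsc : ∀ d w, act (sc d) w = d • w) :
    ∃ (E : Type u) (_ : Field E) (_ : Algebra F E) (_ : Algebra D E) (_ : IsScalarTower F D E)
      (_ : FiniteDimensional D E) (_ : Module E W) (_ : IsScalarTower F E W)
      (_ : IsScalarTower D E W) (ψ : L →ₐ[F] E), Function.Surjective ψ ∧
      (∀ d, ψ (sc d) = algebraMap D E d) ∧ (∀ l l', ψ l = ψ l' ↔ e * l = e * l') ∧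
      ∀ l w, ψ l • w = act l w := by
  have hmax := he.isMaximal
  let I : Ideal L := Ideal.span {1 - e}
  let : Field (L ⧸ I) := Ideal.Quotient.field I
  let ψ := Ideal.Quotient.mkₐ F I
  let : Algebra D (L ⧸ I) := (ψ.comp sc).toRingHom.toAlgebra
  have : IsScalarTower F D (L ⧸ I) :=
    IsScalarTower.of_algebraMap_eq fun r => ((ψ.comp sc).commutes r).symm
  have : FiniteDimensional F (L ⧸ I) :=
    Module.Finite.of_surjective ψ.toLinearMap (Ideal.Quotient.mkₐ_surjective F I)
  have hact : ∀ l ∈ I, act l = 0 := by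
    intro l hl
    obtain ⟨c, rfl⟩ := Ideal.mem_span_singleton'.1 hl
    rw [map_mul, map_sub, map_one, hact, sub_self, mul_zero]
  let : Module (L ⧸ I) W := Module.compHom W (Ideal.Quotient.lift I act hact)
  have hsmul : ∀ l (w : W), ψ l • w = act l w := fun l w => rfl
  have : IsScalarTower D (L ⧸ I) W := IsScalarTower.of_algebraMap_smul hsc
  have : IsScalarTower F (L ⧸ I) W := by
    refine IsScalarTower.of_algebraMap_smul fun r w => ?_
    rw [← ψ.commutes r, ← sc.commutes r, hsmul, hsc, algebraMap_smul]
  refine ⟨_, inferInstance, inferInstance, inferInstance, inferInstance,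
    Module.Finite.of_restrictScalars_finite F D _, inferInstance, inferInstance, inferInstance, ψ,
    Ideal.Quotient.mkₐ_surjective F I, fun _ => rfl, fun l l' => ?_, hsmul⟩
  rw [show ψ l = ψ l' ↔ l - l' ∈ I from Ideal.Quotient.eq]
  constructor
  · intro hl
    obtain ⟨c, hc⟩ := Ideal.mem_span_singleton'.1 hl
    linear_combination c * (-he.idem) - e * hc
  · intro hl
    exact Ideal.mem_span_singleton'.2 ⟨l - l', by linear_combination -hl⟩

variable (x) in
theorem exists_isFieldCorner [FiniteDimensional F D] [FiniteDimensional D V]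
    {e : Subalgebra.center F (centr F x)} (he : IsFieldIdempotent e) :
    ∃ (E : Type u) (_ : Field E) (_ : Algebra F E) (_ : Algebra D E) (_ : IsScalarTower F D E)
      (_ : FiniteDimensional D E) (W : Type u) (_ : AddCommGroup W) (_ : Module E W)
      (_ : Module D W) (_ : Module F W) (_ : IsScalarTower F E W) (_ : IsScalarTower D E W)
      (_ : IsScalarTower F D W) (_ : FiniteDimensional D W)
      (ψ : Subalgebra.center F (centr F x) →ₐ[F] E) (i : W →ₗ[D] V) (q : V →ₗ[D] W),
      IsFieldCorner e ψ i q := by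
  have : FiniteDimensional F V := FiniteDimensional.trans F D V
  have : FiniteDimensional F (Module.End D V) := FiniteDimensional.trans F D _
  let W := LinearMap.range e.1.1
  have hcomm : ∀ (l : Subalgebra.center F (centr F x)) v, l.1.1 (e.1.1 v) = e.1.1 (l.1.1 v) :=
    fun l v => LinearMap.congr_fun (congrArg Subtype.val (Subalgebra.mem_center_iff.1 e.2 l.1)) v
  have hee : ∀ v, e.1.1 (e.1.1 v) = e.1.1 v := fun v =>
    LinearMap.congr_fun (congrArg (fun l => l.1.1) he.idem) v
  have hmem : ∀ (l : Subalgebra.center F (centr F x)), ∀ w ∈ W, l.1.1 w ∈ W := by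
    rintro l _ ⟨v, rfl⟩
    exact ⟨l.1.1 v, (hcomm l v).symm⟩
  let act : Subalgebra.center F (centr F x) →+* Module.End D W :=
    { toFun := fun l => l.1.1.restrict (hmem l)
      map_one' := rfl
      map_zero' := rfl
      map_add' := fun _ _ => rfl
      map_mul' := fun _ _ => rfl }
  have hact : act e = 1 := by
    refine LinearMap.ext ?_
    rintro ⟨_, v, rfl⟩
    exact Subtype.ext (hee v)
  obtain ⟨E, _, _, _, _, _, _, _, _, ψ, h1, h2, h3, h4⟩ :=
    he.exists_residueField (centerScalar x) act hact fun d w => rfl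
  exact ⟨E, inferInstance, inferInstance, inferInstance, inferInstance, inferInstance, W,
    inferInstance, inferInstance, inferInstance, inferInstance, inferInstance, inferInstance,
    inferInstance, inferInstance, ψ, W.subtype, e.1.1.rangeRestrict,
    ⟨h1, h2, h3, fun l w => congrArg Subtype.val (h4 l w),
      fun ⟨_, v, hv⟩ => Subtype.ext (by subst hv; exact hee v), fun _ => rfl⟩⟩

end FieldCorner

end

noncomputable section

set_option linter.unusedSectionVars false

/-! ## Hermitian forms and involutions on corners -/

section CornerForm

variable {F D V W : Type u} [Field F] [Field D] [Algebra F D] [AddCommGroup V] [Module D V]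
  [AddCommGroup W] [Module D W] {τ : D ≃ₐ[F] D} [FiniteDimensional D V]

theorem HermitianForm.form_adjoint_left (B : HermitianForm τ V) {η : Module.End D V}
    (hη : B.adjoint η = η) (v w : V) : B.form (η v) w = B.form v (η w) := by
  rw [← B.adjoint_left, hη]

/-- The form `B(i w, η (i w'))` is a hermitian form on `W`. -/
theorem HermitianForm.exists_form_comp (B : HermitianForm τ V) {i : W →ₗ[D] V} {q : V →ₗ[D] W}
    {η f : Module.End D V} (hη : B.adjoint η = η) (hηη : ∀ v, η (η v) = v)
    (hqi : ∀ w, q (i w) = w) (hiq : ∀ v, i (q v) = f v)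
    (hf : ∀ w, B.adjoint f (η (i w)) = η (i w)) :
    ∃ b : HermitianForm τ W, ∀ w w', b.form w w' = B.form (i w) (η (i w')) := by
  have hsymm : ∀ w w', τ (B.form (i w) (η (i w'))) = B.form (i w') (η (i w)) := fun w w' => by
    rw [B.symm, B.form_adjoint_left hη]
  have hzero : ∀ w, (∀ w', B.form (η (i w)) (i w') = 0) → w = 0 := by
    intro w hw
    have h1 : η (i w) = 0 := B.nondegenerate.1 _ fun v => by
      rw [← hf, B.adjoint_left, ← hiq, hw]
    rw [← hqi w, ← hηη (i w), h1, map_zero, map_zero]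
  refine ⟨⟨LinearMap.mk₂'ₛₗ (τ : D →+* D) (RingHom.id D) (fun w w' => B.form (i w) (η (i w')))
    ?_ ?_ ?_ ?_, ⟨hsymm⟩, ?_, ?_⟩, fun w w' => rfl⟩
  · intro w w₁ w'
    simp only [map_add, LinearMap.add_apply]
  · intro d w w'
    simp only [map_smul, map_smulₛₗ, LinearMap.smul_apply]
  · intro w w' w₁
    simp only [map_add]
  · intro d w w'
    simp only [map_smul, RingHom.id_apply]
  · intro w hw
    refine hzero w fun w' => ?_
    rw [B.form_adjoint_left hη]
    exact hw w'
  · intro w hw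
    refine hzero w fun w' => ?_
    have h1 : B.form (i w') (η (i w)) = 0 := hw w'
    rw [← B.symm, h1, map_zero]

end CornerForm

theorem exists_algEquiv_of_surjective {F L E : Type*} [Field F] [CommRing L] [Algebra F L] [Field E]
    [Algebra F E] (ψ : L →ₐ[F] E) (hψ : Function.Surjective ψ) (s : L →+* L)
    (hs : ∀ l, s (s l) = l) (hs' : ∀ l l', ψ l = ψ l' → ψ (s l) = ψ (s l'))
    (hF : ∀ a, s (algebraMap F L a) = algebraMap F L a) :
    ∃ r : E ≃ₐ[F] E, (∀ l, r (ψ l) = ψ (s l)) ∧ ∀ z, r (r z) = z := by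
  choose g hg using hψ
  have hr : ∀ l, ψ (s (g (ψ l))) = ψ (s l) := fun l => hs' _ _ (hg _)
  have hrr : ∀ z, ψ (s (g (ψ (s (g z))))) = z := fun z => by rw [hr, hs, hg]
  let r : E ≃ₐ[F] E :=
    { toFun := fun z => ψ (s (g z))
      invFun := fun z => ψ (s (g z))
      left_inv := hrr
      right_inv := hrr
      map_mul' := fun a b => by
        rw [← hg a, ← hg b, ← map_mul, hr, hr, hr, map_mul, map_mul]
      map_add' := fun a b => by
        rw [← hg a, ← hg b, ← map_add, hr, hr, hr, map_add, map_add]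
      commutes' := fun a => by
        rw [← ψ.commutes a, hr, hF] }
  exact ⟨r, hr, hrr⟩

section FieldCorner

variable {F D V : Type u} [Field F] [Field D] [Algebra F D] [AddCommGroup V] [Module D V]
  [Module F V] [IsScalarTower F D V] {x : Module.End D V}
  {E W : Type u} [Field E] [Algebra F E] [Algebra D E] [AddCommGroup W] [Module E W]
  [Module D W] {e : Subalgebra.center F (centr F x)}
  {ψ : Subalgebra.center F (centr F x) →ₐ[F] E} {i : W →ₗ[D] V} {q : V →ₗ[D] W}

theorem centr_center_apply (l : Subalgebra.center F (centr F x)) (c : centr F x) (v : V) :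
    c.1 (l.1.1 v) = l.1.1 (c.1 v) :=
  LinearMap.congr_fun (congrArg Subtype.val (Subalgebra.mem_center_iff.1 l.2 c)) v

namespace IsFieldCorner

variable (h : IsFieldCorner e ψ i q)
include h

theorem injective : Function.Injective i := fun w w' hw => by
  rw [← h.q_i w, hw, h.q_i]

theorem e_i (w : W) : e.1.1 (i w) = i w := by rw [← h.i_q, h.q_i]

theorem q_e (v : V) : q (e.1.1 v) = q v := by rw [← h.i_q, h.q_i]

theorem q_apply (l : Subalgebra.center F (centr F x)) (v : V) : q (l.1.1 v) = ψ l • q v := by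
  apply h.injective
  rw [h.i_q, h.i_smul, h.i_q, centr_center_apply l e.1]

theorem isSpaceCorner [Module F W] [IsScalarTower F E W] [IsScalarTower F D W]
    [IsScalarTower D E W] :
    IsSpaceCorner e.1 (i.restrictScalars F) (q.restrictScalars F) (ψ (centerSelf F x)) where
  i_smul d w := by
    rw [LinearMap.restrictScalars_apply, LinearMap.restrictScalars_apply, algebraMap_smul,
      map_smul]
  q_smul d v := by
    rw [LinearMap.restrictScalars_apply, LinearMap.restrictScalars_apply, algebraMap_smul,
      map_smul]
  x_i w := (h.i_smul (centerSelf F x) w).symm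
  q_x v := h.q_apply (centerSelf F x) v
  linear c z w := by
    obtain ⟨l, rfl⟩ := h.surjective z
    change q (c.1 (i (ψ l • w))) = ψ l • q (c.1 (i w))
    rw [h.i_smul, centr_center_apply, h.q_apply]
  q_i := h.q_i
  i_q := h.i_q

/-- The automorphism of `E` that is induced by an involution of the center. -/
theorem exists_algEquiv (s : Subalgebra.center F (centr F x) →+* Subalgebra.center F (centr F x))
    (hs : ∀ l, s (s l) = l) (hse : s e = e) (t : D ≃ₐ[F] D)
    (hsd : ∀ d, s (centerScalar x d) = centerScalar x (t d)) :
    ∃ r : E ≃ₐ[F] E, (∀ l, r (ψ l) = ψ (s l)) ∧ (∀ z, r (r z) = z) ∧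
      ∀ d, r (algebraMap D E d) = algebraMap D E (t d) := by
  have hs' : ∀ l l', ψ l = ψ l' → ψ (s l) = ψ (s l') := by
    intro l l' hl
    rw [h.eq_iff] at hl ⊢
    have h1 := congrArg s hl
    rwa [map_mul, map_mul, hse] at h1
  obtain ⟨r, hr, hrr⟩ := exists_algEquiv_of_surjective (F := F)
    (L := Subalgebra.center F (centr F x)) ψ h.surjective s hs hs' fun a => by
      rw [← (centerScalar x).commutes, hsd, t.commutes]
  refine ⟨r, hr, hrr, fun d => ?_⟩
  rw [← h.scalar, ← h.scalar, ← hsd]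
  exact hr _

/-- The hermitian form over `E` on `W`, whose adjoint involution corresponds to
`c ↦ η⁻¹ c^* η`. -/
theorem exists_form [IsScalarTower D E W] [FiniteDimensional D E] [CharZero D]
    [FiniteDimensional D V] [FiniteDimensional E W] {τ : D ≃ₐ[F] D} (B : HermitianForm τ V)
    {η : Module.End D V} (hη : B.adjoint η = η) (hηη : ∀ v, η (η v) = v)
    (s : Subalgebra.center F (centr F x) →+* Subalgebra.center F (centr F x))
    (hs : ∀ l, s (s l) = l) (hse : s e = e)
    (hsη : ∀ l v, B.adjoint l.1.1 (η v) = η ((s l).1.1 v)) :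
    ∃ r : E ≃ₐ[F] E, (∀ l, r (ψ l) = ψ (s l)) ∧ (∀ z, r (r z) = z) ∧
      (∀ d, r (algebraMap D E d) = algebraMap D E (τ d)) ∧
      ∃ (b : HermitianForm τ W) (B' : HermitianForm r W),
        (∀ w w', b.form w w' = B.form (i w) (η (i w'))) ∧
        (∀ z w w', Algebra.trace D E (z * B'.form w w') = b.form w (z • w')) ∧
        ∀ (c c' : centr F x) (f g : Module.End E W),
          (∀ v, B.adjoint c.1 (η v) = η (c'.1 v)) → (∀ w, f w = q (c.1 (i w))) →
          (∀ w, g w = q (c'.1 (i w))) → B'.adjoint f = g := by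
  have hsd : ∀ d, s (centerScalar x d) = centerScalar x (τ d) := by
    intro d
    refine Subtype.ext (Subtype.ext (LinearMap.ext fun v => ?_))
    rw [← hηη ((s (centerScalar x d)).1.1 v), ← hsη, centerScalar_apply]
    have h1 : B.adjoint (centerScalar (F := F) x d).1.1 (η v) = τ d • η v := by
      refine B.ext_right fun w => ?_
      rw [B.adjoint_right, centerScalar_apply, map_smulₛₗ, LinearMap.smul_apply, map_smul]
      rfl
    rw [h1, map_smul, hηη]
  obtain ⟨r, hr1, hr2, hr3⟩ := h.exists_algEquiv s hs hse τ hsd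
  obtain ⟨b, hb⟩ := B.exists_form_comp hη hηη h.q_i h.i_q fun w => by rw [hsη, hse, h.e_i]
  obtain ⟨B', hB'⟩ := b.exists_trace_eq hr3 hr2 (by
    intro z w w'
    obtain ⟨l, rfl⟩ := h.surjective z
    rw [hb, hb, hr1, h.i_smul, h.i_smul, ← hsη, B.adjoint_right])
  refine ⟨r, hr1, hr2, hr3, b, B', hb, hB', fun c c' f g hcc' hf hg => ?_⟩
  refine HermitianForm.adjoint_eq_of_trace_eq hB' fun w w' => ?_
  rw [hb, hb, hf, hg, h.i_q, h.i_q, ← centr_center_apply, ← centr_center_apply, h.e_i, h.e_i,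
    ← B.form_adjoint_left hη, ← hcc', B.adjoint_left, B.form_adjoint_left hη]

end IsFieldCorner

end FieldCorner

section FixedField

variable {F D E : Type u} [Field F] [Field D] [Field E] [Algebra F D] [Algebra F E] [Algebra D E]
  [IsScalarTower F D E] [FiniteDimensional D E]

theorem exists_fixedField (c : E ≃ₐ[D] E) (hc : c ≠ 1) (hc2 : ∀ z, c (c z) = z) :
    ∃ (K : Type u) (_ : Field K) (_ : Algebra F K) (_ : Algebra D K) (_ : IsScalarTower F D K)
      (_ : FiniteDimensional D K) (_ : Algebra K E) (_ : IsScalarTower F K E)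
      (_ : IsScalarTower D K E) (_ : Algebra.IsQuadraticExtension K E) (c' : E ≃ₐ[K] E),
      c' ≠ 1 ∧ (∀ z, c' z = c z) ∧ ∀ z, c z = z → ∃ k, algebraMap K E k = z := by
  have hcc : c ^ 2 = 1 := AlgEquiv.ext fun z => by rw [sq]; exact hc2 z
  let K := IntermediateField.fixedField (Subgroup.zpowers c)
  have hK : ∀ z, c z = z → z ∈ K := by
    rintro z hz ⟨g, n, rfl⟩
    have : (Subgroup.zpowers c) ≤ MulAction.stabilizer (E ≃ₐ[D] E) z := by
      rw [Subgroup.zpowers_le]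
      exact hz
    exact this ⟨n, rfl⟩
  have hK' : ∀ z ∈ K, c z = z := fun z hz => hz ⟨c, Subgroup.mem_zpowers c⟩
  have hfin : Module.finrank K E = 2 := by
    rw [IntermediateField.finrank_fixedField_eq_card, Nat.card_zpowers]
    exact orderOf_eq_prime hcc hc
  have : Algebra.IsQuadraticExtension K E := ⟨hfin⟩
  refine ⟨K, inferInstance, inferInstance, inferInstance, inferInstance, inferInstance,
    inferInstance, IsScalarTower.of_algebraMap_eq fun r => rfl, inferInstance, inferInstance,
    AlgEquiv.ofRingEquiv (f := (c : E ≃+* E)) fun k => hK' _ k.2, fun h => hc ?_, fun z => rfl,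
    fun z hz => ⟨⟨z, hK z hz⟩, rfl⟩⟩
  exact AlgEquiv.ext fun z => congrArg (fun f : E ≃ₐ[K] E => f z) h

theorem exists_algEquiv_restrict {K : Type u} [Field K] [Algebra F K] [Algebra K E]
    [IsScalarTower F K E] (s : E ≃ₐ[F] E) (hs : ∀ z, s (s z) = z)
    (h : ∀ k : K, ∃ k', algebraMap K E k' = s (algebraMap K E k)) :
    ∃ t : K ≃ₐ[F] K, (∀ k, s (algebraMap K E k) = algebraMap K E (t k)) ∧ ∀ k, t (t k) = k := by
  choose t ht using h
  have hinj := (algebraMap K E).injective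
  have htt : ∀ k, t (t k) = k := fun k => hinj (by rw [ht, ht, hs])
  let t' : K ≃ₐ[F] K :=
    { toFun := t
      invFun := t
      left_inv := htt
      right_inv := htt
      map_mul' := fun a b => hinj (by rw [map_mul, ht, ht, ht, map_mul, map_mul])
      map_add' := fun a b => hinj (by rw [map_add, ht, ht, ht, map_add, map_add])
      commutes' := fun a => hinj (by
        rw [ht, ← IsScalarTower.algebraMap_apply, s.commutes]) }
  exact ⟨t', fun k => (ht k).symm, htt⟩

end FixedField

end

noncomputable section

/-! ## The factors of a descendant -/

/-- The element `x` of the unitary group of `B` is the symmetrization of an element with respect to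
the conjugation by the unitary involution `ε`; `y` is the inverse of `x`. -/
structure IsSymmetrized {F D V : Type u} [Field F] [Field D] [Algebra F D] [AddCommGroup V]
    [Module D V] [FiniteDimensional D V] {τ : D ≃ₐ[F] D} (B : HermitianForm τ V)
    (x y ε : Module.End D V) : Prop where
  xy : x * y = 1
  yx : y * x = 1
  εε : ε * ε = 1
  εx : ε * x * ε = y
  adjoint_x : B.adjoint x = y
  adjoint_ε : B.adjoint ε = ε

section Adjoint

variable {F D V : Type u} [Field F] [Field D] [Algebra F D] [AddCommGroup V] [Module D V]
  [FiniteDimensional D V] {τ : D ≃ₐ[F] D}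

theorem HermitianForm.adjoint_one (B : HermitianForm τ V) : B.adjoint 1 = 1 :=
  LinearMap.ext fun w => B.ext_right fun v => by
    rw [B.adjoint_right, Module.End.one_apply, Module.End.one_apply]

theorem HermitianForm.adjoint_eq (B : HermitianForm τ V) {f g : Module.End D V}
    (h : ∀ w w', B.form (g w) w' = B.form w (f w')) : B.adjoint f = g :=
  LinearMap.ext fun w => B.injective (LinearMap.ext fun w' => by rw [B.adjoint_left, h])

end Adjoint

section Factors

variable {F D V : Type u} [Field F] [Field D] [Algebra F D] [AddCommGroup V] [Module D V]
  [Module F V] [IsScalarTower F D V] [FiniteDimensional D V] {τ : D ≃ₐ[F] D}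
  {B : HermitianForm τ V} {x y ε : Module.End D V} (h : IsSymmetrized B x y ε)

namespace IsSymmetrized

include h

/-- The adjoint involution on the centralizer of `x`. -/
def inv : AlgInvolution F (centr F x) :=
  B.adjointInvolution.restrictCentr h.xy h.yx h.adjoint_x

/-- The conjugation by `ε` on the centralizer of `x`. -/
def aut : centr F x →ₐ[F] centr F x :=
  conjCentr h.xy h.yx h.εε h.εx

theorem aut_aut (a : centr F x) : h.aut (h.aut a) = a := conjCentr_conjCentr _ _ _ _ a

theorem inv_aut (a : centr F x) : h.inv.toLin (h.aut a) = h.aut (h.inv.toLin a) :=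
  restrictCentr_conjCentr _ _ _ _ h.adjoint_x h.adjoint_ε a

theorem coe_inv (a : centr F x) : (h.inv.toLin a).1 = B.adjoint a.1 := rfl

theorem aut_apply (a : centr F x) (v : V) : (h.aut a).1 v = ε (a.1 (ε v)) := rfl

theorem ε_ε (v : V) : ε (ε v) = v := LinearMap.congr_fun h.εε v

/-- The adjoint involution on the center. -/
def centerInv :
    Subalgebra.center F (centr F x) →+* Subalgebra.center F (centr F x) :=
  h.inv.centerHom

/-- The conjugation by `ε` on the center. -/
def centerConj :
    Subalgebra.center F (centr F x) →+* Subalgebra.center F (centr F x) :=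
  centerAut h.aut h.aut_aut

theorem coe_centerInv (l : Subalgebra.center F (centr F x)) :
    (h.centerInv l).1 = h.inv.toLin l.1 := rfl

theorem coe_centerConj (l : Subalgebra.center F (centr F x)) :
    (h.centerConj l).1 = h.aut l.1 := rfl

theorem centerInv_centerInv (l : Subalgebra.center F (centr F x)) :
    h.centerInv (h.centerInv l) = l := Subtype.ext (h.inv.involutive l.1)

theorem centerConj_centerConj (l : Subalgebra.center F (centr F x)) :
    h.centerConj (h.centerConj l) = l := Subtype.ext (h.aut_aut l.1)

theorem centerInv_centerConj (l : Subalgebra.center F (centr F x)) :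
    h.centerInv (h.centerConj l) = h.centerConj (h.centerInv l) := Subtype.ext (h.inv_aut l.1)

end IsSymmetrized

variable {E W : Type u} [Field E] [Algebra F E] [Algebra D E] [IsScalarTower F D E]
  [FiniteDimensional D E] [AddCommGroup W] [Module E W] [Module D W] [Module F W]
  [IsScalarTower F E W] [IsScalarTower D E W] [IsScalarTower F D W] [FiniteDimensional E W]
  {e : Subalgebra.center F (centr F x)}
  {ψ : Subalgebra.center F (centr F x) →ₐ[F] E} {i : W →ₗ[D] V} {q : V →ₗ[D] W}
  (hc : IsFieldCorner e ψ i q)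
include hc

theorem IsFieldCorner.exists_isCornerMap :
    ∃ (π : centr F x →ₐ[F] Module.End E W) (ι : Module.End E W →ₗ[F] centr F x),
      IsCornerMap e.1 π ι ∧ ∀ c w, π c w = q (c.1 (i w)) :=
  hc.isSpaceCorner.exists_isCornerMap fun c => (Subalgebra.mem_center_iff.1 e.2 c).symm

namespace IsSymmetrized

theorem exists_factor_free (h1 : e * h.centerInv e = 0) (h2 : e * h.centerConj e = 0)
    (h3 : e * h.centerConj (h.centerInv e) = 0) :
    ∃ P, IsListedPair F D τ P ∧ IsFactor h.inv h.aut h.aut_aut h.inv_aut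
      (e + h.centerInv e + h.centerConj (e + h.centerInv e)).1 P := by
  obtain ⟨π, ι, hπ, -⟩ := hc.exists_isCornerMap
  exact ⟨_, .diagonalGL E W, isFactor_diagonal_unitsFunctor hπ (congrArg Subtype.val h1)
    (congrArg Subtype.val h2) (congrArg Subtype.val h3)⟩

theorem exists_factor_left [CharZero D] (h1 : h.centerInv e = e) (h2 : e * h.centerConj e = 0) :
    ∃ P, IsListedPair F D τ P ∧ IsFactor h.inv h.aut h.aut_aut h.inv_aut
      (e + h.centerConj e).1 P := by
  obtain ⟨π, ι, hπ, hπ'⟩ := hc.exists_isCornerMap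
  obtain ⟨r, -, hr2, hr3, b, B', -, -, hB'⟩ := hc.exists_form B (η := 1) B.adjoint_one
    (fun _ => rfl) h.centerInv h.centerInv_centerInv h1 (fun _ _ => rfl)
  exact ⟨_, .diagonalU E r hr2 hr3 W B', isFactor_diagonal_unitaryFunctor hπ B'.adjointInvolution
    (congrArg Subtype.val h1) (congrArg Subtype.val h2) fun c =>
      (hB' c _ _ _ (fun _ => rfl) (hπ' c) (hπ' _)).symm⟩

theorem exists_factor_mixed [CharZero D] (h1 : h.centerConj (h.centerInv e) = e)
    (h2 : e * h.centerInv e = 0) :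
    ∃ P, IsListedPair F D τ P ∧ IsFactor h.inv h.aut h.aut_aut h.inv_aut
      (e + h.centerInv e).1 P := by
  obtain ⟨π, ι, hπ, hπ'⟩ := hc.exists_isCornerMap
  have hη : ∀ (c : centr F x) v, B.adjoint c.1 (ε v) = ε ((h.aut (h.inv.toLin c)).1 v) :=
    fun c v => by rw [h.aut_apply, h.ε_ε, h.coe_inv]
  obtain ⟨r, -, hr2, hr3, b, B', -, -, hB'⟩ := hc.exists_form B h.adjoint_ε h.ε_ε
    (h.centerConj.comp h.centerInv) (fun l => by
      rw [RingHom.comp_apply, RingHom.comp_apply, h.centerInv_centerConj, h.centerInv_centerInv,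
        h.centerConj_centerConj]) h1 (fun l v => hη l.1 v)
  exact ⟨_, .unitaryInGL E r hr2 hr3 W B', isFactor_unitsUnitary hπ B'.adjointInvolution
    (congrArg Subtype.val h2) fun c => (hB' c _ _ _ (hη c) (hπ' c) (hπ' _)).symm⟩

/-- If `e` is fixed by the conjugation by `ε`, then `ε` acts on the image of `e`. -/
theorem exists_semilinear (h1 : h.centerConj e = e) :
    ∃ (c : E ≃ₐ[D] E) (η : W →ₗ[D] W), (∀ l, c (ψ l) = ψ (h.centerConj l)) ∧
      (∀ z, c (c z) = z) ∧ (∀ z w, η (z • w) = c z • η w) ∧ (∀ w, η (η w) = w) ∧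
      (∀ w, i (η w) = ε (i w)) ∧
      ∀ (a : centr F x) w, q ((h.aut a).1 (i w)) = η (q (a.1 (i (η w)))) := by
  obtain ⟨c, hc1, hc2, hc3⟩ := hc.exists_algEquiv h.centerConj h.centerConj_centerConj h1
    AlgEquiv.refl (fun d => Subtype.ext (Subtype.ext (LinearMap.ext fun v => by
      rw [h.coe_centerConj, h.aut_apply]
      change ε (d • ε v) = d • v
      rw [map_smul, h.ε_ε])))
  have hεe : ∀ v, ε (e.1.1 v) = e.1.1 (ε v) := fun v => by
    have := h.aut_apply e.1 (ε v)
    rw [h.ε_ε, ← h.coe_centerConj, h1] at this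
    exact this.symm
  have hi : ∀ w, i (q (ε (i w))) = ε (i w) := fun w => by rw [hc.i_q, ← hεe, hc.e_i]
  refine ⟨AlgEquiv.ofRingEquiv (f := (c : E ≃+* E)) hc3, q ∘ₗ ε ∘ₗ i, hc1, hc2, fun z w => ?_,
    fun w => ?_, hi, fun a w => ?_⟩
  · obtain ⟨l, rfl⟩ := hc.surjective z
    change q (ε (i (ψ l • w))) = c (ψ l) • q (ε (i w))
    rw [hc1, ← hc.q_apply, hc.i_smul, h.coe_centerConj, h.aut_apply, h.ε_ε]
  · change q (ε (i (q (ε (i w))))) = w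
    rw [hi, h.ε_ε, hc.q_i]
  · change _ = q (ε (i (q (a.1 (i (q (ε (i w))))))))
    rw [hi, hc.i_q, hεe, hc.q_e]
    rfl

end IsSymmetrized

end Factors

end

noncomputable section

/-! ## Factors of a single idempotent that is stable under the conjugation -/

section Descent

variable {F D E W : Type u} [Field F] [Field D] [Field E] [Algebra F D] [Algebra F E] [Algebra D E]
  [IsScalarTower F D E] [FiniteDimensional D E] [CharZero D] [AddCommGroup W] [Module E W]
  [Module D W] [IsScalarTower D E W]

theorem fixed_form_eq {τ : D ≃ₐ[F] D} {r : E ≃ₐ[F] E} {b : HermitianForm τ W}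
    {B : HermitianForm r W}
    (hB : ∀ z w w', Algebra.trace D E (z * B.form w w') = b.form w (z • w')) (c : E ≃ₐ[D] E)
    (hc : ∀ z, c (c z) = z) {η : W →ₗ[D] W} (hη : ∀ (z : E) w, η (z • w) = c z • η w)
    (hηη : ∀ w, η (η w) = w) (hb : ∀ w w', b.form (η w) w' = b.form w (η w')) (w w' : W) :
    B.form (η w) (η w') = c (B.form w w') := by
  refine trace_mul_injective D fun z => ?_
  have h1 : z * c (B.form w w') = c (c z * B.form w w') := by rw [map_mul, hc]
  have h2 : z • η w' = η (c z • w') := by rw [hη, hc]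
  rw [h1, Algebra.trace_eq_of_algEquiv, hB, hB, hb, h2, hηη]

/-- The restriction of a hermitian form to the fixed vectors of a semilinear isometry. -/
theorem exists_form_fixedVectors {K : Type u} [Field K] [Algebra F K] [Algebra K E]
    [Module K W] [IsScalarTower K E W] {r : E ≃ₐ[F] E} (B : HermitianForm r W)
    {t : K ≃ₐ[F] K} (ht : ∀ k, r (algebraMap K E k) = algebraMap K E (t k)) {c : E → E}
    (hK : ∀ z, c z = z → ∃ k, algebraMap K E k = z)
    {η : W →ₗ[K] W} (hη : ∀ w w', B.form (η w) (η w') = c (B.form w w'))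
    (hspan : ∀ l : W →ₗ[E] E, (∀ w ∈ fixedVectors η, l w = 0) → l = 0) :
    ∃ B₀ : HermitianForm t (fixedVectors η), ∀ w w' : fixedVectors η,
      algebraMap K E (B₀.form w w') = B.form w w' := by
  have h1 : ∀ w w' : fixedVectors η, ∃ k, algebraMap K E k = B.form (w : W) w' := by
    intro w w'
    refine hK _ ?_
    rw [← hη, mem_fixedVectors.1 w.2, mem_fixedVectors.1 w'.2]
  choose β hβ using h1
  have hinj := (algebraMap K E).injective
  have hsymm : ∀ w w', t (β w w') = β w' w := fun w w' => hinj (by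
    rw [← ht, hβ, hβ, B.symm])
  have hleft : ∀ w, (∀ w', β w w' = 0) → w = 0 := by
    intro w hw
    have : B.form (w : W) = 0 := hspan _ fun w' hw' => by
      rw [← hβ w ⟨w', hw'⟩, hw, map_zero]
    exact Subtype.ext (B.injective (this.trans (map_zero B.form).symm))
  refine ⟨⟨LinearMap.mk₂'ₛₗ (t : K →+* K) (RingHom.id K) β ?_ ?_ ?_ ?_, ⟨hsymm⟩, hleft, ?_⟩, hβ⟩
  · intro w w₁ w'
    refine hinj ?_
    rw [map_add, hβ, hβ, hβ, Submodule.coe_add, map_add, LinearMap.add_apply]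
  · intro k w w'
    refine hinj ?_
    change _ = algebraMap K E (t k * β w w')
    rw [map_mul, hβ, hβ, ← ht, Submodule.coe_smul, ← algebraMap_smul E k, map_smulₛₗ]
    rfl
  · intro w w' w₁
    refine hinj ?_
    rw [map_add, hβ, hβ, hβ, Submodule.coe_add, map_add]
  · intro k w w'
    refine hinj ?_
    rw [RingHom.id_apply, smul_eq_mul, map_mul, hβ, hβ, Submodule.coe_smul,
      ← algebraMap_smul E k, map_smul, smul_eq_mul]
  · intro w hw
    refine hleft w fun w' => ?_
    have h2 : β w' w = 0 := hw w'
    rw [← hsymm, h2, map_zero]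

end Descent

section Factors

variable {F D V : Type u} [Field F] [Field D] [Algebra F D] [AddCommGroup V] [Module D V]
  [Module F V] [IsScalarTower F D V] [FiniteDimensional D V] {τ : D ≃ₐ[F] D}
  {B : HermitianForm τ V} {x y ε : Module.End D V} (h : IsSymmetrized B x y ε)
  {E W : Type u} [Field E] [Algebra F E] [Algebra D E] [IsScalarTower F D E]
  [FiniteDimensional D E] [AddCommGroup W] [Module E W] [Module D W] [Module F W]
  [IsScalarTower F E W] [IsScalarTower D E W] [IsScalarTower F D W] [FiniteDimensional E W]
  {e : Subalgebra.center F (centr F x)}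
  {ψ : Subalgebra.center F (centr F x) →ₐ[F] E} {i : W →ₗ[D] V} {q : V →ₗ[D] W}
  (hc : IsFieldCorner e ψ i q)
include hc

namespace IsSymmetrized

theorem exists_factor_galoisGL [CharZero D] (h2 : e * h.centerInv e = 0)
    {c : E ≃ₐ[D] E} {η : W →ₗ[D] W} (hcc : ∀ z, c (c z) = z)
    (hη : ∀ (z : E) w, η (z • w) = c z • η w) (hηη : ∀ w, η (η w) = w)
    (hi : ∀ (a : centr F x) w, q ((h.aut a).1 (i w)) = η (q (a.1 (i (η w))))) (hc1 : c ≠ 1) :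
    ∃ P, IsListedPair F D τ P ∧ IsFactor h.inv h.aut h.aut_aut h.inv_aut
      (e + h.centerInv e).1 P := by
  obtain ⟨K, _, _, _, _, _, _, _, _, _, c', hc1', hcc', hK⟩ := exists_fixedField (F := F) c hc1 hcc
  have : CharZero K := charZero_of_injective_algebraMap (algebraMap D K).injective
  let _ : Module K W := Module.compHom W (algebraMap K E)
  have : IsScalarTower K E W := IsScalarTower.of_algebraMap_smul fun k w => rfl
  let ηK : W →ₗ[K] W :=
    { toFun := η
      map_add' := η.map_add
      map_smul' := fun k w => by
        change η (algebraMap K E k • w) = algebraMap K E k • η w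
        rw [hη, ← hcc', AlgEquiv.commutes] }
  have : FiniteDimensional K W := FiniteDimensional.trans K E W
  obtain ⟨T, hT1, hT2⟩ := exists_galoisDescent c' hc1' (fun z => by rw [hcc', hcc', hcc])
    (fun z hz => hK z (by rw [← hcc', hz])) ηK (fun z w => by rw [hcc']; exact hη z w) hηη
  obtain ⟨π, ι, hπ, hπ'⟩ := (hc.isSpaceCorner.comp T).exists_isCornerMap fun c =>
    (Subalgebra.mem_center_iff.1 e.2 c).symm
  refine ⟨_, .galoisGL K E c' hc1' (fixedVectors ηK), isFactor_unitsAut hπ _ _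
    (congrArg Subtype.val h2) fun a => LinearMap.ext fun u => T.injective ?_⟩
  have hTπ : ∀ a u, T (π a u) = q (a.1 (i (T u))) := fun a u => by
    rw [hπ']
    exact T.apply_symm_apply _
  rw [galoisConj_apply, hT2, hTπ, hTπ, hi, hT2]
  rfl

theorem exists_factor_galoisU [CharZero D] (h1 : h.centerInv e = e)
    {c : E ≃ₐ[D] E} {η : W →ₗ[D] W} (hcψ : ∀ l, c (ψ l) = ψ (h.centerConj l))
    (hcc : ∀ z, c (c z) = z)
    (hη : ∀ (z : E) w, η (z • w) = c z • η w) (hηη : ∀ w, η (η w) = w)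
    (hiη : ∀ w, i (η w) = ε (i w))
    (hi : ∀ (a : centr F x) w, q ((h.aut a).1 (i w)) = η (q (a.1 (i (η w))))) (hc1 : c ≠ 1) :
    ∃ P, IsListedPair F D τ P ∧ IsFactor h.inv h.aut h.aut_aut h.inv_aut e.1 P := by
  obtain ⟨r, hr1, hr2, hr3, b, B', hb, hB, hB'⟩ := hc.exists_form B (η := 1) B.adjoint_one
    (fun _ => rfl) h.centerInv h.centerInv_centerInv h1 (fun _ _ => rfl)
  obtain ⟨K, _, _, _, _, _, _, _, _, _, c', hc1', hcc', hK⟩ := exists_fixedField (F := F) c hc1 hcc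
  have : CharZero K := charZero_of_injective_algebraMap (algebraMap D K).injective
  let _ : Module K W := Module.compHom W (algebraMap K E)
  have : IsScalarTower K E W := IsScalarTower.of_algebraMap_smul fun k w => rfl
  let ηK : W →ₗ[K] W :=
    { toFun := η
      map_add' := η.map_add
      map_smul' := fun k w => by
        change η (algebraMap K E k • w) = algebraMap K E k • η w
        rw [hη, ← hcc', AlgEquiv.commutes] }
  have : FiniteDimensional K W := FiniteDimensional.trans K E W
  obtain ⟨T, hT1, hT2⟩ := exists_galoisDescent c' hc1' (fun z => by rw [hcc', hcc', hcc])
    (fun z hz => hK z (by rw [← hcc', hz])) ηK (fun z w => by rw [hcc']; exact hη z w) hηη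
  have hrc : ∀ z, r (c z) = c (r z) := by
    intro z
    obtain ⟨l, rfl⟩ := hc.surjective z
    rw [hcψ, hr1, hr1, hcψ, h.centerInv_centerConj]
  obtain ⟨t, ht1, ht2⟩ := exists_algEquiv_restrict (K := K) r hr2 fun k => hK _ (by
    rw [← hrc, ← hcc' (algebraMap K E k), AlgEquiv.commutes])
  have ht3 : ∀ d, t (algebraMap D K d) = algebraMap D K (τ d) := fun d =>
    (algebraMap K E).injective (by
      rw [← ht1, ← IsScalarTower.algebraMap_apply, ← IsScalarTower.algebraMap_apply, hr3])
  have hbη : ∀ w w', b.form (η w) w' = b.form w (η w') := fun w w' => by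
    rw [hb, hb, hiη, B.form_adjoint_left h.adjoint_ε, hiη]
    rfl
  obtain ⟨B₀, hB₀⟩ := exists_form_fixedVectors (η := ηK) B' ht1 hK
    (fixed_form_eq hB c hcc hη hηη hbη) fun l hl => by
      have h3 : l ∘ₗ T.toLinearMap = 0 := TensorProduct.AlgebraTensorModule.ext fun z w => by
        change l (T (z ⊗ₜ w)) = 0
        rw [hT1, map_smul, hl _ w.2, smul_zero]
      refine LinearMap.ext fun w => ?_
      rw [← T.apply_symm_apply w]
      exact LinearMap.congr_fun h3 _
  have hform : ∀ u v, B₀.baseChangeForm r ht1 u v = B'.form (T u) (T v) := by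
    intro u v
    induction u with
    | zero => simp
    | add u u' hu hu' => simp only [map_add, LinearMap.add_apply, hu, hu']
    | tmul z w =>
      induction v with
      | zero => simp
      | add v v' hv hv' => simp only [map_add, hv, hv']
      | tmul z' w' =>
        rw [HermitianForm.baseChangeForm_tmul, hT1, hT1, hB₀, map_smul,
          B'.form.map_smulₛₗ, LinearMap.smul_apply, smul_eq_mul, smul_eq_mul, mul_comm (r z),
          mul_assoc]
        rfl
  obtain ⟨π, ι, hπ, hπ'⟩ := (hc.isSpaceCorner.comp T).exists_isCornerMap fun c =>
    (Subalgebra.mem_center_iff.1 e.2 c).symm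
  have hTπ : ∀ a u, T (π a u) = q (a.1 (i (T u))) := fun a u => by
    rw [hπ']
    exact T.apply_symm_apply _
  obtain ⟨π', ι', hπ1, hπ2⟩ := hc.exists_isCornerMap
  refine ⟨_, .galoisU K t ht2 ht3 E r hr2 ht1 c' hc1' (fixedVectors ηK) B₀,
    isFactor_unitaryAut hπ _ _ _ _ (congrArg Subtype.val h1) (fun a => ?_)
    fun a => LinearMap.ext fun u => T.injective ?_⟩
  · refine (HermitianForm.adjoint_eq _ fun u v => ?_).symm
    refine (hform _ _).trans (Eq.trans ?_ (hform _ _).symm)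
    rw [hTπ, hTπ, ← hπ2, ← hπ2, ← hB' a _ _ _ (fun _ => rfl) (hπ2 a) (hπ2 _), B'.adjoint_left]
  · rw [galoisConj_apply, hT2, hTπ, hTπ, hi, hT2]
    rfl

end IsSymmetrized

end Factors

end

noncomputable section

/-! ## Factors with a conjugation by an element -/

section Inner

variable {F A C : Type u} [Field F] [Ring A] [Algebra F A] [Ring C] [Algebra F C]

/-- The conjugation by an element `η` with `η² = 1`. -/
def conjInvolution (F : Type u) [Field F] [Algebra F A] {η : A} (hη : η * η = 1) : A →ₐ[F] A :=
  AlgHom.ofLinearMap (LinearMap.mulLeft F η ∘ₗ LinearMap.mulRight F η)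
    (by simp [hη])
    (fun a b => by
      simp only [LinearMap.comp_apply, LinearMap.mulLeft_apply, LinearMap.mulRight_apply]
      calc η * (a * b * η) = η * (a * 1 * (b * η)) := by rw [mul_one, mul_assoc]
        _ = _ := by rw [← hη]; simp only [mul_assoc])

theorem conjInvolution_apply {η : A} (hη : η * η = 1) (a : A) :
    conjInvolution F hη a = η * (a * η) := rfl

theorem IsFactor.inner {σ : AlgInvolution F C} {φ : C →ₐ[F] C} {hφ : ∀ a, φ (φ a) = a}
    {hσ : ∀ a, σ.toLin (φ a) = φ (σ.toLin a)} {f : C} {σ' : AlgInvolution F A}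
    {φ' : A →ₐ[F] A} {hφ' : ∀ a, φ' (φ' a) = a} {hσ' : ∀ a, σ'.toLin (φ' a) = φ' (σ'.toLin a)}
    (h : IsFactor σ φ hφ hσ f (SymmetricPair.unitaryAut σ' φ' hφ' hσ'))
    (ε : (unitaryFunctor σ').obj (CommAlgCat.of F F)) (hε : ε ^ 2 = 1)
    (hφε : ∀ a, φ' a = pointVal σ' ε * (a * pointVal σ' ε)) :
    IsFactor σ φ hφ hσ f (SymmetricPair.inner (unitaryFunctor σ') ε hε) := by
  obtain ⟨l, h1, h2⟩ := h
  refine ⟨l, fun R z => (h1 R z).trans (unitaryVal_injective R ?_), h2⟩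
  refine Eq.trans ?_ (inner_θ_val ε hε R (l.app R z)).symm
  change SymmetricPair.extHom φ' R (unitaryVal _ R (l.app R z)) = _
  generalize unitaryVal _ R (l.app R z) = w
  induction w with
  | zero => simp
  | add a b ha hb => simp only [map_add, ha, hb, mul_add, add_mul]
  | tmul r a => simp [SymmetricPair.extHom, hφε, mul_assoc]

end Inner

section Factors

variable {F D V : Type u} [Field F] [Field D] [Algebra F D] [AddCommGroup V] [Module D V]
  [Module F V] [IsScalarTower F D V] [FiniteDimensional D V] {τ : D ≃ₐ[F] D}
  {B : HermitianForm τ V} {x y ε : Module.End D V} (h : IsSymmetrized B x y ε)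
  {E W : Type u} [Field E] [Algebra F E] [Algebra D E] [IsScalarTower F D E]
  [FiniteDimensional D E] [AddCommGroup W] [Module E W] [Module D W] [Module F W]
  [IsScalarTower F E W] [IsScalarTower D E W] [IsScalarTower F D W] [FiniteDimensional E W]
  {e : Subalgebra.center F (centr F x)}
  {ψ : Subalgebra.center F (centr F x) →ₐ[F] E} {i : W →ₗ[D] V} {q : V →ₗ[D] W}
  (hc : IsFieldCorner e ψ i q)
include hc

namespace IsSymmetrized

theorem exists_sign (hψ : ∀ l, ψ l = ψ (h.centerConj l)) :
    ∃ δ : D, (δ = 1 ∨ δ = -1) ∧ ∀ w, x (i w) = δ • i w := by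
  have h1 : centerSelf F x * h.centerConj (centerSelf F x) = 1 :=
    Subtype.ext (Subtype.ext (LinearMap.ext fun v => by
      change x (ε (x (ε v))) = v
      have h2 : ε (x (ε v)) = y v := LinearMap.congr_fun h.εx v
      rw [h2]
      exact LinearMap.congr_fun h.xy v))
  have h2 := congrArg ψ h1
  rw [map_mul, ← hψ, map_one, mul_self_eq_one_iff] at h2
  have h3 : ∀ w, x (i w) = i (ψ (centerSelf F x) • w) := fun w => (hc.i_smul (centerSelf F x) w).symm
  rcases h2 with h2 | h2
  · exact ⟨1, Or.inl rfl, fun w => by rw [h3, h2, one_smul, one_smul]⟩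
  · exact ⟨-1, Or.inr rfl, fun w => by rw [h3, h2, neg_smul, one_smul, neg_smul, one_smul, map_neg]⟩

theorem centerInv_mul_ne_zero (he : e ≠ 0) {δ : D} (hδ : δ = 1 ∨ δ = -1)
    (hx : ∀ w, x (i w) = δ • i w) : e * h.centerInv e ≠ 0 := by
  intro h2
  have hδδ : δ * δ = 1 := by rcases hδ with rfl | rfl <;> simp
  have hτδ : τ δ = δ := by rcases hδ with rfl | rfl <;> simp
  have hxe : ∀ v, x (e.1.1 v) = δ • e.1.1 v := fun v => by rw [← hc.i_q, hx]
  have hex : ∀ v, e.1.1 (x v) = δ • e.1.1 v := fun v =>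
    (centr_center_apply e (centerSelf F x).1 v).symm.trans (hxe v)
  have hye : ∀ v, y ((h.centerInv e).1.1 v) = δ • (h.centerInv e).1.1 v := fun v =>
    B.ext_right fun u => by
      rw [h.coe_centerInv, h.coe_inv, ← h.adjoint_x, B.adjoint_right, B.adjoint_right, hex,
        map_smulₛₗ, LinearMap.smul_apply, map_smul, B.adjoint_right]
      exact congrArg (· • _) hτδ
  have hxe' : ∀ v, x ((h.centerInv e).1.1 v) = δ • (h.centerInv e).1.1 v := fun v => by
    have h3 : x (y ((h.centerInv e).1.1 v)) = (h.centerInv e).1.1 v := LinearMap.congr_fun h.xy _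
    rw [hye, map_smul] at h3
    nth_rewrite 2 [← h3]
    rw [smul_smul, hδδ, one_smul]
  have hne : ∀ l : Subalgebra.center F (centr F x), l ≠ 0 → ∃ v, l.1.1 v ≠ 0 := by
    intro l hl
    by_contra! hv
    exact hl (Subtype.ext (Subtype.ext (LinearMap.ext hv)))
  obtain ⟨v₀, hv₀⟩ := hne e he
  obtain ⟨v₁, hv₁⟩ := hne (h.centerInv e) fun h0 => he (by
    rw [← h.centerInv_centerInv e, h0, map_zero])
  obtain ⟨f, hf⟩ : ∃ f : Module.Dual D V, f (e.1.1 v₀) ≠ 0 := by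
    by_contra! hf
    exact hv₀ ((Module.forall_dual_apply_eq_zero_iff D _).1 hf)
  let a : centr F x := ⟨(f ∘ₗ e.1.1).smulRight ((h.centerInv e).1.1 v₁), mem_centr.2
    (LinearMap.ext fun v => by
      change x (f (e.1.1 v) • _) = f (e.1.1 (x v)) • _
      rw [map_smul, hxe', hex, map_smul, smul_assoc, smul_comm])⟩
  have h3 := centr_center_apply e a v₀
  have h4 : e.1.1 ((h.centerInv e).1.1 v₁) = 0 :=
    LinearMap.congr_fun (congrArg (fun l => l.1.1) h2) v₁
  have h5 : e.1.1 (e.1.1 v₀) = e.1.1 v₀ := by rw [← hc.i_q v₀, hc.e_i]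
  change f (e.1.1 (e.1.1 v₀)) • (h.centerInv e).1.1 v₁ =
    e.1.1 (f (e.1.1 v₀) • (h.centerInv e).1.1 v₁) at h3
  rw [h5, map_smul, h4, smul_zero, smul_eq_zero] at h3
  exact h3.elim hf hv₁

theorem exists_factor_innerU [CharZero D] (he : e ≠ 0) (h1 : h.centerInv e = e)
    {δ : D} (hx : ∀ w, x (i w) = δ • i w) {η : W →ₗ[D] W} (hηη : ∀ w, η (η w) = w)
    (hiη : ∀ w, i (η w) = ε (i w))
    (hi : ∀ (a : centr F x) w, q ((h.aut a).1 (i w)) = η (q (a.1 (i (η w))))) :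
    ∃ P, IsListedPair F D τ P ∧ IsFactor h.inv h.aut h.aut_aut h.inv_aut e.1 P := by
  have : FiniteDimensional D W := FiniteDimensional.trans D E W
  have hadj : B.adjoint e.1.1 = e.1.1 := congrArg (fun l => l.1.1) h1
  obtain ⟨b, hb⟩ := B.exists_form_comp (η := 1) B.adjoint_one (fun _ => rfl) hc.q_i hc.i_q
    fun w => by rw [hadj]; exact hc.e_i w
  have hb' : ∀ w w', b.form w w' = B.form (i w) (i w') := hb
  have hsp : IsSpaceCorner e.1 (i.restrictScalars F) (q.restrictScalars F) δ :=
    { i_smul := fun d w => i.map_smul d w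
      q_smul := fun d v => q.map_smul d v
      x_i := fun w => (hx w).trans (i.map_smul δ w).symm
      q_x := fun v => by
        change q (x v) = δ • q v
        have h3 : e.1.1 (x v) = x (e.1.1 v) :=
          (centr_center_apply e (centerSelf F x).1 v).symm
        rw [← hc.q_e, h3, ← hc.i_q, hx, map_smul, hc.q_i]
      linear := fun c z w => by
        change q (c.1 (i (z • w))) = z • q (c.1 (i w))
        rw [map_smul, map_smul, map_smul]
      q_i := hc.q_i
      i_q := hc.i_q }
  obtain ⟨π, ι, hπ, hπ'⟩ := hsp.exists_isCornerMap fun c =>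
    (Subalgebra.mem_center_iff.1 e.2 c).symm
  have hπ'' : ∀ c w, π c w = q (c.1 (i w)) := hπ'
  have hη1 : η * η = 1 := LinearMap.ext hηη
  have hbη : b.adjoint η = η := b.adjoint_eq fun w w' => by
    rw [hb', hb', hiη, hiη, B.form_adjoint_left h.adjoint_ε]
  have hconj : ∀ a, conjInvolution F hη1 (conjInvolution F hη1 a) = a := fun a => by
    rw [conjInvolution_apply, conjInvolution_apply]
    calc η * (η * (a * η) * η) = η * η * a * (η * η) := by simp only [mul_assoc]
      _ = a := by rw [hη1, one_mul, mul_one]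
  have hfac : IsFactor h.inv h.aut h.aut_aut h.inv_aut e.1
      (SymmetricPair.unitaryAut b.adjointInvolution (conjInvolution F hη1) hconj fun a => by
        have hbη' : b.adjointInvolution.toLin η = η := hbη
        rw [conjInvolution_apply, conjInvolution_apply, AlgInvolution.map_mul,
          AlgInvolution.map_mul, hbη', mul_assoc]) := by
    refine isFactor_unitaryAut hπ _ _ _ _ (congrArg Subtype.val h1) (fun a => ?_) fun a =>
      LinearMap.ext fun w => ?_
    · refine (b.adjoint_eq fun w w' => ?_).symm
      rw [hπ'', hπ'', hb', hb', hc.i_q, hc.i_q, ← centr_center_apply, ← centr_center_apply, hc.e_i,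
        hc.e_i, h.coe_inv, B.adjoint_left]
    · rw [hπ'', hi, ← hπ'']
      rfl
  obtain ⟨κ, hκ1, hκκ, hbκ, hκη⟩ : ∃ κ : Module.End D W, κ ≠ 1 ∧ κ * κ = 1 ∧ b.adjoint κ = κ ∧
      ∀ a, κ * (a * κ) = η * (a * η) := by
    by_cases hη : η = 1
    · refine ⟨-1, fun h3 => ?_, by simp, b.adjoint_eq fun w w' => by simp, fun a => by simp [hη]⟩
      obtain ⟨v, hv⟩ : ∃ v, e.1.1 v ≠ 0 := by
        by_contra! hv
        exact he (Subtype.ext (Subtype.ext (LinearMap.ext hv)))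
      have h4 : -q v = q v := LinearMap.congr_fun h3 (q v)
      have h5 : (2 : D) • q v = 0 := by
        nth_rewrite 1 [two_smul, ← h4]
        exact neg_add_cancel _
      rw [smul_eq_zero_iff_right two_ne_zero] at h5
      exact hv (by rw [← hc.i_q, h5, map_zero])
    · exact ⟨η, hη, hη1, hbη, fun _ => rfl⟩
  obtain ⟨εW, hεW⟩ := exists_pointVal_eq (σ := b.adjointInvolution) hκκ hκκ hbκ
  have hord : orderOf εW = 2 := by
    refine orderOf_eq_prime (pointVal_injective ?_) fun h3 => hκ1 ?_
    · rw [sq, pointVal_mul, hεW, hκκ, pointVal_one]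
    · rw [← hεW, h3, pointVal_one]
  exact ⟨_, .innerU W b εW hord, hfac.inner εW _ fun a => by
    rw [conjInvolution_apply, hεW, hκη]⟩

end IsSymmetrized

end Factors

end

noncomputable section

/-! ## The decomposition of a descendant -/

theorem exists_isOrbitSum_family_of_finite (F : Type*) {L : Type*} [Field F] [CommRing L]
    [Algebra F L] [FiniteDimensional F L] [IsReduced L] (σ φ : L →+* L)
    (hσ : ∀ a, σ (σ a) = a) (hφ : ∀ a, φ (φ a) = a) (hσφ : ∀ a, σ (φ a) = φ (σ a)) :
    ∃ (n : ℕ) (f : Fin n → L), ∑ i, f i = 1 ∧ (∀ i, f i * f i = f i) ∧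
      (∀ i j, i ≠ j → f i * f j = 0) ∧
      ∀ i, ∃ e, IsFieldIdempotent e ∧ IsOrbitSum σ φ e (f i) :=
  have : IsArtinianRing L := IsArtinianRing.of_finite F L
  exists_isOrbitSum_family σ φ hσ hφ hσφ 1 (one_mul 1) (map_one σ) (map_one φ)

section Decomposition

variable {F D V : Type u} [Field F] [Field D] [Algebra F D] [AddCommGroup V] [Module D V]
  [Module F V] [IsScalarTower F D V] [FiniteDimensional D V] {τ : D ≃ₐ[F] D}
  {B : HermitianForm τ V} {x y ε : Module.End D V}

/-- The center of the centralizer of a semisimple endomorphism is reduced. -/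
theorem isReduced_center_centr (hx : x.IsSemisimple) :
    IsReduced (Subalgebra.center F (centr F x)) := by
  rw [isReduced_iff_pow_one_lt 2 one_lt_two]
  intro n hn
  have hnn : ∀ v, n.1.1 (n.1.1 v) = 0 := fun v =>
    LinearMap.congr_fun (congrArg (fun l => l.1.1) ((sq n).symm.trans hn)) v
  have hxn : ∀ v, x (n.1.1 v) = n.1.1 (x v) := centr_center_apply n (centerSelf F x).1
  have hker : LinearMap.ker n.1.1 ∈ x.invtSubmodule := by
    rw [Module.End.mem_invtSubmodule_iff_forall_mem_of_mem]
    intro v hv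
    rw [LinearMap.mem_ker] at hv ⊢
    rw [← hxn, hv, map_zero]
  obtain ⟨p, hp, hcompl⟩ := Module.End.isSemisimple_iff.1 hx _ hker
  let P : Module.End D V := Submodule.projection _ _ hcompl
  have hPx : x * P = P * x := by
    refine ((LinearMap.IsIdempotentElem.commute_iff
      (Submodule.isIdempotentElem_projection hcompl)).2 ⟨?_, ?_⟩).eq.symm
    · rw [Submodule.range_projection]
      exact hker
    · rw [Submodule.ker_projection]
      exact hp
  let a : centr F x := ⟨P, mem_centr.2 hPx⟩
  refine Subtype.ext (Subtype.ext (LinearMap.ext fun v => ?_))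
  have h1 : P (n.1.1 v) = n.1.1 (P v) := centr_center_apply n a v
  have h2 : P (n.1.1 v) = n.1.1 v :=
    Submodule.projection_apply_of_mem_left hcompl (LinearMap.mem_ker.2 (hnn v))
  have h3 : n.1.1 (P v) = 0 :=
    LinearMap.mem_ker.1 (Submodule.projection_apply_mem hcompl v)
  rw [← h2, h1, h3]
  rfl

namespace IsSymmetrized

variable (h : IsSymmetrized B x y ε)
include h

theorem exists_factor [FiniteDimensional F D] [CharZero D]
    {e f : Subalgebra.center F (centr F x)} (he : IsFieldIdempotent e)
    (hf : IsOrbitSum h.centerInv h.centerConj e f) :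
    ∃ P, IsListedPair F D τ P ∧ IsFactor h.inv h.aut h.aut_aut h.inv_aut f.1 P := by
  obtain ⟨E, _, _, _, _, _, W, _, _, _, _, _, _, _, _, ψ, i, q, hc⟩ := exists_isFieldCorner x he
  have : FiniteDimensional E W := Module.Finite.of_restrictScalars_finite D E W
  have he0 : e ≠ 0 := he.ne_zero
  cases hf with
  | fixed h1 h2 =>
    obtain ⟨c, η, hcψ, hcc, hη, hηη, hiη, hi⟩ := h.exists_semilinear hc h2
    by_cases hc1 : c = 1
    · obtain ⟨δ, -, hδ⟩ := h.exists_sign hc fun l => by rw [← hcψ, hc1]; rfl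
      exact h.exists_factor_innerU hc he0 h1 hδ hηη hiη hi
    · exact h.exists_factor_galoisU hc h1 hcψ hcc hη hηη hiη hi hc1
  | left h1 h2 => exact h.exists_factor_left hc h1 h2
  | right h1 h2 =>
    obtain ⟨c, η, hcψ, hcc, hη, hηη, hiη, hi⟩ := h.exists_semilinear hc h1
    by_cases hc1 : c = 1
    · obtain ⟨δ, hδ, hxδ⟩ := h.exists_sign hc fun l => by rw [← hcψ, hc1]; rfl
      exact (h.centerInv_mul_ne_zero hc he0 hδ hxδ h2).elim
    · exact h.exists_factor_galoisGL hc h2 hcc hη hηη hi hc1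
  | mixed h1 h2 => exact h.exists_factor_mixed hc h1 h2
  | free h1 h2 h3 => exact h.exists_factor_free hc h1 h2 h3

theorem exists_isomorphic_pi [FiniteDimensional F D] [CharZero D] (hx : x.IsSemisimple) :
    ∃ (n : ℕ) (P : Fin n → SymmetricPair F), (∀ i, IsListedPair F D τ (P i)) ∧
      (SymmetricPair.unitaryAut h.inv h.aut h.aut_aut h.inv_aut).Isomorphic
        (SymmetricPair.pi P) := by
  have : FiniteDimensional F (Module.End D V) := FiniteDimensional.trans F D _
  have := isReduced_center_centr (F := F) hx
  obtain ⟨n, f, h1, h2, h3, h4⟩ := exists_isOrbitSum_family_of_finite F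
    (L := Subalgebra.center F (centr F x)) h.centerInv h.centerConj h.centerInv_centerInv h.centerConj_centerConj h.centerInv_centerConj
  choose e he hf using h4
  choose P hP hfac using fun i => h.exists_factor (he i) (hf i)
  refine ⟨n, P, hP, isomorphic_pi_of_isFactor (fun i => (f i).1)
    (fun i c => (Subalgebra.mem_center_iff.1 (f i).2 c).symm) ?_
    (fun i => congrArg Subtype.val (h2 i)) (fun i j hij => congrArg Subtype.val (h3 i j hij))
    (fun i => congrArg Subtype.val ((hf i).spec (he i).idem h.centerInv_centerInv
      h.centerConj_centerConj h.centerInv_centerConj).2.1) P hfac⟩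
  have := congrArg (Subalgebra.center F (centr F x)).val h1
  rwa [map_sum] at this

end IsSymmetrized

end Decomposition

end

noncomputable section

theorem exists_isomorphic_pi_of_isDescendant {F D V : Type u} [Field F] [CharZero F] [Field D]
    [Algebra F D] [FiniteDimensional F D] {τ : D ≃ₐ[F] D} [AddCommGroup V] [Module D V]
    [Module F V] [IsScalarTower F D V] [FiniteDimensional D V] (B : HermitianForm τ V)
    (ε : (unitaryFunctor B.adjointInvolution).obj (CommAlgCat.of F F)) (hε : ε ^ 2 = 1)
    {Q : SymmetricPair F}
    (hQ : (SymmetricPair.inner (unitaryFunctor B.adjointInvolution) ε hε).IsDescendant Q) :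
    ∃ (n : ℕ) (P : Fin n → SymmetricPair F),
      (∀ i, IsListedPair F D τ (P i)) ∧ Q.Isomorphic (SymmetricPair.pi P) := by
  obtain ⟨(g : (unitaryFunctor B.adjointInvolution).obj (CommAlgCat.of F F)), hg, rfl⟩ := hQ
  have : CharZero D := charZero_of_injective_algebraMap (algebraMap F D).injective
  have : FiniteDimensional F (Module.End D V) := FiniteDimensional.trans F D _
  have hε1 : ε * ε = 1 := by rw [← sq, hε]
  have hsymm : ∀ z : (unitaryFunctor B.adjointInvolution).obj (CommAlgCat.of F F),
      (SymmetricPair.inner (unitaryFunctor B.adjointInvolution) ε hε).θ.app _ z = ε * z * ε := fun z =>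
    pointVal_injective ((pointVal_inner_θ ε hε z).trans
      ((pointVal_mul _ _).trans (congrArg (· * _) (pointVal_mul _ _))).symm)
  obtain ⟨x, hx⟩ : ∃ x : (unitaryFunctor B.adjointInvolution).obj (CommAlgCat.of F F),
    x = (SymmetricPair.inner (unitaryFunctor B.adjointInvolution) ε hε).symmetrization g := ⟨_, rfl⟩
  have hxθ : (SymmetricPair.inner (unitaryFunctor B.adjointInvolution) ε hε).θ.app _ x = x⁻¹ := by
    rw [hx]
    exact (SymmetricPair.inner (unitaryFunctor B.adjointInvolution) ε hε).θ_symmetrization g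
  have hxg : x = g * (ε * g⁻¹ * ε) := hx.trans (congrArg (g * ·) (hsymm _))
  have hss : IsSemisimpleElement F (pointVal B.adjointInvolution x) :=
    isSemisimpleElement_of_doubleCosetClosed ε hε g hg
      (fun hs h1 h2 h3 h4 h5 h6 h7 _ ht =>
        exists_unit_mul_eq hs.isSemisimple h1 h2 h3 h4 h5 h6 h7 ht) hxg
  have hsym : IsSymmetrized B (pointVal B.adjointInvolution x) (pointVal B.adjointInvolution x⁻¹)
      (pointVal B.adjointInvolution ε) :=
    { xy := by rw [← pointVal_mul, mul_inv_cancel, pointVal_one]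
      yx := by rw [← pointVal_mul, inv_mul_cancel, pointVal_one]
      εε := by rw [← pointVal_mul, hε1, pointVal_one]
      εx := by
        rw [← pointVal_mul, ← pointVal_mul, ← hsymm, hxθ]
      adjoint_x := toLin_pointVal x
      adjoint_ε := (toLin_pointVal ε).trans
        (congrArg _ (inv_eq_of_mul_eq_one_left hε1)) }
  obtain ⟨n, P, hP, hiso⟩ := hsym.exists_isomorphic_pi hss.isSemisimple
  refine ⟨n, P, hP, SymmetricPair.Isomorphic.trans ?_ hiso⟩
  subst hx
  exact centralizerPair_isomorphic ε hε _ hxθ rfl rfl hsym.xy hsym.yx hsym.εε hsym.εx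
    hsym.adjoint_x hsym.adjoint_ε

theorem mainTheorem11 {F : Type u} [NontriviallyNormedField F] [LocallyCompactSpace F] [CharZero F]
    {D : Type u} [Field D] [Algebra F D] [Algebra.IsQuadraticExtension F D]
    (τ : D ≃ₐ[F] D) (hτ : τ ≠ 1)
    {V : Type u} [AddCommGroup V] [Module D V] [Module F V] [IsScalarTower F D V]
    [FiniteDimensional D V] (B : HermitianForm τ V)
    (ε : (unitaryGroupFunctor B).obj (CommAlgCat.of F F)) (hε : orderOf ε = 2)
    (Q : SymmetricPair F)
    (hQ : (SymmetricPair.inner (unitaryGroupFunctor B) ε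
      (hε ▸ pow_orderOf_eq_one ε)).IsDescendant Q) :
    ∃ (n : ℕ) (P : Fin n → SymmetricPair F),
      (∀ i, IsListedPair F D τ (P i)) ∧ Q.Isomorphic (SymmetricPair.pi P) := by
  exact exists_isomorphic_pi_of_isDescendant B ε (hε ▸ pow_orderOf_eq_one ε) hQ

end
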